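/- **Setting.** Write $x=(x_1,x_2)$ for points of $\mathbf R^2$, $\sigma(x_1,x_2)=(-x_1,x_2)$, and $\pi(x,\xi)=x$. Let $V:\mathbf R^2\to\mathbf R$ be smooth with $V\circ\sigma=V$, let $q(x,\xi)=|\xi|^2-V(x)$, with Hamilton field $H_q=(2\xi,\nabla V)$; its integral curves are called bicharacteristics. Let $E>0$, and for $E'\in\mathbf R$ let $U_L(E')$, $U_R(E')$ be the connected components of $\{V\le E'\}$ containing $a_L$ and $a_R=\sigma(a_L)$, where $a_L$ lies in $\{x_1<0\}$. Assume that $\{V\le E\}$ is the disjoint union of $U_L(E)$ and $U_R(E)$, and that (model case) $V=\lambda_1^2z_1^2+\lambda_2^2z_2^2$ on a neighbourhood of $U_L(E)$, where $z$ are Cartesian orthonormal coordinates with origin $a_L$ and $0<\lambda_1<\lambda_2$; let $\zeta$ be the dual momenta. A *libration* of energy $E'$ is (the projection of) a periodic orbit of $H_q$ on $\{q=-E'\}$, of some period $2T'$, which is at rest on $\partial U_L(E')$ at time $0$, at rest on $\partial U_R(E')$ at time $T'$, and satisfies $V>E'$ at times in $(0,T')$. Assume that there is exactly one libration of energy $E$.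 Let $\gamma_E$ be its lift (the tunnel cycle), with end points $y_L\in\partial U_L(E)$ at time $0$ and $y_R\in\partial U_R(E)$ at time $T$. Assume that $\gamma_E$ is minimal, i.e. of least length between the wells for the Agmon metric $(V-E)_+dx^2$, that it is non-degenerate ($1$ is not an eigenvalue of the linearised flow over the period $2T$, acting on the tangent space of the energy surface modulo $H_q$), and that $z_1(y_L)\ne0\ne z_2(y_L)$. For $y$ near $y_L$, put $E(y)=V(y)$ and $2\iota_j(y)=\lambda_jz_j(y)^2$. Let $\widetilde\Lambda_L(y)$ be the part of $\{\zeta_j^2-\lambda_j^2z_j^2=-2\lambda_j\iota_j(y),\ j=1,2\}$ within distance $r$ of $(y_L,0)$. It is a piece of the complexified torus with umbilic $y$. Let $\widetilde\Lambda_R(y)$ be its mirror image near $(y_R,0)$ (same actions $\iota(y)$, umbilic $\sigma(y)$). The caustic of such a $\Lambda$ is the projection of the points at which $\Lambda$ has a nonzero vertical tangent vector; at $\widetilde\Lambda_L(y)$ (resp. $\widetilde\Lambda_R(y)$) its regular part is the complement of the umbilic. Extend $\widetilde\Lambda_L(y)$ along $\gamma_E$ by the flow of $H_q$ for times in $(-\delta,T+\delta)$,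 and $\widetilde\Lambda_R(y)$ for times in $(-T-\delta,\delta)$. In the same way let $\Lambda_{\partial,L}(y)$, $\Lambda_{\partial,R}(y)$ be the flow-outs, for the same times, of the parts of $\partial U_{L}(E(y))\times\{0\}$, $\partial U_R(E(y))\times\{0\}$ within distance $r$ of $(y_{L},0)$, $(y_R,0)$. **Claim.** For all sufficiently small $r,\delta>0$ and all $y$ sufficiently close to $y_L$ (depending on $r,\delta$) the following holds. 1. $\gamma(y)=\Lambda_{\partial,L}(y)\cap\Lambda_{\partial,R}(y)$ is a simple bicharacteristic arc in $\{q=-E(y)\}$. It lies on the lift of a libration of energy $E(y)$ and contains the part of this lift that goes from $\partial U_L(E(y))$ to $\partial U_R(E(y))$. Its projection is that libration, which is the only one of energy $E(y)$ that starts and ends within $r$ of $y_L$ and $y_R$ and takes a time less than $T+\delta$. The projection meets $\partial U_L(E(y))$ exactly at one point $y'(y)$ and $\partial U_R(E(y))$ exactly at $\sigma(y'(y))$. 2. The intersection $\widetilde\gamma(y)$ of the extensions of $\widetilde\Lambda_L(y)$ and $\widetilde\Lambda_R(y)$ is a tunnel bicharacteristic: a simple bicharacteristic arc in $\{q=-E(y)\}$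 containing points of $\widetilde\Lambda_L(y)$ and of $\widetilde\Lambda_R(y)$. It meets $\pi^{-1}(\{x_1=0\})$ in exactly one point, transversally, and $\pi(\widetilde\gamma(y))$ crosses $\{x_1=0\}$ orthogonally there. 3. If $y\neq y'(y)$, i.e. $y$ is not itself the end point of the libration of energy $E(y)$, then $\widetilde\gamma(y)$ projects, at some point of $\widetilde\Lambda_L(y)$ and at some point of $\widetilde\Lambda_R(y)$, onto a point of the regular part of the corresponding caustic, tangentially to the caustic and with nonzero velocity; moreover $\gamma(y)$ and $\widetilde\gamma(y)$ are disjoint. If $y=y'(y)$, then $\widetilde\gamma(y)$ contains $(y,0)$. -/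

import Mathlib

open scoped ContDiff

namespace Tunnel

/-- The configuration plane with its Euclidean structure. -/
abbrev Plane := EuclideanSpace ℝ (Fin 2)

/-- The phase space of pairs `(x, ξ)`. -/
abbrev Phase := Plane × Plane

/-- The reflection in the axis `{x₁ = 0}`; the coordinates `x₁, x₂` are `x 0, x 1`. -/
noncomputable def refl (x : Plane) : Plane := !₂[-x 0, x 1]

/-- The Hamiltonian with reversed potential `q(x, ξ) = ξ² - V(x)`. -/
noncomputable def symbolQ (V : Plane → ℝ) (ρ : Phase) : ℝ := ‖ρ.2‖ ^ 2 - V ρ.1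

/-- The Hamilton vector field `H_q = (∂q/∂ξ, -∂q/∂x) = (2ξ, ∇V)`. -/
noncomputable def hamField (V : Plane → ℝ) (ρ : Phase) : Phase :=
  ((2 : ℝ) • ρ.2, gradient V ρ.1)

/-- `c` is an integral curve of `H_q` at the times in `s`. -/
def IsBicharOn (V : Plane → ℝ) (c : ℝ → Phase) (s : Set ℝ) : Prop :=
  ∀ t ∈ s, HasDerivAt c (hamField V (c t)) t

/-- The potential well at energy `E` around `a`. -/
def well (V : Plane → ℝ) (E : ℝ) (a : Plane) : Set Plane :=
  connectedComponentIn {x | V x ≤ E} a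

/-- The points `exp(t H_q)(ρ)` with `ρ ∈ A` and `t ∈ I` (wherever the flow is defined). -/
def flowOut (V : Plane → ℝ) (A : Set Phase) (I : Set ℝ) : Set Phase :=
  {p | ∃ (c : ℝ → Phase) (t : ℝ),
    t ∈ I ∧ c 0 ∈ A ∧ IsBicharOn V c (Set.uIcc 0 t) ∧ c t = p}

/-- The set `∂U_E × {0}` for the well `U_E` around `a`. -/
def boundaryLift (V : Plane → ℝ) (E : ℝ) (a : Plane) : Set Phase :=
  {ρ | ρ.1 ∈ frontier (well V E a) ∧ ρ.2 = 0}

/-- The actions `ι = ι(y)` of the torus with umbilic `y`, for the harmonic well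
`∑ λ_j² z_j²`, `z_j = ⟪e_j, x - a⟫`. They satisfy `2 λ_j ι_j = λ_j² z_j(y)²`. -/
noncomputable def actions (lam : Fin 2 → ℝ) (e : Fin 2 → Plane) (a y : Plane) (j : Fin 2) : ℝ :=
  lam j * (inner ℝ (e j) (y - a)) ^ 2 / 2

/-- The leaf `ζ_j² - λ_j² z_j² = -2 λ_j ι_j`, `j = 1, 2`, of the integrable Hamiltonian
`ζ² - ∑ λ_j² z_j²`: the torus `ζ_j² + λ_j² z_j² = 2 λ_j ι_j` continued to imaginary time,
`(t, ζ) ↦ (i t, i ζ)`. -/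
def extTorus (lam : Fin 2 → ℝ) (e : Fin 2 → Plane) (a : Plane) (ι : Fin 2 → ℝ) : Set Phase :=
  {ρ | ∀ j, (inner ℝ (e j) ρ.2) ^ 2 - (lam j) ^ 2 * (inner ℝ (e j) (ρ.1 - a)) ^ 2
    = -(2 * lam j * ι j)}

/-- The caustic of a submanifold `Λ` of phase space: the projection of the points of `Λ` at which
some non-zero tangent vector is vertical. -/
def caustic (Λ : Set Phase) : Set Plane :=
  Prod.fst '' {ρ | ρ ∈ Λ ∧ ∃ η : Plane, η ≠ 0 ∧ ((0 : Plane), η) ∈ tangentConeAt ℝ Λ ρ}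

/-- `Γ` is a simple open arc of bicharacteristic of `q` in the energy surface `q = -E`. -/
def IsBicharArc (V : Plane → ℝ) (E : ℝ) (Γ : Set Phase) : Prop :=
  ∃ (c : ℝ → Phase) (J : Set ℝ), IsOpen J ∧ J.OrdConnected ∧ J.Nonempty ∧
    IsBicharOn V c J ∧ Set.InjOn c J ∧ (∀ t ∈ J, symbolQ V (c t) = -E) ∧ Γ = c '' J

/-- `Γ` is a tunnel bicharacteristic at energy `E`, putting points of `ΛL` and `ΛR` in
correspondence. -/
def IsTunnelBichar (V : Plane → ℝ) (E : ℝ) (ΛL ΛR Γ : Set Phase) : Prop :=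
  IsBicharArc V E Γ ∧ (∃ ρL ∈ Γ, ρL ∈ ΛL) ∧ ∃ ρR ∈ Γ, ρR ∈ ΛR

/-- `c` is the lift of a libration of energy `E` between the wells around `aL` and `aR`: a periodic
orbit of `H_q`, of period `2 T`, which is at rest on the boundary of the left well at time `0`, at
rest on the boundary of the right well at time `T`, and in the forbidden region in between. -/
structure IsLibration (V : Plane → ℝ) (aL aR : Plane) (E : ℝ) (c : ℝ → Phase) (T : ℝ) :
    Prop where
  pos : 0 < T
  bichar : IsBicharOn V c Set.univ
  periodic : Function.Periodic c (2 * T)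
  left : c 0 ∈ boundaryLift V E aL
  right : c T ∈ boundaryLift V E aR
  forbidden : ∀ t ∈ Set.Ioo 0 T, E < V (c t).1

/-- The length of `γ` on `[s, t]` for the Agmon metric `(V - E)₊ dx²`. -/
noncomputable def agmonLength (V : Plane → ℝ) (E : ℝ) (γ : ℝ → Plane) (s t : ℝ) : ℝ :=
  ∫ u in s..t, Real.sqrt (max (V (γ u) - E) 0) * ‖deriv γ u‖

/-- The libration `c` minimises Agmon length among the Lipschitz curves between the wells. -/
def IsMinimal (V : Plane → ℝ) (aL aR : Plane) (E : ℝ) (c : ℝ → Phase) (T : ℝ) : Prop :=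
  ∀ (γ : ℝ → Plane) (K : NNReal), LipschitzOnWith K γ (Set.Icc 0 1) →
    γ 0 ∈ well V E aL → γ 1 ∈ well V E aR →
    agmonLength V E (fun t => (c t).1) 0 T ≤ agmonLength V E γ 0 1

/-- Non-degeneracy of the periodic orbit `c` of period `P` in its energy surface: the linearised
flow over one period, on the tangent space of the energy surface modulo `H_q`, does not have the
eigenvalue `1`. -/
def IsNondegenerate (V : Plane → ℝ) (c : ℝ → Phase) (P : ℝ) : Prop :=
  ∀ W : ℝ → Phase,
    (∀ t ∈ Set.Icc 0 P, HasDerivAt W (fderiv ℝ (hamField V) (c t) (W t)) t) →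
    fderiv ℝ (symbolQ V) (c 0) (W 0) = 0 →
    (∃ k : ℝ, W P - W 0 = k • hamField V (c 0)) →
    ∃ k : ℝ, W 0 = k • hamField V (c 0)

/-- The symmetric double well potential, in the model case: `V` is smooth, symmetric in
`{x₁ = 0}`, `{V ≤ E}` consists of two wells, around `a` (on the left) and its mirror image, and `V`
is equal to `∑ λ_j² z_j²` near the left well, in Euclidean coordinates `z` with origin `a`. -/
structure IsDoubleWell (V : Plane → ℝ) (E : ℝ) (a : Plane) (lam : Fin 2 → ℝ)
    (e : OrthonormalBasis (Fin 2) ℝ Plane) : Prop where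
  smooth : ContDiff ℝ ∞ V
  symm : ∀ x, V (refl x) = V x
  pos : 0 < E
  on_left : a 0 < 0
  lam_pos : 0 < lam 0
  lam_lt : lam 0 < lam 1
  cover : {x | V x ≤ E} = well V E a ∪ well V E (refl a)
  disj : Disjoint (well V E a) (well V E (refl a))
  model : ∃ O : Set Plane, IsOpen O ∧ well V E a ⊆ O ∧
    ∀ x ∈ O, V x = ∑ j, (lam j) ^ 2 * (inner ℝ (e j) (x - a)) ^ 2

/-- `c` is the tunnel cycle at energy `E`: the lift of the only libration of that energy; it is
minimal and non-degenerate. -/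
structure IsMinimalTunnelCycle (V : Plane → ℝ) (a : Plane) (E : ℝ) (c : ℝ → Phase) (T : ℝ) :
    Prop where
  libration : IsLibration V a (refl a) E c T
  unique : ∀ (c₁ : ℝ → Phase) (T₁ : ℝ), IsLibration V a (refl a) E c₁ T₁ → c₁ 0 = c 0
  minimal : IsMinimal V a (refl a) E c T
  nondegenerate : IsNondegenerate V c (2 * T)

/-- The part of `Λ` within `r` of `ρ`. -/
def germ (Λ : Set Phase) (ρ : Phase) (r : ℝ) : Set Phase := Λ ∩ Metric.ball ρ r

/-- The left boundary flow-out at energy `E'`, along the tunnel cycle `c`. -/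
def boundaryL (V : Plane → ℝ) (a : Plane) (c : ℝ → Phase) (T r δ E' : ℝ) : Set Phase :=
  flowOut V (germ (boundaryLift V E' a) (c 0) r) (Set.Ioo (-δ) (T + δ))

/-- The right boundary flow-out at energy `E'`, along the tunnel cycle `c`. -/
def boundaryR (V : Plane → ℝ) (a : Plane) (c : ℝ → Phase) (T r δ E' : ℝ) : Set Phase :=
  flowOut V (germ (boundaryLift V E' (refl a)) (c T) r) (Set.Ioo (-(T + δ)) δ)

/-- The complexified left torus with umbilic `y`, near the left end point of the tunnel cycle. -/
def torusL (a : Plane) (lam : Fin 2 → ℝ) (e : OrthonormalBasis (Fin 2) ℝ Plane)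
    (c : ℝ → Phase) (r : ℝ) (y : Plane) : Set Phase :=
  germ (extTorus lam e a (actions lam e a y)) (c 0) r

/-- The complexified right torus with the same actions, hence with umbilic `refl y`, near the right
end point of the tunnel cycle. -/
def torusR (a : Plane) (lam : Fin 2 → ℝ) (e : OrthonormalBasis (Fin 2) ℝ Plane)
    (c : ℝ → Phase) (T r : ℝ) (y : Plane) : Set Phase :=
  germ (extTorus lam (fun j => refl (e j)) (refl a) (actions lam e a y)) (c T) r

/-- The extension of the left torus along the tunnel cycle by the flow of `q`. -/
def torusExtL (V : Plane → ℝ) (a : Plane) (lam : Fin 2 → ℝ)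
    (e : OrthonormalBasis (Fin 2) ℝ Plane) (c : ℝ → Phase) (T r δ : ℝ) (y : Plane) : Set Phase :=
  flowOut V (torusL a lam e c r y) (Set.Ioo (-δ) (T + δ))

/-- The extension of the right torus along the tunnel cycle by the flow of `q`. -/
def torusExtR (V : Plane → ℝ) (a : Plane) (lam : Fin 2 → ℝ)
    (e : OrthonormalBasis (Fin 2) ℝ Plane) (c : ℝ → Phase) (T r δ : ℝ) (y : Plane) : Set Phase :=
  flowOut V (torusR a lam e c T r y) (Set.Ioo (-(T + δ)) δ)

/-- `Γ` is the lift of the libration of energy `E'` near the tunnel cycle `c`. That libration is the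
only one that starts within `r` of the left end point of `c`, ends within `r` of the right one, and
takes a time less than `T + δ`. It starts at `y'`, and the projection of `Γ` meets the boundaries of
the wells exactly at `y'` and at its mirror image. -/
def IsLibrationLift (V : Plane → ℝ) (a : Plane) (c : ℝ → Phase) (T r δ E' : ℝ)
    (y' : Plane) (Γ : Set Phase) : Prop :=
  ∃ (c' : ℝ → Phase) (T' : ℝ),
    IsLibration V a (refl a) E' c' T' ∧
    c' 0 = (y', 0) ∧ c' T' = (refl y', 0) ∧
    c' 0 ∈ Metric.ball (c 0) r ∧ c' T' ∈ Metric.ball (c T) r ∧ T' < T + δ ∧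
    (∀ (c₁ : ℝ → Phase) (T₁ : ℝ), IsLibration V a (refl a) E' c₁ T₁ →
      c₁ 0 ∈ Metric.ball (c 0) r → c₁ T₁ ∈ Metric.ball (c T) r → T₁ < T + δ →
      c₁ = c' ∧ T₁ = T') ∧
    IsBicharArc V E' Γ ∧
    c' '' Set.Icc 0 T' ⊆ Γ ∧ Γ ⊆ Set.range c' ∧
    Prod.fst '' Γ = (fun t => (c' t).1) '' Set.Icc 0 T' ∧
    Prod.fst '' Γ ∩ frontier (well V E' a) = {y'} ∧
    Prod.fst '' Γ ∩ frontier (well V E' (refl a)) = {refl y'}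

/-- The set `Γ` meets `{x₁ = 0}` in a single point, transversally in phase space, and with an
orthogonal projection in the plane. -/
def CrossesAxisOrthogonally (V : Plane → ℝ) (Γ : Set Phase) : Prop :=
  ∃ σ : Phase, Γ ∩ {ρ | ρ.1 0 = 0} = {σ} ∧
    (hamField V σ).1 0 ≠ 0 ∧ (hamField V σ).1 1 = 0

/-- At some point of `Λ`, the bicharacteristic `Γ` projects onto a point of the caustic of `Λ` other
than the umbilic `y`, and the projection is tangent to the caustic there. -/
def TouchesRegularCaustic (V : Plane → ℝ) (Λ : Set Phase) (y : Plane) (Γ : Set Phase) : Prop :=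
  ∃ ρ ∈ Γ, ρ ∈ Λ ∧ ρ.1 ∈ caustic Λ ∧ ρ.1 ≠ y ∧
    (hamField V ρ).1 ≠ 0 ∧ (hamField V ρ).1 ∈ tangentConeAt ℝ (caustic Λ) ρ.1

end Tunnel

/-! Write `R` for `axisRev`, the map (x, ξ) ↦ (σx, −σξ). It reverses the flow of `H_q`, and its
fixed points, {x₁ = 0, ξ₂ = 0}, are the phase points over the axis whose velocity is orthogonal to
it or zero. The boundary lifts sit at ξ = 0 and the equations of the tori are even in ξ, so the
right-hand germs are the `R`-images of the left-hand ones. Both intersections are thus of the form Λ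
∩ RΛ, with Λ the flow-out of a surface germ at the left end of the cycle. An orbit of Λ through a
fixed point of `R` is `R`-invariant, which places an arc of it in Λ ∩ RΛ. Conversely, let an orbit
of Λ meet RΛ. Where it crosses the axis, at X, one has X = RX' with X' the crossing point of another
orbit of Λ; X and X' have the same position, and Λ projects injectively there, so X = X' is fixed by
`R`. Since Λ has only one orbit through the fixed set, Λ ∩ RΛ is an arc of it
(`IsTransversalFamily.exists_orbit`, `IsArcGerm.inter_eq`).

The two facts about Λ at the axis, injective projection and a unique orthogonal orbit, follow from
the implicit function theorem, uniformly in `y`, once the derivatives are invertible on the tunnel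
cycle. There non-degeneracy enters (`IsSymmetricCycle.transversal`): the tangent plane of Λ at the
left end is spanned by `H_q` and a vector that is even or odd under time reversal. Were one of the
derivatives singular, the linearised solution issued from that vector would also be even or odd
under `R` at the half period, modulo `H_q`; two reflections in time compose to a translation, and
the solution would be periodic modulo `H_q`. The cycle itself is `R`-symmetric because the libration
is unique, and it meets the axis only once per half period because it is minimal
(`IsMinimalTunnelCycle.isSymmetricCycle`).

Near the left end the potential is quadratic and the flow is explicit in cosh and sinh. For the
boundary germ, the orthogonal orbit passes through a point at rest, and time reversal together with
`R` makes it periodic: it is a libration (`isLibrationLift_inter`). For the torus germ, each degree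
of freedom of the orthogonal orbit comes to rest at its own time. If the two times differ, then at
the first one the orbit touches a regular branch of the caustic (`touchesAt_modelPoint`). If they
agree, the orbit passes through (y, 0) and is the libration. Finally, a point common to the two arcs
would force the two orbits, and hence their rest coordinates, to coincide. -/

namespace Tunnel

/-! ### Ordinary differential equations: global existence, uniqueness, differentiable dependence on
the data -/

section ODE

open Set Metric
open scoped NNReal

variable {E : Type*} [NormedAddCommGroup E] [NormedSpace ℝ E]

/-- A Lipschitz vector field that is bounded has solutions on any symmetric time interval. -/
theorem exists_solution_of_bounded [CompleteSpace E] {f : ℝ → E → E} {K : ℝ≥0} (hK : ∀ t, LipschitzWith K (f t))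
    (hc : ∀ x, Continuous fun t => f t x) {T : ℝ} (hT : 0 < T) {M : ℝ}
    (hM : ∀ t ∈ Icc (-T) T, ∀ x, ‖f t x‖ ≤ M) (x₀ : E) :
    ∃ γ : ℝ → E, γ 0 = x₀ ∧
      ∀ t ∈ Icc (-T) T, HasDerivWithinAt γ (f t (γ t)) (Icc (-T) T) t := by
  have hM0 : 0 ≤ M := (norm_nonneg _).trans (hM 0 ⟨by linarith, hT.le⟩ 0)
  have h : IsPicardLindelof f (⟨0, by constructor <;> linarith⟩ : Icc (-T) T) x₀
      (⟨M, hM0⟩ * ⟨T, hT.le⟩) 0 ⟨M, hM0⟩ K :=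
    { lipschitzOnWith := fun t _ => (hK t).lipschitzOnWith
      continuousOn := fun x _ => (hc x).continuousOn
      norm_le := fun t ht x _ => hM t ht x
      mul_max_le := by
        change M * max (T - 0) (0 - (-T)) ≤ M * T - 0
        simp }
  simpa using h.exists_eq_forall_mem_Icc_hasDerivWithinAt₀

/-- A cut-off of the identity: Lipschitz, bounded, equal to the identity on a large ball, and
norm decreasing. -/
theorem exists_identity_cutoff (E : Type*) [NormedAddCommGroup E] [NormedSpace ℝ E]
    [FiniteDimensional ℝ E] (B : ℝ) :
    ∃ (g : E → E) (C : ℝ≥0) (M : ℝ), LipschitzWith C g ∧ (∀ x, ‖g x‖ ≤ M) ∧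
      (∀ x, ‖g x‖ ≤ ‖x‖) ∧ ∀ x, ‖x‖ ≤ B → g x = x := by
  let χ : ContDiffBump (0 : E) := ⟨|B| + 1, |B| + 2, by positivity, by linarith⟩
  have hcs : HasCompactSupport fun x : E => χ x • x := χ.hasCompactSupport.smul_right
  have hcd : ContDiff ℝ 1 fun x : E => χ x • x := χ.contDiff.smul contDiff_id
  obtain ⟨C, hC⟩ := hcd.lipschitzWith_of_hasCompactSupport hcs one_ne_zero
  obtain ⟨M, hM⟩ := hcs.exists_bound_of_continuous hcd.continuous
  refine ⟨_, C, M, hC, hM, fun x => ?_, fun x hx => ?_⟩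
  · rw [norm_smul, Real.norm_of_nonneg χ.nonneg]
    exact mul_le_of_le_one_left (norm_nonneg _) χ.le_one
  · rw [χ.one_of_mem_closedBall, one_smul]
    simp only [mem_closedBall_zero_iff]
    change ‖x‖ ≤ |B| + 1
    linarith [le_abs_self B]

/-- Negative times reduce to positive ones by running `f` backwards, so the value at `0` controls
`f` on the whole symmetric interval. -/
theorem norm_le_gronwallBound_of_norm_deriv_le {f f' : ℝ → E} {δ K ε T : ℝ}
    (hδ : 0 ≤ δ) (hK : 0 ≤ K) (hε : 0 ≤ ε)
    (hf : ∀ t ∈ Icc (-T) T, HasDerivWithinAt f (f' t) (Icc (-T) T) t) (h0 : ‖f 0‖ ≤ δ)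
    (bound : ∀ t ∈ Icc (-T) T, ‖f' t‖ ≤ K * ‖f t‖ + ε) :
    ∀ t ∈ Icc (-T) T, ‖f t‖ ≤ gronwallBound δ K ε T := by
  have key : ∀ (g g' : ℝ → E), (∀ t ∈ Icc (-T) T, HasDerivWithinAt g (g' t) (Icc (-T) T) t) →
      ‖g 0‖ ≤ δ → (∀ t ∈ Icc (-T) T, ‖g' t‖ ≤ K * ‖g t‖ + ε) →
      ∀ t ∈ Icc 0 T, ‖g t‖ ≤ gronwallBound δ K ε T := by
    intro g g' hg hg0 hb t ht
    have hT : 0 ≤ T := ht.1.trans ht.2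
    have hsub : Icc 0 T ⊆ Icc (-T) T := Icc_subset_Icc_left (by linarith)
    refine (norm_le_gronwallBound_of_norm_deriv_right_le (f' := g') (a := 0) (b := T)
      (fun s hs => ((hg s (hsub hs)).continuousWithinAt.mono hsub)) (fun s hs => ?_) hg0
      (fun s hs => hb s (hsub ⟨hs.1, hs.2.le⟩)) t ht).trans ?_
    · refine (hg s (hsub ⟨hs.1, hs.2.le⟩)).mono_of_mem_nhdsWithin ?_
      exact Filter.mem_of_superset (Icc_mem_nhdsGE hs.2) (Icc_subset_Icc_left (by linarith [hs.1]))
    · exact gronwallBound_mono hδ hε hK (by linarith [ht.2])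
  intro t ht
  rcases le_total 0 t with h | h
  · exact key f f' hf h0 bound t ⟨h, ht.2⟩
  · have hneg : ∀ s ∈ Icc (-T) T, -s ∈ Icc (-T) T := fun s hs =>
      ⟨by linarith [hs.2], by linarith [hs.1]⟩
    have := key (fun s => f (-s)) (fun s => -f' (-s)) (fun s hs => ?_) (by simpa using h0)
      (fun s hs => by simpa using bound (-s) (hneg s hs)) (-t) ⟨by linarith, by linarith [ht.1]⟩
    · simpa using this
    · have h1 := (hf (-s) (hneg s hs)).scomp s ((hasDerivAt_neg s).hasDerivWithinAt (s := Icc (-T) T))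
        (fun u hu => hneg u hu)
      simpa [Function.comp_def] using h1

/-- A Lipschitz field grows at most linearly, so Grönwall bounds solutions a priori. The argument of
the field is cut off beyond that bound; as the cut-off decreases norms, the bound persists for the
modified equation, and its solution never meets the modification. -/
theorem exists_solution_Icc [FiniteDimensional ℝ E] {f : ℝ → E → E} {K : ℝ≥0}
    (hK : ∀ t, LipschitzWith K (f t)) (hc : ∀ x, Continuous fun t => f t x) {T : ℝ} (hT : 0 < T)
    (x₀ : E) :
    ∃ γ : ℝ → E, γ 0 = x₀ ∧
      ∀ t ∈ Icc (-T) T, HasDerivWithinAt γ (f t (γ t)) (Icc (-T) T) t := by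
  obtain ⟨M₀, hM₀⟩ := isCompact_Icc.exists_bound_of_continuousOn
    (s := Icc (-T) T) (hc 0).continuousOn
  have hM₀0 : 0 ≤ M₀ := (norm_nonneg _).trans (hM₀ 0 ⟨by linarith, hT.le⟩)
  obtain ⟨g, C, M, hgC, hgM, hgn, hgB⟩ :=
    exists_identity_cutoff E (gronwallBound ‖x₀‖ K M₀ T)
  have hlin : ∀ t ∈ Icc (-T) T, ∀ x, ‖f t x‖ ≤ K * ‖x‖ + M₀ := by
    intro t ht x
    have h1 := (hK t).norm_sub_le x 0
    have h2 := norm_sub_norm_le (f t x) (f t 0)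
    have h3 := hM₀ t ht
    rw [sub_zero] at h1
    linarith
  obtain ⟨γ, h0, hγ⟩ := exists_solution_of_bounded (f := fun t x => f t (g x))
    (fun t => (hK t).comp hgC) (fun x => hc (g x)) hT (M := K * M + M₀)
    (fun t ht x => (hlin t ht _).trans (by gcongr; exact hgM x)) x₀
  have hb := norm_le_gronwallBound_of_norm_deriv_le (norm_nonneg x₀) K.2 hM₀0 hγ (by rw [h0])
    (fun t ht => (hlin t ht _).trans (add_le_add_left (mul_le_mul_of_nonneg_left (hgn _) K.2) _))
  refine ⟨γ, h0, fun t ht => ?_⟩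
  have := hγ t ht
  rwa [hgB _ (hb t ht)] at this

/-- Global existence for globally Lipschitz time dependent vector fields. -/
theorem exists_global_solution [FiniteDimensional ℝ E] {f : ℝ → E → E} {K : ℝ≥0}
    (hK : ∀ t, LipschitzWith K (f t)) (hc : ∀ x, Continuous fun t => f t x) (x₀ : E) :
    ∃ γ : ℝ → E, γ 0 = x₀ ∧ ∀ t, HasDerivAt γ (f t (γ t)) t := by
  have hex : ∀ n : ℝ, ∃ γ : ℝ → E, γ 0 = x₀ ∧
      ∀ t ∈ Ioo (-(|n| + 1)) (|n| + 1), HasDerivAt γ (f t (γ t)) t := by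
    intro n
    obtain ⟨γ, h0, hγ⟩ := exists_solution_Icc hK hc (T := |n| + 1) (by positivity) x₀
    exact ⟨γ, h0, fun t ht => (hγ t (Ioo_subset_Icc_self ht)).hasDerivAt (Icc_mem_nhds ht.1 ht.2)⟩
  choose γ h0 hγ using hex
  have huniq : ∀ m n : ℝ, |m| ≤ |n| → EqOn (γ m) (γ n) (Ioo (-(|m| + 1)) (|m| + 1)) := by
    intro m n hmn
    refine ODE_solution_unique_of_mem_Ioo (t₀ := 0) (v := f) (s := fun _ => univ) (K := K)
      (fun t _ => (hK t).lipschitzOnWith) ⟨by linarith [abs_nonneg m], by positivity⟩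
      (fun t ht => ⟨hγ m t ht, trivial⟩) (fun t ht => ⟨hγ n t ⟨?_, ?_⟩, trivial⟩) (by rw [h0, h0])
    · linarith [ht.1]
    · linarith [ht.2]
  have habs : ∀ t : ℝ, t ∈ Ioo (-(|t| + 1)) (|t| + 1) := fun t =>
    ⟨by linarith [neg_abs_le t], by linarith [le_abs_self t]⟩
  refine ⟨fun t => γ t t, h0 0, fun t => ?_⟩
  refine (hγ t t (habs t)).congr_of_eventuallyEq ?_
  filter_upwards [Ioo_mem_nhds (habs t).1 (habs t).2] with s hs
  rcases le_total |s| |t| with h | h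
  · exact huniq s t h (habs s)
  · exact (huniq t s h hs).symm

/-- Two integral curves of a `C¹` vector field on a compact interval agree if they agree at one
point of it. -/
theorem eqOn_Icc_of_contDiff [FiniteDimensional ℝ E] {F : E → E} (hF : ContDiff ℝ 1 F) {f g : ℝ → E}
    {a b t₀ : ℝ} (ht₀ : t₀ ∈ Icc a b) (hf : ∀ t ∈ Icc a b, HasDerivAt f (F (f t)) t)
    (hg : ∀ t ∈ Icc a b, HasDerivAt g (F (g t)) t) (h : f t₀ = g t₀) : EqOn f g (Icc a b) := by
  have hfc : ContinuousOn f (Icc a b) := fun t ht => (hf t ht).continuousAt.continuousWithinAt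
  have hgc : ContinuousOn g (Icc a b) := fun t ht => (hg t ht).continuousAt.continuousWithinAt
  obtain ⟨R, hR⟩ := ((isCompact_Icc.image_of_continuousOn hfc).union
    (isCompact_Icc.image_of_continuousOn hgc)).isBounded.subset_closedBall 0
  have hfR : ∀ t ∈ Icc a b, f t ∈ closedBall 0 R := fun t ht => hR (Or.inl ⟨t, ht, rfl⟩)
  have hgR : ∀ t ∈ Icc a b, g t ∈ closedBall 0 R := fun t ht => hR (Or.inr ⟨t, ht, rfl⟩)
  obtain ⟨K, hK⟩ := hF.contDiffOn.exists_lipschitzOnWith one_ne_zero (convex_closedBall (0 : E) R)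
    (isCompact_closedBall 0 R)
  have hl : Icc a t₀ ⊆ Icc a b := Icc_subset_Icc_right ht₀.2
  have hr : Icc t₀ b ⊆ Icc a b := Icc_subset_Icc_left ht₀.1
  rw [← Icc_union_Icc_eq_Icc ht₀.1 ht₀.2]
  refine EqOn.union ?_ ?_
  · have hs : Ioc a t₀ ⊆ Icc a b := Ioc_subset_Icc_self.trans hl
    exact ODE_solution_unique_of_mem_Icc_left (v := fun _ => F) (s := fun _ => closedBall 0 R)
      (fun _ _ => hK) (hfc.mono hl) (fun t ht => (hf t (hs ht)).hasDerivWithinAt)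
      (fun t ht => hfR t (hs ht)) (hgc.mono hl) (fun t ht => (hg t (hs ht)).hasDerivWithinAt)
      (fun t ht => hgR t (hs ht)) h
  · have hs : Ico t₀ b ⊆ Icc a b := Ico_subset_Icc_self.trans hr
    exact ODE_solution_unique_of_mem_Icc_right (v := fun _ => F) (s := fun _ => closedBall 0 R)
      (fun _ _ => hK) (hfc.mono hr) (fun t ht => (hf t (hs ht)).hasDerivWithinAt)
      (fun t ht => hfR t (hs ht)) (hgc.mono hr) (fun t ht => (hg t (hs ht)).hasDerivWithinAt)
      (fun t ht => hgR t (hs ht)) h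

theorem eq_of_contDiff [FiniteDimensional ℝ E] {F : E → E} (hF : ContDiff ℝ 1 F) {f g : ℝ → E}
    (t₀ : ℝ) (hf : ∀ t, HasDerivAt f (F (f t)) t)
    (hg : ∀ t, HasDerivAt g (F (g t)) t) (h : f t₀ = g t₀) : f = g := by
  funext t
  exact eqOn_Icc_of_contDiff hF (a := min t t₀) (b := max t t₀) ⟨min_le_right _ _, le_max_right _ _⟩
    (fun s _ => hf s) (fun s _ => hg s) h ⟨min_le_left _ _, le_max_left _ _⟩

/-- Integral curves of a Lipschitz vector field depend in a Lipschitz way on their initial data. -/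
theorem norm_sub_le_of_integralCurves {F : E → E} {K : ℝ≥0} (hK : LipschitzWith K F)
    {f g : ℝ → E} (hf : ∀ t, HasDerivAt f (F (f t)) t) (hg : ∀ t, HasDerivAt g (F (g t)) t)
    {T t : ℝ} (ht : t ∈ Icc (-T) T) :
    ‖f t - g t‖ ≤ ‖f 0 - g 0‖ * Real.exp (K * T) := by
  have := norm_le_gronwallBound_of_norm_deriv_le (f := fun t => f t - g t)
    (f' := fun t => F (f t) - F (g t)) (norm_nonneg (f 0 - g 0)) K.2 le_rfl
    (fun s _ => ((hf s).sub (hg s)).hasDerivWithinAt) le_rfl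
    (fun s _ => by simpa using hK.norm_sub_le (f s) (g s)) t ht
  rwa [gronwallBound_ε0] at this

/-- Differentiable dependence on the initial data: the time `T` flow of a `C¹` vector field is
strictly differentiable, with derivative given by the linearised equation. -/
theorem hasStrictFDerivAt_flow [FiniteDimensional ℝ E] {F : E → E} (hF : ContDiff ℝ 1 F) {K : ℝ≥0}
    (hK : LipschitzWith K F) {Φ : ℝ → E → E} (h0 : ∀ x, Φ 0 x = x)
    (hΦ : ∀ x t, HasDerivAt (fun t => Φ t x) (F (Φ t x)) t) (x₀ : E) {T : ℝ} (hT : 0 ≤ T) :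
    ∃ L : E →L[ℝ] E, HasStrictFDerivAt (Φ T) L x₀ ∧
      ∀ W : ℝ → E, (∀ t, HasDerivAt W (fderiv ℝ F (Φ t x₀) (W t)) t) → W T = L (W 0) := by
  have hA : ∀ t, ‖fderiv ℝ F (Φ t x₀)‖ ≤ K := fun t => norm_fderiv_le_of_lipschitz ℝ hK
  have hAL : ∀ t, LipschitzWith K (fun w => fderiv ℝ F (Φ t x₀) w) := fun t =>
    (fderiv ℝ F (Φ t x₀)).lipschitz.weaken (hA t)
  have hcont : Continuous fun t => Φ t x₀ :=
    continuous_iff_continuousAt.2 fun t => (hΦ x₀ t).continuousAt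
  have hfc : Continuous (fderiv ℝ F) := hF.continuous_fderiv one_ne_zero
  have hex : ∀ w, ∃ W : ℝ → E, W 0 = w ∧ ∀ t, HasDerivAt W (fderiv ℝ F (Φ t x₀) (W t)) t :=
    fun w => exists_global_solution hAL (fun w => (hfc.comp hcont).clm_apply continuous_const) w
  choose S hS0 hS using hex
  have huniq : ∀ W : ℝ → E, (∀ t, HasDerivAt W (fderiv ℝ F (Φ t x₀) (W t)) t) → W = S (W 0) :=
    fun W hW => ODE_solution_unique_univ (t₀ := 0) (v := fun t w => fderiv ℝ F (Φ t x₀) w)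
      (s := fun _ => univ) (fun t => (hAL t).lipschitzOnWith) (fun t => ⟨hW t, trivial⟩)
      (fun t => ⟨hS _ t, trivial⟩) (hS0 _).symm
  have hadd : ∀ v w, S (v + w) = fun t => S v t + S w t := by
    intro v w
    have := huniq (fun t => S v t + S w t) fun t => by
      simpa using (hS v t).fun_add (hS w t)
    simpa [hS0] using this.symm
  have hsmul : ∀ (k : ℝ) w, S (k • w) = fun t => k • S w t := by
    intro k w
    have := huniq (fun t => k • S w t) fun t => by
      simpa using (hS w t).fun_const_smul k
    simpa [hS0] using this.symm
  let L₀ : E →ₗ[ℝ] E :=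
    { toFun := fun w => S w T
      map_add' := fun v w => by rw [hadd]
      map_smul' := fun k w => by rw [hsmul]; rfl }
  refine ⟨LinearMap.toContinuousLinearMap L₀, ?_, fun W hW => congrFun (huniq W hW) T⟩
  rw [hasStrictFDerivAt_iff_isLittleO, Asymptotics.isLittleO_iff]
  intro ε hε
  set C := Real.exp (K * T) with hC
  have hCpos : 0 < C := Real.exp_pos _
  set G := gronwallBound 0 K 1 T with hG
  have hG0 : 0 ≤ G := by
    have := gronwallBound_mono (δ := 0) (K := K) (ε := 1) le_rfl zero_le_one K.2 hT
    rwa [gronwallBound_x0] at this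
  -- `C` bounds the growth of the distance between two orbits and `G` is the Grönwall factor for a
  -- unit forcing term; the `+ 1` keeps the divisor positive.
  set ε' := ε / (C * (G + 1)) with hε'
  have hε'pos : 0 < ε' := by positivity
  -- Compactness of the orbit segment gives one radius within which the derivative of `F` varies by
  -- less than `ε'`, for all times at once.
  have hunif := (isCompact_Icc (a := (0 : ℝ)) (b := T)).image_of_continuousOn
    hcont.continuousOn |>.uniformContinuousAt_of_continuousAt (fderiv ℝ F)
      (fun p _ => hfc.continuousAt) (dist_mem_uniformity hε'pos)
  obtain ⟨d, hd, hdF⟩ := mem_uniformity_dist.1 hunif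
  have hnear : ∀ᶠ p : E × E in nhds (x₀, x₀),
      ‖x₀ - p.1‖ * C < d ∧ ‖x₀ - p.2‖ * C < d := by
    refine Filter.Eventually.and ?_ ?_
    · refine (Continuous.tendsto (by fun_prop) _).eventually_lt_const
        (f := fun p : E × E => ‖x₀ - p.1‖ * C) ?_
      simpa using hd
    · refine (Continuous.tendsto (by fun_prop) _).eventually_lt_const
        (f := fun p : E × E => ‖x₀ - p.2‖ * C) ?_
      simpa using hd
  filter_upwards [hnear] with ⟨x, y⟩ ⟨hx, hy⟩
  have hTI : ∀ t ∈ Icc 0 T, t ∈ Icc (-T) T := fun t ht => ⟨by linarith [ht.1], ht.2⟩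
  have hclose : ∀ z, ‖x₀ - z‖ * C < d → ∀ t ∈ Icc 0 T, Φ t z ∈ ball (Φ t x₀) d := by
    intro z hz t ht
    have := norm_sub_le_of_integralCurves hK (hΦ x₀) (hΦ z) (hTI t ht)
    rw [h0, h0] at this
    rw [mem_ball, dist_comm, dist_eq_norm]
    exact this.trans_lt hz
  -- Grönwall is applied to the defect of linearity, which vanishes at time `0` and is forced by the
  -- first-order Taylor error of `F` between two nearby orbits.
  have hD := norm_le_gronwallBound_of_norm_deriv_right_le (a := 0) (b := T)
    (f := fun t => Φ t x - Φ t y - S (x - y) t) (δ := 0) (K := K) (ε := ε' * (‖x - y‖ * C))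
    (f' := fun t => F (Φ t x) - F (Φ t y) - fderiv ℝ F (Φ t x₀) (S (x - y) t))
    (fun t _ => (((hΦ x t).sub (hΦ y t)).sub (hS (x - y) t)).continuousAt.continuousWithinAt)
    (fun t _ => (((hΦ x t).sub (hΦ y t)).sub (hS (x - y) t)).hasDerivWithinAt)
    (by simp [h0, hS0]) (fun t ht => ?_) T ⟨hT, le_rfl⟩
  · have hlin : gronwallBound 0 K (ε' * (‖x - y‖ * C)) (T - 0) = ε' * (‖x - y‖ * C) * G := by
      rw [hG, sub_zero]
      unfold gronwallBound
      split_ifs <;> ring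
    rw [hlin] at hD
    refine hD.trans ?_
    have : ε' * (C * (G + 1)) = ε := by
      rw [hε']
      field_simp
    calc ε' * (‖x - y‖ * C) * G ≤ ε' * (‖x - y‖ * C) * (G + 1) := by gcongr; linarith
      _ = (ε' * (C * (G + 1))) * ‖x - y‖ := by ring
      _ = ε * ‖x - y‖ := by rw [this]
  · have ht' : t ∈ Icc 0 T := ⟨ht.1, ht.2.le⟩
    have h1 := (convex_ball (Φ t x₀) d).norm_image_sub_le_of_norm_fderiv_le'
      (f := F) (𝕜 := ℝ) (φ := fderiv ℝ F (Φ t x₀)) (C := ε')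
      (fun p _ => (hF.differentiable one_ne_zero).differentiableAt) (fun p hp => ?_)
      (hclose y hy t ht') (hclose x hx t ht')
    · have h2 := norm_sub_le_of_integralCurves hK (hΦ x) (hΦ y) (hTI t ht')
      rw [h0, h0] at h2
      have h3 := (fderiv ℝ F (Φ t x₀)).le_of_opNorm_le (hA t) (Φ t x - Φ t y - S (x - y) t)
      have h4 : F (Φ t x) - F (Φ t y) - fderiv ℝ F (Φ t x₀) (S (x - y) t) =
          (F (Φ t x) - F (Φ t y) - fderiv ℝ F (Φ t x₀) (Φ t x - Φ t y)) +
            fderiv ℝ F (Φ t x₀) (Φ t x - Φ t y - S (x - y) t) := by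
        rw [map_sub (fderiv ℝ F (Φ t x₀)) (Φ t x - Φ t y)]
        abel
      rw [h4, add_comm]
      refine (norm_add_le _ _).trans (add_le_add h3 (h1.trans ?_))
      gcongr
    · have h5 := @hdF (Φ t x₀) p (by rw [dist_comm]; exact hp) ⟨t, ht', rfl⟩
      rw [← dist_eq_norm, dist_comm]
      exact le_of_lt h5

end ODE

/-! ### The reflection, time reversal, and their effect on the Hamilton field -/

section Symmetry

open Set

@[simp] theorem refl_apply_zero (x : Plane) : refl x 0 = -x 0 := by simp [refl]

@[simp] theorem refl_apply_one (x : Plane) : refl x 1 = x 1 := by simp [refl]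

@[simp] theorem refl_refl (x : Plane) : refl (refl x) = x := by
  ext i; fin_cases i <;> simp

/-- The reflection as a linear isometry. -/
noncomputable def reflL : Plane ≃ₗᵢ[ℝ] Plane where
  toFun := refl
  invFun := refl
  left_inv := refl_refl
  right_inv := refl_refl
  map_add' x y := by
    change refl (x + y) = refl x + refl y
    ext i; fin_cases i <;> simp; ring
  map_smul' k x := by
    change refl (k • x) = k • refl x
    ext i; fin_cases i <;> simp
  norm_map' x := by
    change ‖refl x‖ = ‖x‖
    simp [EuclideanSpace.norm_eq, Fin.sum_univ_two]

@[simp] theorem reflL_apply (x : Plane) : reflL x = refl x := rfl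

@[simp] theorem norm_refl (x : Plane) : ‖refl x‖ = ‖x‖ := reflL.norm_map x

@[simp] theorem inner_refl_refl (x y : Plane) : inner ℝ (refl x) (refl y) = inner ℝ x y :=
  reflL.inner_map_map x y

theorem refl_sub (x y : Plane) : refl (x - y) = refl x - refl y := reflL.map_sub x y

theorem refl_neg (x : Plane) : refl (-x) = -refl x := reflL.map_neg x

theorem refl_smul (k : ℝ) (x : Plane) : refl (k • x) = k • refl x := reflL.map_smul k x

theorem refl_injective : Function.Injective refl := reflL.injective

/-- Time reversal `(x, ξ) ↦ (x, -ξ)`. -/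
noncomputable def timeRev : Phase →L[ℝ] Phase :=
  (ContinuousLinearMap.fst ℝ Plane Plane).prod (-ContinuousLinearMap.snd ℝ Plane Plane)

/-- The reflection composed with time reversal, `(x, ξ) ↦ (σ x, -σ ξ)`. -/
noncomputable def axisRev : Phase →L[ℝ] Phase :=
  ((reflL : Plane →L[ℝ] Plane).comp (ContinuousLinearMap.fst ℝ Plane Plane)).prod
    (-(reflL : Plane →L[ℝ] Plane).comp (ContinuousLinearMap.snd ℝ Plane Plane))

@[simp] theorem timeRev_apply (ρ : Phase) : timeRev ρ = (ρ.1, -ρ.2) := rfl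

@[simp] theorem axisRev_apply (ρ : Phase) : axisRev ρ = (refl ρ.1, -refl ρ.2) := rfl

theorem timeRev_timeRev (ρ : Phase) : timeRev (timeRev ρ) = ρ := by simp

theorem axisRev_axisRev (ρ : Phase) : axisRev (axisRev ρ) = ρ := by simp [refl_neg]

theorem axisRev_timeRev (ρ : Phase) : axisRev (timeRev ρ) = timeRev (axisRev ρ) := by
  simp [refl_neg]

theorem norm_axisRev (ρ : Phase) : ‖axisRev ρ‖ = ‖ρ‖ := by simp [Prod.norm_def]

theorem dist_axisRev (ρ ρ' : Phase) : dist (axisRev ρ) (axisRev ρ') = dist ρ ρ' := by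
  rw [dist_eq_norm, dist_eq_norm, ← map_sub, norm_axisRev]

variable {V : Plane → ℝ}

theorem inner_gradient (x u : Plane) : inner ℝ (gradient V x) u = fderiv ℝ V x u := by
  simp [gradient]

theorem gradient_refl (hV : ContDiff ℝ ∞ V) (hs : ∀ x, V (refl x) = V x) (x : Plane) :
    gradient V (refl x) = refl (gradient V x) := by
  refine ext_inner_right ℝ fun u => ?_
  have hd : Differentiable ℝ V := hV.differentiable (by simp)
  have h1 : HasFDerivAt (fun x => V (refl x))
      ((fderiv ℝ V (refl x)).comp (reflL : Plane →L[ℝ] Plane)) x :=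
    (hd (refl x)).hasFDerivAt.comp x (reflL : Plane →L[ℝ] Plane).hasFDerivAt
  simp only [hs] at h1
  have h2 := h1.unique (hd x).hasFDerivAt
  have h3 : inner ℝ (refl (gradient V x)) u = inner ℝ (gradient V x) (refl u) := by
    rw [← inner_refl_refl, refl_refl]
  rw [h3, inner_gradient, inner_gradient, ← h2]
  simp

theorem contDiff_gradient (hV : ContDiff ℝ ∞ V) : ContDiff ℝ ∞ (gradient V) := by
  have h : ContDiff ℝ ∞ (fderiv ℝ V) := hV.fderiv_right (by simp)
  exact ((InnerProductSpace.toDual ℝ Plane).symm.toContinuousLinearEquiv :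
    StrongDual ℝ Plane ≃L[ℝ] Plane).contDiff.comp h

theorem contDiff_hamField (hV : ContDiff ℝ ∞ V) : ContDiff ℝ ∞ (hamField V) :=
  (contDiff_snd.const_smul (2 : ℝ)).prodMk ((contDiff_gradient hV).comp contDiff_fst)

theorem hamField_timeRev (ρ : Phase) : hamField V (timeRev ρ) = -timeRev (hamField V ρ) := by
  simp [hamField]

/-- The reflection preserves the field and time reversal changes its sign, so the composite carries
orbits to orbits run backwards. -/
theorem hamField_axisRev (hV : ContDiff ℝ ∞ V) (hs : ∀ x, V (refl x) = V x) (ρ : Phase) :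
    hamField V (axisRev ρ) = -axisRev (hamField V ρ) := by
  simp [hamField, gradient_refl hV hs, refl_smul]

theorem contDiff_symbolQ (hV : ContDiff ℝ ∞ V) : ContDiff ℝ ∞ (symbolQ V) :=
  (contDiff_snd.norm_sq ℝ).sub (hV.comp contDiff_fst)

theorem hasFDerivAt_symbolQ (hV : ContDiff ℝ ∞ V) (ρ : Phase) :
    HasFDerivAt (symbolQ V) ((2 • innerSL ℝ ρ.2).comp (ContinuousLinearMap.snd ℝ Plane Plane) -
      (fderiv ℝ V ρ.1).comp (ContinuousLinearMap.fst ℝ Plane Plane)) ρ := by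
  have hd : Differentiable ℝ V := hV.differentiable (by simp)
  exact ((hasStrictFDerivAt_norm_sq ρ.2).hasFDerivAt.comp ρ hasFDerivAt_snd).sub
    ((hd ρ.1).hasFDerivAt.comp ρ hasFDerivAt_fst)

theorem fderiv_symbolQ_apply (hV : ContDiff ℝ ∞ V) (ρ w : Phase) :
    fderiv ℝ (symbolQ V) ρ w = 2 * inner ℝ ρ.2 w.2 - inner ℝ (gradient V ρ.1) w.1 := by
  rw [(hasFDerivAt_symbolQ hV ρ).fderiv, inner_gradient]
  simp

theorem fderiv_symbolQ_hamField (hV : ContDiff ℝ ∞ V) (ρ : Phase) :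
    fderiv ℝ (symbolQ V) ρ (hamField V ρ) = 0 := by
  rw [fderiv_symbolQ_apply hV]
  simp [hamField, inner_smul_right]

end Symmetry

/-! ### A complete flow that agrees with that of `H_q` near a periodic orbit -/

section Flow

open Set

variable {V : Plane → ℝ}

/-- A smooth cut-off on phase space, invariant under the symmetries. -/
noncomputable def cutoff (M : ℝ) (ρ : Phase) : ℝ :=
  Real.smoothTransition (M + 1 - (‖ρ.1‖ ^ 2 + ‖ρ.2‖ ^ 2))

/-- The Hamilton field, cut off outside of a large ball. -/
noncomputable def cutField (V : Plane → ℝ) (M : ℝ) (ρ : Phase) : Phase :=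
  cutoff M ρ • hamField V ρ

/-- The region on which the field is not modified. -/
def plateau (M : ℝ) : Set Phase := {ρ | ‖ρ.1‖ ^ 2 + ‖ρ.2‖ ^ 2 < M}

theorem isOpen_plateau (M : ℝ) : IsOpen (plateau M) :=
  isOpen_lt (by fun_prop) continuous_const

theorem cutField_of_mem {M : ℝ} {ρ : Phase} (h : ρ ∈ plateau M) : cutField V M ρ = hamField V ρ := by
  have h' : ‖ρ.1‖ ^ 2 + ‖ρ.2‖ ^ 2 < M := h
  rw [cutField, cutoff, Real.smoothTransition.one_of_one_le (by linarith), one_smul]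

theorem contDiff_cutField (hV : ContDiff ℝ ∞ V) (M : ℝ) : ContDiff ℝ ∞ (cutField V M) := by
  have h : ContDiff ℝ ∞ (cutoff M) := Real.smoothTransition.contDiff.comp (contDiff_const.sub
    ((contDiff_fst.norm_sq ℝ).add (contDiff_snd.norm_sq ℝ)))
  exact h.smul (contDiff_hamField hV)

theorem hasCompactSupport_cutField (V : Plane → ℝ) (M : ℝ) : HasCompactSupport (cutField V M) := by
  refine HasCompactSupport.intro (isCompact_closedBall (0 : Phase) (|M| + 1)) fun ρ hρ => ?_
  rw [cutField, cutoff, Real.smoothTransition.zero_of_nonpos, zero_smul]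
  rw [mem_closedBall_zero_iff, not_le, Prod.norm_def, lt_max_iff] at hρ
  have h0 := abs_nonneg M
  have h1 := le_abs_self M
  rcases hρ with h | h <;> nlinarith [norm_nonneg ρ.1, norm_nonneg ρ.2]

theorem cutField_timeRev (M : ℝ) (ρ : Phase) :
    cutField V M (timeRev ρ) = -timeRev (cutField V M ρ) := by
  rw [cutField, cutField, hamField_timeRev, map_smul, smul_neg]
  simp [cutoff]

theorem cutField_axisRev (hV : ContDiff ℝ ∞ V) (hs : ∀ x, V (refl x) = V x) (M : ℝ) (ρ : Phase) :
    cutField V M (axisRev ρ) = -axisRev (cutField V M ρ) := by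
  rw [cutField, cutField, hamField_axisRev hV hs, map_smul, smul_neg]
  simp [cutoff]

/-- `Φ` is a complete flow, compatible with the symmetries, that coincides with the flow of `H_q`
on a neighbourhood `Ω` of the orbit `c`. -/
structure IsLocalFlow (V : Plane → ℝ) (c : ℝ → Phase) (Φ : ℝ → Phase → Phase) (Ω : Set Phase) :
    Prop where
  zero : ∀ ρ, Φ 0 ρ = ρ
  add : ∀ s t ρ, Φ (s + t) ρ = Φ s (Φ t ρ)
  timeRev_eq : ∀ t ρ, Φ t (timeRev ρ) = timeRev (Φ (-t) ρ)
  axisRev_eq : ∀ t ρ, Φ t (axisRev ρ) = axisRev (Φ (-t) ρ)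
  orbit : ∀ t, Φ t (c 0) = c t
  isOpen : IsOpen Ω
  mem : ∀ t, c t ∈ Ω
  axisRev_mem : ∀ ρ ∈ Ω, axisRev ρ ∈ Ω
  bichar : ∀ ρ t, Φ t ρ ∈ Ω → HasDerivAt (fun t => Φ t ρ) (hamField V (Φ t ρ)) t
  energy : ∀ t ρ, symbolQ V (Φ t ρ) = symbolQ V ρ
  close : ∀ M ε : ℝ, 0 < ε → ∀ᶠ ρ in nhds (c 0), ∀ t ∈ Icc (-M) M, dist (Φ t ρ) (c t) < ε
  continuous_time : ∀ ρ, Continuous fun t => Φ t ρ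
  continuous_space : ∀ t, Continuous (Φ t)
  linearised : ∀ w, ∃ W : ℝ → Phase, W 0 = w ∧
    ∀ t, HasDerivAt W (fderiv ℝ (hamField V) (c t) (W t)) t
  linearised_unique : ∀ (W₁ W₂ : ℝ → Phase) (s : ℝ),
    (∀ t, HasDerivAt W₁ (fderiv ℝ (hamField V) (c t) (W₁ t)) t) →
    (∀ t, HasDerivAt W₂ (fderiv ℝ (hamField V) (c t) (W₂ t)) t) → W₁ s = W₂ s → W₁ = W₂
  strict : ∀ T, 0 ≤ T → ∃ L : Phase →L[ℝ] Phase, HasStrictFDerivAt (Φ T) L (c 0) ∧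
    ∀ W : ℝ → Phase, (∀ t, HasDerivAt W (fderiv ℝ (hamField V) (c t) (W t)) t) → W T = L (W 0)

/-- A periodic orbit is bounded, so the field can be cut off outside a ball-like region containing
it and becomes complete. The cut-off depends on the norms of x and ξ only, which keeps both
symmetries; the new field is a multiple of `H_q`, so energy is conserved everywhere and not just on
`Ω`. -/
theorem exists_isLocalFlow (hV : ContDiff ℝ ∞ V) (hs : ∀ x, V (refl x) = V x) {c : ℝ → Phase}
    (hc : IsBicharOn V c univ) {P : ℝ} (hP : 0 < P) (hper : Function.Periodic c P) :
    ∃ Φ Ω, IsLocalFlow V c Φ Ω := by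
  have hcd : ∀ t, HasDerivAt c (hamField V (c t)) t := fun t => hc t trivial
  have hcc : Continuous c := continuous_iff_continuousAt.2 fun t => (hcd t).continuousAt
  obtain ⟨M, hM⟩ : ∃ M, ∀ t, c t ∈ plateau M := by
    obtain ⟨M, hM⟩ := (isCompact_Icc (a := (0 : ℝ)) (b := P)).exists_bound_of_continuousOn
      (f := fun t => ‖(c t).1‖ ^ 2 + ‖(c t).2‖ ^ 2) (by fun_prop)
    refine ⟨M + 1, fun t => ?_⟩
    obtain ⟨s, hs, hst⟩ := hper.exists_mem_Ico₀ hP t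
    have := (le_abs_self _).trans (hM s ⟨hs.1, hs.2.le⟩)
    rw [hst]
    change ‖(c s).1‖ ^ 2 + ‖(c s).2‖ ^ 2 < M + 1
    linarith
  set F := cutField V M with hF
  have hFs : ContDiff ℝ 1 F := (contDiff_cutField hV M).of_le (by simp)
  obtain ⟨K, hK⟩ := hFs.lipschitzWith_of_hasCompactSupport (hasCompactSupport_cutField V M)
    one_ne_zero
  choose S hS0 hS using fun ρ => exists_global_solution (f := fun _ => F) (fun _ => hK)
    (fun _ => continuous_const) ρ
  have hcF : ∀ t, HasDerivAt c (F (c t)) t := fun t => by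
    rw [hF, cutField_of_mem (hM t)]; exact hcd t
  have horb : S (c 0) = c := eq_of_contDiff hFs 0 (hS _) hcF (hS0 _)
  -- A linear map that reverses the field conjugates the flow to its inverse; this serves for both
  -- symmetries.
  have hrev : ∀ A : Phase →L[ℝ] Phase, (∀ ρ, F (A ρ) = -A (F ρ)) →
      ∀ t ρ, S (A ρ) t = A (S ρ (-t)) := by
    intro A hA t ρ
    refine congrFun (eq_of_contDiff hFs (g := fun t => A (S ρ (-t))) 0 (hS _) (fun t => ?_) ?_) t
    · rw [hA]
      have := A.hasFDerivAt.comp_hasDerivAt t ((hS ρ (-t)).scomp t (hasDerivAt_neg t))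
      simpa [Function.comp_def] using this
    · simp [hS0]
  have hcont : ∀ ρ, Continuous (S ρ) := fun ρ =>
    continuous_iff_continuousAt.2 fun t => (hS ρ t).continuousAt
  have hdist : ∀ M t, t ∈ Icc (-M) M → ∀ ρ ρ', dist (S ρ t) (S ρ' t) ≤ dist ρ ρ' * Real.exp (K * M) := by
    intro M t ht ρ ρ'
    have := norm_sub_le_of_integralCurves hK (hS ρ) (hS ρ') ht
    rwa [hS0, hS0, ← dist_eq_norm, ← dist_eq_norm] at this
  have hfd : ∀ t, fderiv ℝ (hamField V) (c t) = fderiv ℝ F (c t) := by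
    intro t
    refine Filter.EventuallyEq.fderiv_eq ?_
    filter_upwards [(isOpen_plateau M).mem_nhds (hM t)] with ρ hρ
    rw [hF, cutField_of_mem hρ]
  have hlip : ∀ t, LipschitzWith K fun w => fderiv ℝ (hamField V) (c t) w := fun t => by
    rw [hfd]
    exact (fderiv ℝ F (c t)).lipschitz.weaken (norm_fderiv_le_of_lipschitz ℝ hK)
  refine ⟨fun t ρ => S ρ t, plateau M, ?_⟩
  constructor
  case zero => exact hS0
  case add =>
    intro s t ρ
    exact congrFun (eq_of_contDiff hFs (f := fun s => S ρ (s + t)) 0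
      (fun s => (hS ρ (s + t)).comp_add_const s t) (hS _) (by simp [hS0])) s
  case timeRev_eq => exact hrev timeRev (cutField_timeRev M)
  case axisRev_eq => exact hrev axisRev (cutField_axisRev hV hs M)
  case orbit => exact fun t => by rw [horb]
  case isOpen => exact isOpen_plateau M
  case mem => exact hM
  case axisRev_mem => exact fun ρ hρ => by simpa [plateau] using hρ
  case bichar => 
    intro ρ t h
    have := hS ρ t
    rwa [hF, cutField_of_mem h] at this
  case energy =>
    intro t ρ
    have hd : ∀ t, HasDerivAt (fun t => symbolQ V (S ρ t)) 0 t := fun t => by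
      have := ((contDiff_symbolQ hV).differentiable (by simp) (S ρ t)).hasFDerivAt.comp_hasDerivAt t
        (hS ρ t)
      rwa [hF, cutField, map_smul, fderiv_symbolQ_hamField hV, smul_zero] at this
    have := is_const_of_deriv_eq_zero (fun t => (hd t).differentiableAt) (fun t => (hd t).deriv) t 0
    rwa [hS0] at this
  case close =>
    intro N ε hε
    have : ∀ᶠ ρ in nhds (c 0), dist ρ (c 0) * Real.exp (K * N) < ε := by
      refine (Continuous.tendsto (by fun_prop) _).eventually_lt_const
        (f := fun ρ : Phase => dist ρ (c 0) * Real.exp (K * N)) ?_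
      simpa using hε
    filter_upwards [this] with ρ hρ t ht
    have h := hdist N t ht ρ (c 0)
    rw [horb] at h
    exact h.trans_lt hρ
  case continuous_time => exact hcont
  case continuous_space =>
    intro t
    have : LipschitzWith ⟨Real.exp (K * |t|), (Real.exp_pos _).le⟩ fun ρ => S ρ t :=
      LipschitzWith.of_dist_le_mul fun ρ ρ' => by
        have := hdist |t| t ⟨neg_abs_le t, le_abs_self t⟩ ρ ρ'
        rwa [mul_comm] at this
    exact this.continuous
  case linearised =>
    refine exists_global_solution hlip fun w => ?_
    simp only [hfd]
    exact ((hFs.continuous_fderiv one_ne_zero).comp hcc).clm_apply continuous_const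
  case linearised_unique =>
    intro W₁ W₂ s h₁ h₂ h
    exact ODE_solution_unique_univ (t₀ := s) (v := fun t w => fderiv ℝ (hamField V) (c t) w)
      (s := fun _ => univ) (fun t => (hlip t).lipschitzOnWith) (fun t => ⟨h₁ t, trivial⟩)
      (fun t => ⟨h₂ t, trivial⟩) h
  case strict =>
    intro T hT
    obtain ⟨L, hL, hL'⟩ := hasStrictFDerivAt_flow hFs hK (Φ := fun t ρ => S ρ t) hS0 hS (c 0) hT
    refine ⟨L, hL, fun W hW => hL' W fun t => ?_⟩
    simpa only [horb, hfd] using hW t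

end Flow

/-! ### Wells and their boundaries -/

section Wells

open Set Filter Topology

theorem isClosed_connectedComponentIn {X : Type*} [TopologicalSpace X] {F : Set X}
    (hF : IsClosed F) (x : X) : IsClosed (connectedComponentIn F x) := by
  by_cases hx : x ∈ F
  · refine isClosed_of_closure_subset ?_
    exact isPreconnected_connectedComponentIn.closure.subset_connectedComponentIn
      (subset_closure (mem_connectedComponentIn hx))
      (closure_minimal (connectedComponentIn_subset F x) hF)
  · rw [connectedComponentIn_eq_empty hx]
    exact isClosed_empty

theorem isClosed_well {V : Plane → ℝ} (hV : Continuous V) (E : ℝ) (a : Plane) :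
    IsClosed (well V E a) :=
  isClosed_connectedComponentIn (isClosed_le hV continuous_const) a

theorem well_refl {V : Plane → ℝ} (hs : ∀ x, V (refl x) = V x) (E : ℝ) (a : Plane) :
    well V E (refl a) = refl '' well V E a := by
  have himage : refl '' {x | V x ≤ E} = {x | V x ≤ E} := by
    ext x
    constructor
    · rintro ⟨y, hy, rfl⟩
      simpa [hs] using hy
    · intro hx
      exact ⟨refl x, by simpa [hs] using hx, refl_refl x⟩
  by_cases ha : V a ≤ E
  · have := reflL.toHomeomorph.image_connectedComponentIn (s := {x | V x ≤ E}) ha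
    change refl '' _ = connectedComponentIn (refl '' _) (refl a) at this
    rw [himage] at this
    exact this.symm
  · rw [well, well, connectedComponentIn_eq_empty (show a ∉ {x | V x ≤ E} from ha),
      connectedComponentIn_eq_empty (by simpa [hs] using ha), image_empty]

theorem frontier_well_refl {V : Plane → ℝ} (hs : ∀ x, V (refl x) = V x) (E : ℝ) (a : Plane) :
    frontier (well V E (refl a)) = refl '' frontier (well V E a) := by
  rw [well_refl hs]
  exact (reflL.toHomeomorph.image_frontier _).symm

/-- The quadratic form `∑ λ_j² z_j²`. -/
noncomputable def quad (lam : Fin 2 → ℝ) (e : OrthonormalBasis (Fin 2) ℝ Plane) (a x : Plane) : ℝ :=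
  ∑ j, (lam j) ^ 2 * (inner ℝ (e j) (x - a)) ^ 2

variable {lam : Fin 2 → ℝ} {e : OrthonormalBasis (Fin 2) ℝ Plane} {a : Plane}

theorem continuous_quad : Continuous (quad lam e a) := by
  unfold quad
  fun_prop

theorem quad_segment (t : ℝ) (x : Plane) :
    quad lam e a (a + t • (x - a)) = t ^ 2 * quad lam e a x := by
  simp only [quad, add_sub_cancel_left, inner_smul_right, Finset.mul_sum]
  exact Finset.sum_congr rfl fun j _ => by ring

theorem quad_self : quad lam e a a = 0 := by simp [quad]

theorem sq_norm_le_quad (h0 : 0 < lam 0) (h1 : lam 0 < lam 1) (x : Plane) :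
    (lam 0) ^ 2 * ‖x - a‖ ^ 2 ≤ quad lam e a x := by
  rw [← e.sum_sq_norm_inner_right (x - a), quad, Finset.mul_sum]
  refine Finset.sum_le_sum fun j _ => ?_
  rw [Real.norm_eq_abs, sq_abs]
  have : lam 0 ≤ lam j := by fin_cases j <;> simp [h1.le]
  gcongr

theorem isCompact_quad_le (h0 : 0 < lam 0) (h1 : lam 0 < lam 1) (E : ℝ) :
    IsCompact {x | quad lam e a x ≤ E} := by
  refine Metric.isCompact_of_isClosed_isBounded (isClosed_le continuous_quad continuous_const) ?_
  refine (Metric.isBounded_closedBall (x := a) (r := 1 + |E| / (lam 0) ^ 2)).subset fun x hx => ?_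
  rw [Metric.mem_closedBall, dist_eq_norm]
  have h2 := (sq_norm_le_quad h0 h1 x).trans (hx.trans (le_abs_self E))
  have h3 : ‖x - a‖ ^ 2 ≤ |E| / (lam 0) ^ 2 := by
    rw [le_div_iff₀ (by positivity)]; linarith
  nlinarith [sq_nonneg (‖x - a‖ - 1), norm_nonneg (x - a)]

theorem segment_quad {E : ℝ} {x : Plane} (hx : quad lam e a x ≤ E) {t : ℝ} (ht : t ∈ Icc (0 : ℝ) 1) :
    quad lam e a (a + t • (x - a)) ≤ E := by
  rw [quad_segment]
  have hq : 0 ≤ quad lam e a x := Finset.sum_nonneg fun j _ => by positivity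
  have : t ^ 2 ≤ 1 := pow_le_one₀ ht.1 ht.2
  nlinarith

theorem isPreconnected_quad_le {E : ℝ} : IsPreconnected {x | quad lam e a x ≤ E} := by
  refine isPreconnected_of_forall a fun x hx => ?_
  refine ⟨(fun t : ℝ => a + t • (x - a)) '' Icc 0 1, ?_, ⟨0, by simp⟩, ⟨1, by simp⟩, ?_⟩
  · rintro _ ⟨t, ht, rfl⟩
    exact segment_quad hx ht
  · exact isPreconnected_Icc.image _ (by fun_prop)

/-- A point of the level set is not interior, because dilation from `a` by a factor above `1`
increases the form. -/
theorem frontier_quad_le {E : ℝ} (hE : 0 < E) :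
    frontier {x | quad lam e a x ≤ E} = {x | quad lam e a x = E} := by
  refine subset_antisymm (frontier_le_subset_eq continuous_quad continuous_const) fun x hx => ?_
  have hx' : quad lam e a x = E := hx
  refine ⟨subset_closure hx'.le, fun hint => ?_⟩
  have hcont : Tendsto (fun t : ℝ => a + t • (x - a)) (𝓝 1) (𝓝 x) := by
    have : Continuous fun t : ℝ => a + t • (x - a) := by fun_prop
    simpa using this.tendsto 1
  have h1 : ∀ᶠ t in 𝓝[>] (1 : ℝ), a + t • (x - a) ∈ {x | quad lam e a x ≤ E} :=
    (hcont.eventually (mem_interior_iff_mem_nhds.1 hint)).filter_mono nhdsWithin_le_nhds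
  obtain ⟨t, ht, ht1⟩ := (h1.and self_mem_nhdsWithin).exists
  rw [mem_ofPred_eq, quad_segment, hx'] at ht
  have ht1' : 1 < t := ht1
  have ht2 : 1 < t ^ 2 := by nlinarith
  nlinarith

/-- Description of the left wells at energies near `E`: they are ellipses contained in `{x₁ < 0}`
near which `V` is quadratic. -/
theorem IsDoubleWell.exists_wells {V : Plane → ℝ} {E : ℝ} (hV : IsDoubleWell V E a lam e)
    (hne : (well V E a).Nonempty) :
    ∃ ε > 0, (∀ x, quad lam e a x < E + ε → V =ᶠ[𝓝 x] quad lam e a ∧ x 0 < 0) ∧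
      ∀ E' ∈ Ioo 0 (E + ε), well V E' a = {x | quad lam e a x ≤ E'} ∧
        frontier (well V E' a) = {x | quad lam e a x = E'} := by
  obtain ⟨O, hO, hUO, hVO⟩ := hV.model
  have hVc : Continuous V := hV.smooth.continuous
  have hVO' : ∀ x ∈ O, V =ᶠ[𝓝 x] quad lam e a := fun x hx => by
    filter_upwards [hO.mem_nhds hx] with y hy using hVO y hy
  have haE : a ∈ {x | V x ≤ E} := connectedComponentIn_nonempty_iff.1 hne
  have haU : a ∈ well V E a := mem_connectedComponentIn haE
  -- The well is connected, so if it left the left half-plane it would contain a point of the axis.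
  -- Such a point is its own mirror image and would lie in both wells.
  have hneg : well V E a ⊆ {x | x 0 < 0} := by
    have hpre : IsPreconnected ((fun x : Plane => x 0) '' well V E a) :=
      isPreconnected_connectedComponentIn.image _ (by fun_prop)
    intro x hx
    by_contra hx0
    have : (0 : ℝ) ∈ (fun x : Plane => x 0) '' well V E a :=
      hpre.ordConnected.out ⟨a, haU, rfl⟩ ⟨x, hx, rfl⟩ ⟨hV.on_left.le, not_lt.1 hx0⟩
    obtain ⟨y, hy, hy0⟩ := this
    have hyr : refl y = y := by
      ext i; fin_cases i
      · have : y 0 = 0 := hy0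
        simp [this]
      · simp
    refine disjoint_left.1 hV.disj hy ?_
    rw [well_refl hV.symm]
    exact ⟨y, hy, hyr⟩
  -- Continuity argument along the ray from `a`: the parameters whose points lie in the well form a
  -- closed set, which can be continued to the right inside `O`.
  have hsub : {x | quad lam e a x ≤ E} ⊆ well V E a := by
    intro x hx
    have hcl : IsClosed ({t : ℝ | a + t • (x - a) ∈ well V E a} ∩ Icc 0 1) :=
      ((isClosed_well hVc E a).preimage (by fun_prop)).inter isClosed_Icc
    have := hcl.Icc_subset_of_forall_mem_nhdsWithin (by simpa using haU) ?_
      (right_mem_Icc.2 zero_le_one)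
    · simpa using this
    rintro t ⟨ht, ht01⟩
    have htO := hO.mem_nhds (hUO ht)
    have hcont : Continuous fun s : ℝ => a + s • (x - a) := by fun_prop
    obtain ⟨d, hd, hball⟩ := Metric.mem_nhds_iff.1 (hcont.continuousAt htO)
    have hlt : t < min 1 (t + d) := lt_min ht01.2 (by linarith)
    filter_upwards [Ioo_mem_nhdsGT hlt] with s hs
    have hs1 : s < 1 := hs.2.trans_le (min_le_left _ _)
    have hsd : s < t + d := hs.2.trans_le (min_le_right _ _)
    change a + s • (x - a) ∈ well V E a
    rw [well, connectedComponentIn_eq ht]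
    refine (isPreconnected_Icc.image (fun s : ℝ => a + s • (x - a)) hcont.continuousOn
      |>.subset_connectedComponentIn ⟨t, left_mem_Icc.2 hs.1.le, rfl⟩ ?_)
      ⟨s, right_mem_Icc.2 hs.1.le, rfl⟩
    rintro _ ⟨u, hu, rfl⟩
    have huO : a + u • (x - a) ∈ O := by
      refine hball ?_
      rw [Metric.mem_ball, Real.dist_eq, abs_lt]
      constructor <;> linarith [hu.1, hu.2]
    rw [mem_ofPred_eq, hVO _ huO]
    exact segment_quad hx ⟨ht01.1.trans hu.1, hu.2.trans hs1.le⟩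
  set G : Set Plane := O ∩ {x | x 0 < 0} with hG
  have hGo : IsOpen G := hO.inter (isOpen_lt (by fun_prop) continuous_const)
  -- On the compact part of `{quad ≤ E + 1}` outside `G` the form attains its minimum, which exceeds
  -- `E` by `hsub`.
  obtain ⟨ε, hε, hεG⟩ : ∃ ε > 0, ∀ x, quad lam e a x < E + ε → x ∈ G := by
    have hK : IsCompact ({x | quad lam e a x ≤ E + 1} \ G) :=
      (isCompact_quad_le hV.lam_pos hV.lam_lt _).diff hGo
    rcases ({x | quad lam e a x ≤ E + 1} \ G).eq_empty_or_nonempty with h | h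
    · exact ⟨1, one_pos, fun x hx => by
        by_contra hxG
        exact (h ▸ (⟨le_of_lt hx, hxG⟩ : x ∈ {x | quad lam e a x ≤ E + 1} \ G) : x ∈ (∅ : Set _))⟩
    · obtain ⟨x₀, hx₀, hmin⟩ := hK.exists_isMinOn h continuous_quad.continuousOn
      have hx₀E : E < quad lam e a x₀ := by
        by_contra hcon
        have := hsub (not_lt.1 hcon)
        exact hx₀.2 ⟨hUO this, hneg this⟩
      refine ⟨min 1 (quad lam e a x₀ - E), lt_min one_pos (by linarith), fun x hx => ?_⟩
      by_contra hxG
      have h1 := min_le_left 1 (quad lam e a x₀ - E)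
      have h2 := min_le_right 1 (quad lam e a x₀ - E)
      have := hmin (a := x) ⟨by rw [mem_ofPred_eq]; linarith, hxG⟩
      rw [mem_ofPred_eq] at this
      linarith
  refine ⟨ε, hε, fun x hx => ⟨hVO' x (hεG x hx).1, (hεG x hx).2⟩, fun E' hE' => ?_⟩
  have hVq : ∀ x, quad lam e a x < E + ε → V x = quad lam e a x := fun x hx => hVO x (hεG x hx).1
  have hset : well V E' a = {x | quad lam e a x ≤ E'} := by
    have haE' : quad lam e a a ≤ E' := by rw [quad_self]; exact hE'.1.le
    refine subset_antisymm (fun x hx => ?_) ?_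
    · have hxV : V x ≤ E' := connectedComponentIn_subset {x | V x ≤ E'} a hx
      by_contra hcon
      have hcon' : E' < quad lam e a x := not_le.1 hcon
      -- A connected set reaching beyond the ellipse would meet the shell `E' < quad < E + ε`, where
      -- `V` equals the form and so exceeds `E'`.
      obtain ⟨z, hz, hz1, hz2⟩ := isPreconnected_connectedComponentIn (F := {x | V x ≤ E'}) (x := a)
        {x | quad lam e a x < E + ε} {x | E' < quad lam e a x}
        (isOpen_lt continuous_quad continuous_const) (isOpen_lt continuous_const continuous_quad)
        (fun z _ => (lt_or_ge (quad lam e a z) (E + ε)).imp id fun h => hE'.2.trans_le h)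
        ⟨a, mem_connectedComponentIn
          (by rw [mem_ofPred_eq, hVq a (haE'.trans_lt hE'.2)]; exact haE'), haE'.trans_lt hE'.2⟩
        ⟨x, hx, hcon'⟩
      have hz3 : V z ≤ E' := connectedComponentIn_subset {x | V x ≤ E'} a hz
      rw [hVq z hz1] at hz3
      exact absurd hz2 (not_lt.2 hz3)
    · refine isPreconnected_quad_le.subset_connectedComponentIn haE' fun x hx => ?_
      have hx' : quad lam e a x ≤ E' := hx
      rw [mem_ofPred_eq, hVq x (hx'.trans_lt hE'.2)]
      exact hx'
  exact ⟨hset, by rw [hset, frontier_quad_le hE'.1]⟩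

end Wells

/-! ### Symmetry of the tunnel cycle, and its single crossing of the axis -/

section Cycle

open Set Filter Topology
open scoped NNReal

theorem agmonLength_of_hasDerivAt (V : Plane → ℝ) (E : ℝ) {γ v : ℝ → Plane} {s t : ℝ} (hst : s ≤ t)
    (h : ∀ u ∈ Ioo s t, HasDerivAt γ (v u) u) :
    agmonLength V E γ s t = ∫ u in s..t, Real.sqrt (max (V (γ u) - E) 0) * ‖v u‖ :=
  intervalIntegral.integral_congr_Ioo_of_le hst fun u hu => by rw [(h u hu).deriv]

/-- A curve ending on the axis, followed by its mirror image. -/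
theorem exists_reflected_curve {V : Plane → ℝ} (hVc : Continuous V) (hs : ∀ x, V (refl x) = V x)
    (E : ℝ) {x v : ℝ → Plane} (hx : ∀ t, HasDerivAt x (v t) t) (hv : Continuous v) {t₁ : ℝ}
    (ht₁ : 0 ≤ t₁) (haxis : refl (x t₁) = x t₁) :
    ∃ (γ : ℝ → Plane) (K : ℝ≥0), LipschitzOnWith K γ (Icc 0 1) ∧ γ 0 = x 0 ∧ γ 1 = refl (x 0) ∧
      agmonLength V E γ 0 1 = 2 * agmonLength V E x 0 t₁ := by
  have hxc : Continuous x := continuous_iff_continuousAt.2 fun t => (hx t).continuousAt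
  obtain ⟨C, hC⟩ : ∃ C : ℝ, 0 ≤ C ∧ ∀ s ∈ Icc 0 t₁, ∀ t ∈ Icc 0 t₁, dist (x s) (x t) ≤ C * dist s t := by
    obtain ⟨C, hC⟩ := (isCompact_Icc (a := (0 : ℝ)) (b := t₁)).exists_bound_of_continuousOn
      hv.continuousOn
    have hC0 : 0 ≤ C := (norm_nonneg _).trans (hC 0 ⟨le_rfl, ht₁⟩)
    refine ⟨C, hC0, fun s hs t ht => ?_⟩
    have := (convex_Icc (0 : ℝ) t₁).norm_image_sub_le_of_norm_hasDerivWithin_le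
      (fun u _ => (hx u).hasDerivWithinAt) hC ht hs
    rwa [← dist_eq_norm, ← dist_eq_norm] at this
  obtain ⟨hC0, hC⟩ := hC
  set γ : ℝ → Plane := fun u => if u ≤ 1 / 2 then x (2 * t₁ * u) else refl (x (2 * t₁ - 2 * t₁ * u))
    with hγ
  have hγ1 : ∀ u ≤ 1 / 2, γ u = x (2 * t₁ * u) := fun u hu => if_pos hu
  have hγ2 : ∀ u, 1 / 2 ≤ u → γ u = refl (x (2 * t₁ - 2 * t₁ * u)) := by
    intro u hu
    rcases hu.eq_or_lt with h | h
    · rw [hγ1 u h.ge, ← h]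
      have h1 : 2 * t₁ * (1 / 2) = t₁ := by ring
      have h2 : 2 * t₁ - 2 * t₁ * (1 / 2) = t₁ := by ring
      rw [h2, h1, haxis]
    · exact if_neg (not_le.2 h)
  have hdist : ∀ u ∈ Icc (0 : ℝ) 1, ∀ w ∈ Icc (0 : ℝ) 1, u ≤ w →
      dist (γ u) (γ w) ≤ C * (2 * t₁) * dist u w := by
    have h1 : ∀ u w, 0 ≤ u → u ≤ w → w ≤ 1 / 2 → dist (γ u) (γ w) ≤ C * (2 * t₁) * (w - u) := by
      intro u w hu huw hw
      rw [hγ1 u (huw.trans hw), hγ1 w hw]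
      refine (hC _ ⟨by positivity, by nlinarith⟩ _ ⟨by nlinarith, by nlinarith⟩).trans_eq ?_
      rw [dist_comm, Real.dist_eq, ← mul_sub, abs_of_nonneg (mul_nonneg (by positivity) (by linarith))]
      ring
    have h2 : ∀ u w, 1 / 2 ≤ u → u ≤ w → w ≤ 1 → dist (γ u) (γ w) ≤ C * (2 * t₁) * (w - u) := by
      intro u w hu huw hw
      rw [hγ2 u hu, hγ2 w (hu.trans huw)]
      refine (reflL.dist_map _ _).le.trans
        ((hC _ ⟨by nlinarith, by nlinarith⟩ _ ⟨by nlinarith, by nlinarith⟩).trans_eq ?_)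
      have h3 : 2 * t₁ - 2 * t₁ * u - (2 * t₁ - 2 * t₁ * w) = 2 * t₁ * (w - u) := by ring
      rw [Real.dist_eq, h3, abs_of_nonneg (mul_nonneg (by positivity) (by linarith))]
      ring
    intro u hu w hw huw
    rw [dist_comm u, Real.dist_eq, abs_of_nonneg (sub_nonneg.2 huw)]
    rcases le_total w (1 / 2) with h | h
    · exact h1 u w hu.1 huw h
    rcases le_total u (1 / 2) with h' | h'
    · refine (dist_triangle _ (γ (1 / 2)) _).trans ?_
      have h3 := h1 u (1 / 2) hu.1 h' le_rfl
      have h4 := h2 (1 / 2) w le_rfl h hw.2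
      linarith
    · exact h2 u w h' huw hw.2
  refine ⟨γ, ⟨C * (2 * t₁), by positivity⟩, LipschitzOnWith.of_dist_le_mul fun u hu w hw => ?_,
    by rw [hγ1 0 (by norm_num), mul_zero], by rw [hγ2 1 (by norm_num)]; simp, ?_⟩
  · rcases le_total u w with h | h
    · exact hdist u hu w hw h
    · rw [dist_comm, dist_comm u]
      exact hdist w hw u hu h
  set F : ℝ → ℝ := fun t => Real.sqrt (max (V (x t) - E) 0) * ‖v t‖ with hF
  have hFc : Continuous F := by fun_prop
  have hx1 : agmonLength V E x 0 t₁ = ∫ t in (0 : ℝ)..t₁, F t :=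
    agmonLength_of_hasDerivAt V E ht₁ fun u _ => hx u
  set f : ℝ → ℝ := fun u => Real.sqrt (max (V (γ u) - E) 0) * ‖deriv γ u‖ with hf
  have he1 : EqOn f (fun u => (2 * t₁) * F (2 * t₁ * u)) (Ioo 0 (1 / 2)) := by
    intro u hu
    have hd : HasDerivAt γ ((2 * t₁) • v (2 * t₁ * u)) u := by
      have h1 := (hx (2 * t₁ * u)).scomp u ((hasDerivAt_id u).const_mul (2 * t₁))
      rw [mul_one] at h1
      refine h1.congr_of_eventuallyEq ?_
      filter_upwards [Iic_mem_nhds hu.2] with w hw using hγ1 w hw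
    simp only [hf, hF]
    rw [hd.deriv, hγ1 u hu.2.le, norm_smul, Real.norm_of_nonneg (by positivity)]
    ring
  have he2 : EqOn f (fun u => (2 * t₁) * F (2 * t₁ - 2 * t₁ * u)) (Ioo (1 / 2) 1) := by
    intro u hu
    have hd : HasDerivAt γ (refl (-((2 * t₁) • v (2 * t₁ - 2 * t₁ * u)))) u := by
      have h1 := (hx (2 * t₁ - 2 * t₁ * u)).scomp u
        (((hasDerivAt_id u).const_mul (2 * t₁)).const_sub (2 * t₁))
      rw [mul_one, neg_smul] at h1
      have h2 := (reflL : Plane →L[ℝ] Plane).hasFDerivAt.comp_hasDerivAt u h1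
      refine h2.congr_of_eventuallyEq ?_
      filter_upwards [Ici_mem_nhds hu.1] with w hw using hγ2 w hw
    simp only [hf, hF]
    rw [hd.deriv, hγ2 u hu.1.le, norm_refl, norm_neg, norm_smul, hs,
      Real.norm_of_nonneg (by positivity)]
    ring
  have hi1 : IntervalIntegrable f MeasureTheory.volume 0 (1 / 2) := by
    refine IntervalIntegrable.congr_uIoo (f := fun u => (2 * t₁) * F (2 * t₁ * u))
      (Continuous.intervalIntegrable (by fun_prop) _ _) ?_
    rw [uIoo_of_le (by norm_num)]
    exact he1.symm
  have hi2 : IntervalIntegrable f MeasureTheory.volume (1 / 2) 1 := by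
    refine IntervalIntegrable.congr_uIoo (f := fun u => (2 * t₁) * F (2 * t₁ - 2 * t₁ * u))
      (Continuous.intervalIntegrable (by fun_prop) _ _) ?_
    rw [uIoo_of_le (by norm_num)]
    exact he2.symm
  change (∫ u in (0 : ℝ)..1, f u) = _
  have h1 : 2 * t₁ * (1 / 2) = t₁ := by ring
  have h2 : 2 * t₁ - 2 * t₁ * (1 / 2) = t₁ := by ring
  have h3 : 2 * t₁ - 2 * t₁ * 1 = 0 := by ring
  have hI1 := intervalIntegral.smul_integral_comp_mul_left (a := 0) (b := 1 / 2) F (2 * t₁)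
  have hI2 := intervalIntegral.smul_integral_comp_sub_mul (a := 1 / 2) (b := 1) F (2 * t₁) (2 * t₁)
  rw [h1, mul_zero, smul_eq_mul] at hI1
  rw [h2, h3, smul_eq_mul] at hI2
  rw [← intervalIntegral.integral_add_adjacent_intervals hi1 hi2,
    intervalIntegral.integral_congr_Ioo_of_le (by norm_num) he1,
    intervalIntegral.integral_congr_Ioo_of_le (by norm_num) he2,
    intervalIntegral.integral_const_mul, intervalIntegral.integral_const_mul, hI1, hI2, hx1]
  ring

/-- The properties of the tunnel cycle that follow from its symmetry and minimality. -/
structure IsSymmetricCycle (V : Plane → ℝ) (E : ℝ) (c : ℝ → Phase) (T : ℝ) : Prop where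
  pos : 0 < T
  bichar : ∀ t, HasDerivAt c (hamField V (c t)) t
  periodic : Function.Periodic c (2 * T)
  rest : (c 0).2 = 0
  timeRev_eq : ∀ t, c (-t) = timeRev (c t)
  axisRev_eq : ∀ t, c (T - t) = axisRev (c t)
  energy : ∀ t, symbolQ V (c t) = -E
  forbidden : ∀ t ∈ Ioo 0 T, E < V (c t).1
  left_neg : ∀ t ∈ Ico 0 (T / 2), (c t).1 0 < 0
  nondegenerate : IsNondegenerate V c (2 * T)

theorem symbolQ_const {V : Plane → ℝ} (hV : ContDiff ℝ ∞ V) {c : ℝ → Phase}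
    (hc : ∀ t, HasDerivAt c (hamField V (c t)) t) (s t : ℝ) :
    symbolQ V (c s) = symbolQ V (c t) := by
  have hd : ∀ t, HasDerivAt (fun t => symbolQ V (c t)) 0 t := fun t => by
    have := ((contDiff_symbolQ hV).differentiable (by simp) (c t)).hasFDerivAt.comp_hasDerivAt t
      (hc t)
    rwa [fderiv_symbolQ_hamField hV] at this
  exact is_const_of_deriv_eq_zero (fun t => (hd t).differentiableAt) (fun t => (hd t).deriv) s t

/-- An orbit at rest at time `s` is symmetric under time reversal. -/
theorem timeRev_of_rest {V : Plane → ℝ} (hV : ContDiff ℝ ∞ V) {c : ℝ → Phase}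
    (hc : ∀ t, HasDerivAt c (hamField V (c t)) t) {s : ℝ} (hs : (c s).2 = 0) (t : ℝ) :
    c (s - t) = timeRev (c (s + t)) := by
  have h : (fun t => timeRev (c (s - t))) = fun t => c (s + t) := by
    refine eq_of_contDiff ((contDiff_hamField hV).of_le (by simp)) 0 (fun t => ?_) (fun t => ?_) ?_
    · rw [hamField_timeRev]
      have h1 := (hc (s - t)).scomp t ((hasDerivAt_id t).const_sub s)
      have h2 := timeRev.hasFDerivAt.comp_hasDerivAt t h1
      simp only [neg_smul, one_smul, map_neg] at h2
      exact h2
    · simpa [Function.comp_def] using (hc (s + t)).scomp t ((hasDerivAt_id t).const_add s)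
    · simp [hs, Prod.ext_iff]
  rw [← congrFun h t, timeRev_timeRev]

/-- The reflection swaps the wells and the reversal of time swaps the ends, so together they lead
from left to right again. -/
theorem IsLibration.map_symm {V : Plane → ℝ} (hV : ContDiff ℝ ∞ V) (hs : ∀ x, V (refl x) = V x)
    {a : Plane} {E : ℝ} {c : ℝ → Phase} {T : ℝ} (hc : IsLibration V a (refl a) E c T) :
    IsLibration V a (refl a) E (fun t => axisRev (c (T - t))) T := by
  have hd : ∀ t, HasDerivAt c (hamField V (c t)) t := fun t => hc.bichar t trivial
  have hb : ∀ (a : Plane) ρ, ρ ∈ boundaryLift V E a → axisRev ρ ∈ boundaryLift V E (refl a) := by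
    rintro a ρ ⟨h1, h2⟩
    refine ⟨?_, by simp [h2, refl]⟩
    rw [frontier_well_refl hs]
    exact ⟨_, h1, rfl⟩
  refine ⟨hc.pos, fun t _ => ?_, fun t => ?_, ?_, ?_, fun t ht => ?_⟩
  · rw [hamField_axisRev hV hs]
    have h1 := (hd (T - t)).scomp t ((hasDerivAt_id t).const_sub T)
    have h2 := axisRev.hasFDerivAt.comp_hasDerivAt t h1
    simp only [neg_smul, one_smul, map_neg] at h2
    exact h2
  · rw [← hc.periodic (T - (t + 2 * T))]
    congr 2
    ring
  · have := hb _ _ hc.right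
    rwa [refl_refl, ← sub_zero T] at this
  · have := hb _ _ hc.left
    rwa [← sub_self T] at this
  · have := hc.forbidden (T - t) ⟨by linarith [ht.2], by linarith [ht.1]⟩
    simpa [hs] using this

/-- Uniqueness identifies the cycle with its reversed mirror image. Minimality serves only for
`left_neg`: if the cycle met the axis at a time `t₁ < T / 2`, its arc up to `t₁` followed by the
mirror image of that arc would join the wells at less cost, since by symmetry the whole cycle costs
twice its first half and the density is positive between `t₁` and `T / 2`. -/
theorem IsMinimalTunnelCycle.isSymmetricCycle {V : Plane → ℝ} {E : ℝ} {a : Plane} {lam : Fin 2 → ℝ}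
    {e : OrthonormalBasis (Fin 2) ℝ Plane} (hV : IsDoubleWell V E a lam e) {c : ℝ → Phase} {T : ℝ}
    (hc : IsMinimalTunnelCycle V a E c T) : IsSymmetricCycle V E c T := by
  have hl := hc.libration
  have hd : ∀ t, HasDerivAt c (hamField V (c t)) t := fun t => hl.bichar t trivial
  have hcc : Continuous c := continuous_iff_continuousAt.2 fun t => (hd t).continuousAt
  have hVc := hV.smooth.continuous
  have hcl := isClosed_well hVc E a
  have h0U : (c 0).1 ∈ well V E a := hcl.frontier_subset hl.left.1
  obtain ⟨ε, hε, hquad, hwell⟩ := hV.exists_wells ⟨_, h0U⟩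
  have h0q : quad lam e a (c 0).1 = E := by
    have := hl.left.1
    rwa [(hwell E ⟨hV.pos, by linarith⟩).2] at this
  obtain ⟨h0V, h0neg⟩ := hquad (c 0).1 (by linarith)
  have hrest : (c 0).2 = 0 := hl.left.2
  have htime : ∀ t, c (-t) = timeRev (c t) := fun t => by
    have := timeRev_of_rest hV.smooth hd hrest t
    rwa [zero_sub, zero_add] at this
  have hcT : axisRev (c T) = c 0 := by
    simpa using hc.unique _ _ (hl.map_symm hV.smooth hV.symm)
  have haxis : ∀ t, c (T - t) = axisRev (c t) := fun t => by
    have := congrFun (eq_of_contDiff ((contDiff_hamField hV.smooth).of_le (by simp)) 0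
      (fun t => (hl.map_symm hV.smooth hV.symm).bichar t trivial) hd (by simpa using hcT)) t
    rw [← this, axisRev_axisRev]
  have henergy : ∀ t, symbolQ V (c t) = -E := fun t => by
    rw [symbolQ_const hV.smooth hd t 0, symbolQ, hrest, h0V.self_of_nhds, h0q]
    simp
  have hnorm : ∀ t, ‖(c t).2‖ ^ 2 = V (c t).1 - E := fun t => by
    have := henergy t
    rw [symbolQ] at this
    linarith
  refine ⟨hl.pos, hd, hl.periodic, hrest, htime, haxis, henergy, hl.forbidden, ?_,
    hc.nondegenerate⟩
  rintro t₀ ⟨h0, hT⟩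
  by_contra hcon
  rw [not_lt] at hcon
  have hxc : Continuous fun t => (c t).1 0 := by fun_prop
  obtain ⟨t₁, ht₁, hx₁⟩ := intermediate_value_Icc h0 hxc.continuousOn ⟨h0neg.le, hcon⟩
  have ht₁T : t₁ < T / 2 := ht₁.2.trans_lt hT
  have hrefl : refl (c t₁).1 = (c t₁).1 := by
    have hx₁' : (c t₁).1 0 = 0 := hx₁
    ext i; fin_cases i
    · simp [hx₁']
    · simp
  have hx : ∀ t, HasDerivAt (fun t => (c t).1) ((2 : ℝ) • (c t).2) t := fun t =>
    (hasFDerivAt_fst (𝕜 := ℝ) (p := c t)).comp_hasDerivAt t (hd t)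
  obtain ⟨γ, K, hγK, hγ0, hγ1, hlen⟩ := exists_reflected_curve hVc hV.symm E hx (by fun_prop)
    ht₁.1 hrefl
  have hmin := hc.minimal γ K hγK (by rw [hγ0]; exact h0U)
    (by rw [hγ1, well_refl hV.symm]; exact ⟨_, h0U, rfl⟩)
  -- The density of Agmon length along the cycle: the weight is ‖ξ‖, because V − E = ‖ξ‖², and the
  -- speed is 2‖ξ‖.
  set F : ℝ → ℝ := fun t => 2 * ‖(c t).2‖ ^ 2 with hF
  have hFc : Continuous F := by fun_prop
  have hlenF : ∀ t, 0 ≤ t → agmonLength V E (fun t => (c t).1) 0 t = ∫ u in (0 : ℝ)..t, F u := by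
    intro t ht
    rw [agmonLength_of_hasDerivAt V E ht fun u _ => hx u]
    refine intervalIntegral.integral_congr fun u _ => ?_
    simp only [hF]
    rw [← hnorm, max_eq_left (by positivity), Real.sqrt_sq (norm_nonneg _), norm_smul]
    norm_num
    ring
  rw [hlen, hlenF T hl.pos.le, hlenF t₁ ht₁.1] at hmin
  have hFI : ∀ s t, IntervalIntegrable F MeasureTheory.volume s t := fun s t =>
    hFc.intervalIntegrable s t
  have hsymF : (∫ u in (T / 2)..T, F u) = ∫ u in (0 : ℝ)..(T / 2), F u := by
    have h1 := intervalIntegral.integral_comp_sub_left (a := T / 2) (b := T) F T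
    have h2 : ∀ u, F (T - u) = F u := fun u => by simp [hF, haxis]
    simp only [h2] at h1
    rw [h1]
    congr 1 <;> ring
  have hsplit := intervalIntegral.integral_add_adjacent_intervals (hFI 0 (T / 2)) (hFI (T / 2) T)
  have hsplit2 := intervalIntegral.integral_add_adjacent_intervals (hFI 0 t₁) (hFI t₁ (T / 2))
  have hpos : 0 < ∫ u in t₁..(T / 2), F u := by
    refine intervalIntegral.intervalIntegral_pos_of_pos_on (hFI _ _) (fun u hu => ?_) ht₁T
    have h1 := hl.forbidden u ⟨ht₁.1.trans_lt hu.1, by linarith [hu.2, hl.pos]⟩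
    have h2 := hnorm u
    simp only [hF]
    linarith
  linarith

end Cycle

/-! ### From non-degeneracy to transversality at the axis -/

section Linearised

open Set Filter Topology

variable {V : Plane → ℝ} {E T : ℝ} {c : ℝ → Phase} {Φ : ℝ → Phase → Phase} {Ω : Set Phase}

theorem fderiv_hamField_of_antisymm (hV : ContDiff ℝ ∞ V) (A : Phase →L[ℝ] Phase)
    (hA : ∀ ρ, hamField V (A ρ) = -A (hamField V ρ)) (ρ w : Phase) :
    fderiv ℝ (hamField V) (A ρ) (A w) = -A (fderiv ℝ (hamField V) ρ w) := by
  have hd : Differentiable ℝ (hamField V) := (contDiff_hamField hV).differentiable (by simp)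
  have h1 : HasFDerivAt (fun ρ => hamField V (A ρ)) ((fderiv ℝ (hamField V) (A ρ)).comp A) ρ :=
    (hd (A ρ)).hasFDerivAt.comp ρ A.hasFDerivAt
  have h2 : HasFDerivAt (fun ρ => -A (hamField V ρ)) (-(A.comp (fderiv ℝ (hamField V) ρ))) ρ :=
    (A.hasFDerivAt.comp ρ (hd ρ).hasFDerivAt).fun_neg
  rw [funext hA] at h1
  exact DFunLike.congr_fun (h1.unique h2) w

/-- If a symmetric solution of the linearised equation is symmetric or antisymmetric on the axis,
modulo `H_q`, then it is periodic modulo `H_q`. -/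
theorem IsSymmetricCycle.eq_smul_hamField (hV : ContDiff ℝ ∞ V) (hs : ∀ x, V (refl x) = V x)
    (hc : IsSymmetricCycle V E c T) (hΦ : IsLocalFlow V c Φ Ω) {W : ℝ → Phase}
    (hW : ∀ t, HasDerivAt W (fderiv ℝ (hamField V) (c t) (W t)) t) {s₁ s₂ k : ℝ}
    (hs₁ : s₁ * s₁ = 1) (hs₂ : s₂ * s₂ = 1) (h0 : timeRev (W 0) = s₁ • W 0)
    (hq : fderiv ℝ (symbolQ V) (c 0) (W 0) = 0)
    (hT : axisRev (W (T / 2)) = s₂ • W (T / 2) + k • hamField V (c (T / 2))) :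
    ∃ l : ℝ, W 0 = l • hamField V (c 0) := by
  have hd : Differentiable ℝ (hamField V) := (contDiff_hamField hV).differentiable (by simp)
  have hH : ∀ t, HasDerivAt (fun t => hamField V (c t))
      (fderiv ℝ (hamField V) (c t) (hamField V (c t))) t := fun t =>
    (hd (c t)).hasFDerivAt.comp_hasDerivAt t (hc.bichar t)
  -- Uniqueness propagates each symmetry from a single time to all times: here about time `0`, and
  -- in `h2`, modulo `H_q`, about time `T / 2`.
  have h1 : (fun t => timeRev (W (-t))) = fun t => s₁ • W t := by
    refine hΦ.linearised_unique _ _ 0 (fun t => ?_) (fun t => ?_) (by simpa using h0)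
    · have h2 := timeRev.hasFDerivAt.comp_hasDerivAt t ((hW (-t)).scomp t (hasDerivAt_neg t))
      have h3 := fderiv_hamField_of_antisymm hV timeRev hamField_timeRev (c (-t)) (W (-t))
      rw [← hc.timeRev_eq, neg_neg] at h3
      rw [h3]
      simp only [neg_smul, one_smul, map_neg] at h2
      exact h2
    · rw [map_smul]
      exact (hW t).fun_const_smul s₁
  have h2 : (fun t => axisRev (W (T - t))) = fun t => s₂ • W t + k • hamField V (c t) := by
    refine hΦ.linearised_unique _ _ (T / 2) (fun t => ?_) (fun t => ?_) ?_
    · have h2 := axisRev.hasFDerivAt.comp_hasDerivAt t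
        ((hW (T - t)).scomp t ((hasDerivAt_id t).const_sub T))
      have h3 := fderiv_hamField_of_antisymm hV axisRev (hamField_axisRev hV hs) (c (T - t))
        (W (T - t))
      rw [← hc.axisRev_eq, sub_sub_cancel] at h3
      rw [h3]
      simp only [neg_smul, one_smul, map_neg] at h2
      exact h2
    · rw [map_add, map_smul, map_smul]
      exact ((hW t).fun_const_smul s₂).fun_add ((hH t).fun_const_smul k)
    · rw [← hT, sub_half]
  have e1 : axisRev (W T) = s₂ • W 0 + k • hamField V (c 0) := by
    simpa only [sub_zero] using congrFun h2 0
  have e2 : axisRev (W (2 * T)) = s₂ • W (-T) + k • hamField V (c (-T)) := by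
    have := congrFun h2 (-T)
    rwa [show T - -T = 2 * T by ring] at this
  have e3 : timeRev (W (-T)) = s₁ • W T := congrFun h1 T
  have e4 : timeRev (hamField V (c 0)) = -hamField V (c 0) := by
    have := hamField_timeRev (V := V) (c 0)
    rw [← hc.timeRev_eq, neg_zero] at this
    exact (neg_eq_iff_eq_neg.2 this).symm
  have e5 : axisRev (hamField V (c (-T))) = -hamField V (c 0) := by
    have := hamField_axisRev hV hs (c (-T))
    rw [← hc.axisRev_eq, show T - -T = 0 + 2 * T by ring, hc.periodic] at this
    rw [this, neg_neg]
  -- The two reflections in time compose to a translation by `T` twisted by the commuting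
  -- involutions; applied twice, involutions and signs square away and only a multiple of `H_q` is
  -- left.
  have e6 : W (2 * T) = W 0 + (-(s₁ * s₂ * k) - k) • hamField V (c 0) := by
    have e7 : W (-T) = s₁ • timeRev (W T) := by
      rw [← timeRev_timeRev (W (-T)), e3, map_smul]
    have e8 : axisRev (timeRev (W T)) = (s₂ * s₁) • W 0 - k • hamField V (c 0) := by
      rw [axisRev_timeRev, e1, map_add, map_smul, map_smul, e4, h0, smul_neg, smul_smul, sub_eq_add_neg]
    rw [← axisRev_axisRev (W (2 * T)), e2, map_add, map_smul, map_smul, e5, e7, map_smul, e8]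
    rw [smul_sub, smul_sub, smul_smul, smul_smul, smul_smul, smul_smul,
      show s₂ * s₁ * (s₂ * s₁) = (s₂ * s₂) * (s₁ * s₁) by ring, hs₁, hs₂]
    module
  exact hc.nondegenerate W (fun t _ => hW t) hq ⟨_, by rw [e6, add_sub_cancel_left]⟩

/-- At the half period the cycle crosses the axis orthogonally. -/
theorem IsSymmetricCycle.crossing (hV : ContDiff ℝ ∞ V) (hs : ∀ x, V (refl x) = V x)
    (hc : IsSymmetricCycle V E c T) :
    (c (T / 2)).1 0 = 0 ∧ (c (T / 2)).2 1 = 0 ∧ 0 < (c (T / 2)).2 0 ∧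
      gradient V (c (T / 2)).1 0 = 0 := by
  have hfix : axisRev (c (T / 2)) = c (T / 2) := by rw [← hc.axisRev_eq, sub_half]
  have hx : (c (T / 2)).1 0 = 0 := by
    have := congrArg (fun ρ : Phase => ρ.1 0) hfix
    simp only [axisRev_apply, refl_apply_zero] at this
    linarith
  have hξ : (c (T / 2)).2 1 = 0 := by
    have := congrArg (fun ρ : Phase => ρ.2 1) hfix
    simp only [axisRev_apply, PiLp.neg_apply, refl_apply_one] at this
    linarith
  have hg : gradient V (c (T / 2)).1 0 = 0 := by
    have := hamField_axisRev hV hs (c (T / 2))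
    rw [hfix] at this
    have := congrArg (fun ρ : Phase => ρ.2 0) this
    simp only [hamField, axisRev_apply, Prod.snd_neg, PiLp.neg_apply, refl_apply_zero] at this
    linarith
  refine ⟨hx, hξ, ?_, hg⟩
  -- If both components of the momentum vanished, conservation of energy would give V = E at an
  -- interior time.
  have hne : (c (T / 2)).2 0 ≠ 0 := by
    intro h
    have h1 := hc.energy (T / 2)
    have h2 := hc.forbidden (T / 2) ⟨by linarith [hc.pos], by linarith [hc.pos]⟩
    rw [symbolQ, EuclideanSpace.norm_sq_eq, Fin.sum_univ_two, h, hξ] at h1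
    simp at h1
    linarith
  refine lt_of_le_of_ne ?_ hne.symm
  have hd : HasDerivAt (fun t => (c t).1 0) (2 * (c (T / 2)).2 0) (T / 2) :=
    (((PiLp.proj 2 (fun _ : Fin 2 => ℝ) 0 : Plane →L[ℝ] ℝ).comp
      (ContinuousLinearMap.fst ℝ Plane Plane)).hasFDerivAt.comp_hasDerivAt (T / 2)
        (hc.bichar (T / 2)))
  have hslope := (hasDerivAt_iff_tendsto_slope.1 hd).mono_left
    (nhdsWithin_mono (s := Iio (T / 2)) _ fun t ht => ne_of_lt ht)
  have : 0 ≤ 2 * (c (T / 2)).2 0 := by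
    refine ge_of_tendsto hslope ?_
    filter_upwards [Ioo_mem_nhdsLT (show 0 < T / 2 by linarith [hc.pos])] with t ht
    have h1 := hc.left_neg t ⟨ht.1.le, ht.2⟩
    rw [slope_def_field, hx, sub_zero]
    exact div_nonneg_of_nonpos h1.le (by linarith [ht.2])
  linarith

/-- Transversality at the axis: for admissible variations of the initial data, the position and the
momentum along the axis both vary at first order. -/
theorem IsSymmetricCycle.transversal (hV : ContDiff ℝ ∞ V) (hs : ∀ x, V (refl x) = V x)
    (hc : IsSymmetricCycle V E c T) (hΦ : IsLocalFlow V c Φ Ω) {L : Phase →L[ℝ] Phase}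
    (hL : HasStrictFDerivAt (Φ (T / 2)) L (c 0))
    (hLW : ∀ W : ℝ → Phase, (∀ t, HasDerivAt W (fderiv ℝ (hamField V) (c t) (W t)) t) →
      W (T / 2) = L (W 0)) :
    L (hamField V (c 0)) = hamField V (c (T / 2)) ∧
    ∀ (w : Phase) (s : ℝ), s * s = 1 → timeRev w = s • w → fderiv ℝ (symbolQ V) (c 0) w = 0 →
      (∀ l : ℝ, w ≠ l • hamField V (c 0)) →
      (L w).1 1 ≠ 0 ∧
        2 * (c (T / 2)).2 0 * (L w).2 1 - gradient V (c (T / 2)).1 1 * (L w).1 0 ≠ 0 := by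
  obtain ⟨hx, hξ, hpos, hg⟩ := hc.crossing hV hs
  have hd : Differentiable ℝ (hamField V) := (contDiff_hamField hV).differentiable (by simp)
  refine ⟨(hLW (fun t => hamField V (c t)) fun t =>
    (hd (c t)).hasFDerivAt.comp_hasDerivAt t (hc.bichar t)).symm, ?_⟩
  intro w s hs1 hw hq hne
  obtain ⟨W, hW0, hW⟩ := hΦ.linearised w
  have hWL : W (T / 2) = L w := by rw [hLW W hW, hW0]
  -- Linearised conservation of energy at the crossing ties the variation of ξ₁ to that of x₂.
  have hqL : 2 * ((c (T / 2)).2 0 * (L w).2 0) - gradient V (c (T / 2)).1 1 * (L w).1 1 = 0 := by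
    have hqd : Differentiable ℝ (symbolQ V) := (contDiff_symbolQ hV).differentiable (by simp)
    have h1 : HasFDerivAt (fun ρ => symbolQ V (Φ (T / 2) ρ))
        ((fderiv ℝ (symbolQ V) (Φ (T / 2) (c 0))).comp L) (c 0) :=
      (hqd _).hasFDerivAt.comp (c 0) hL.hasFDerivAt
    rw [funext (hΦ.energy (T / 2)), hΦ.orbit] at h1
    have h2 := DFunLike.congr_fun (h1.unique (hqd (c 0)).hasFDerivAt) w
    rw [hq] at h2
    change fderiv ℝ (symbolQ V) (c (T / 2)) (L w) = 0 at h2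
    rw [fderiv_symbolQ_apply hV] at h2
    simp only [PiLp.inner_apply, Fin.sum_univ_two, hξ, hg] at h2
    simp at h2
    linarith
  have key : ∀ s₂ k : ℝ, s₂ * s₂ = 1 →
      axisRev (L w) = s₂ • L w + k • hamField V (c (T / 2)) → False := by
    intro s₂ k hs₂ h
    obtain ⟨l, hl⟩ := hc.eq_smul_hamField hV hs hΦ hW (k := k) hs1 hs₂ (by rw [hW0, hw])
      (by rw [hW0, hq]) (by rw [hWL, h])
    exact hne l (by rw [← hl, hW0])
  constructor
  -- If x₂ does not vary, neither does ξ₁, so `L w` has only the components x₁ and ξ₂, both of which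
  -- `axisRev` changes in sign.
  · intro h
    rw [h] at hqL
    have h0 : (L w).2 0 = 0 := by
      have : (c (T / 2)).2 0 * (L w).2 0 = 0 := by linarith
      exact (mul_eq_zero.1 this).resolve_left hpos.ne'
    refine key (-1) 0 (by norm_num) ?_
    refine Prod.ext ?_ ?_ <;> ext i <;> fin_cases i <;> simp [h, h0]
  · intro h
    -- The factor is chosen so that the x₁ components match; the vanishing determinant then matches
    -- ξ₂, and the components x₂ and ξ₁ are fixed by `axisRev`.
    refine key 1 (-(L w).1 0 / (c (T / 2)).2 0) (by norm_num) ?_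
    refine Prod.ext ?_ ?_ <;> ext i <;> fin_cases i <;> simp [hamField, hξ, hg]
    · field_simp; ring
    · field_simp; linarith

end Linearised

/-! ### Orbits near the cycle cross the axis exactly once -/

section Crossing

open Set Filter Topology

variable {V : Plane → ℝ} {E T : ℝ} {c : ℝ → Phase} {Φ : ℝ → Phase → Phase} {Ω : Set Phase}

theorem IsLocalFlow.continuous_orbit (hΦ : IsLocalFlow V c Φ Ω) : Continuous c := by
  have := hΦ.continuous_time (c 0)
  rwa [funext hΦ.orbit] at this

theorem IsLocalFlow.eventually_mem (hΦ : IsLocalFlow V c Φ Ω) (M : ℝ) :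
    ∀ᶠ ρ in 𝓝 (c 0), ∀ t ∈ Icc (-M) M, Φ t ρ ∈ Ω := by
  obtain ⟨ε, hε, h⟩ := ((isCompact_Icc (a := -M) (b := M)).image
    hΦ.continuous_orbit).exists_thickening_subset_open hΦ.isOpen
      (image_subset_iff.2 fun t _ => hΦ.mem t)
  filter_upwards [hΦ.close M ε hε] with ρ hρ t ht
  exact h (Metric.mem_thickening_iff.2 ⟨c t, ⟨t, ht, rfl⟩, hρ t ht⟩)

theorem abs_fst_sub_le (ρ ρ' : Phase) (i : Fin 2) : |ρ.1 i - ρ'.1 i| ≤ dist ρ ρ' := by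
  have h1 := PiLp.norm_apply_le (ρ.1 - ρ'.1) i
  rw [PiLp.sub_apply, Real.norm_eq_abs, ← dist_eq_norm] at h1
  exact h1.trans (le_max_left _ _)

theorem abs_snd_sub_le (ρ ρ' : Phase) (i : Fin 2) : |ρ.2 i - ρ'.2 i| ≤ dist ρ ρ' := by
  have h1 := PiLp.norm_apply_le (ρ.2 - ρ'.2) i
  rw [PiLp.sub_apply, Real.norm_eq_abs, ← dist_eq_norm] at h1
  exact h1.trans (le_max_right _ _)

/-- On the time interval `[-T/4, 5T/4]`, the curve `f` crosses the axis exactly once, at time `t`,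
from the left to the right. -/
structure CrossesAt (T : ℝ) (f : ℝ → Phase) (t : ℝ) : Prop where
  eq_zero : (f t).1 0 = 0
  neg : ∀ s ∈ Icc (-(T / 4)) (T + T / 4), s < t → (f s).1 0 < 0
  pos : ∀ s ∈ Icc (-(T / 4)) (T + T / 4), t < s → 0 < (f s).1 0

theorem IsSymmetricCycle.crossesAt (hV : ContDiff ℝ ∞ V) (hs : ∀ x, V (refl x) = V x)
    (hc : IsSymmetricCycle V E c T) : CrossesAt T c (T / 2) := by
  have hneg : ∀ t ∈ Icc (-(T / 4)) (T + T / 4), t < T / 2 → (c t).1 0 < 0 := by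
    intro t ht htT
    rcases le_total 0 t with h | h
    · exact hc.left_neg t ⟨h, htT⟩
    · have h1 := hc.left_neg (-t) ⟨by linarith, by linarith [ht.1, hc.pos]⟩
      simpa [hc.timeRev_eq] using h1
  refine ⟨(hc.crossing hV hs).1, hneg, fun t ht htT => ?_⟩
  have h1 := hneg (T - t) ⟨by linarith [ht.2], by linarith [ht.1]⟩ (by linarith)
  rw [hc.axisRev_eq] at h1
  simpa using h1

/-- On the cycle, x₁ is bounded away from zero outside a short interval around `T / 2`, and its
derivative 2ξ₁ is bounded below inside. Both bounds survive a small perturbation, so there is one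
zero, in the short interval, where x₁ is strictly increasing. -/
theorem IsSymmetricCycle.eventually_crossesAt (hV : ContDiff ℝ ∞ V) (hs : ∀ x, V (refl x) = V x)
    (hc : IsSymmetricCycle V E c T) (hΦ : IsLocalFlow V c Φ Ω) {η : ℝ} (hη : 0 < η) :
    ∀ᶠ ρ in 𝓝 (c 0), ∃ t, |t - T / 2| < η ∧ CrossesAt T (fun t => Φ t ρ) t := by
  have hcr := hc.crossesAt hV hs
  obtain ⟨-, -, hpos, -⟩ := hc.crossing hV hs
  have hcc := hΦ.continuous_orbit
  have hT := hc.pos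
  set κ := (c (T / 2)).2 0 / 2 with hκ
  have hκ0 : 0 < κ := by positivity
  obtain ⟨d, hd, hdκ⟩ : ∃ d > 0, ∀ t, |t - T / 2| < d → κ < (c t).2 0 := by
    have h1 : ∀ᶠ t in 𝓝 (T / 2), κ < (c t).2 0 :=
      (Continuous.tendsto (f := fun t => (c t).2 0) (by fun_prop) _).eventually_const_lt
        (by rw [hκ]; linarith)
    obtain ⟨d, hd, h⟩ := Metric.eventually_nhds_iff.1 h1
    exact ⟨d, hd, fun t ht => h (by rwa [Real.dist_eq])⟩
  set η' := min (min η d) (T / 4) / 2 with hη'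
  have hη'1 : 0 < η' := by positivity
  have hη'm : η' < min (min η d) (T / 4) := half_lt_self (by positivity)
  have hη'η : η' < η := hη'm.trans_le ((min_le_left _ _).trans (min_le_left _ _))
  have hη'd : η' < d := hη'm.trans_le ((min_le_left _ _).trans (min_le_right _ _))
  have hη'T : η' < T / 4 := hη'm.trans_le (min_le_right _ _)
  obtain ⟨κ', hκ', hleft, hright⟩ : ∃ κ' > 0,
      (∀ t ∈ Icc (-(T / 4)) (T / 2 - η'), (c t).1 0 ≤ -κ') ∧
      ∀ t ∈ Icc (T / 2 + η') (T + T / 4), κ' ≤ (c t).1 0 := by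
    have hxc : Continuous fun t => (c t).1 0 := by fun_prop
    obtain ⟨t₁, ht₁, h1⟩ := (isCompact_Icc (a := -(T / 4)) (b := T / 2 - η')).exists_isMaxOn
      ⟨0, by constructor <;> linarith⟩ hxc.continuousOn
    obtain ⟨t₂, ht₂, h2⟩ := (isCompact_Icc (a := T / 2 + η') (b := T + T / 4)).exists_isMinOn
      ⟨T, by constructor <;> linarith⟩ hxc.continuousOn
    have hn := hcr.neg t₁ ⟨ht₁.1, by linarith [ht₁.2]⟩ (by linarith [ht₁.2])
    have hp := hcr.pos t₂ ⟨by linarith [ht₂.1], ht₂.2⟩ (by linarith [ht₂.1])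
    refine ⟨min (-(c t₁).1 0) ((c t₂).1 0), lt_min (by linarith) hp, fun t ht => ?_, fun t ht => ?_⟩
    · have := h1 ht
      have h3 : (c t).1 0 ≤ (c t₁).1 0 := this
      linarith [min_le_left (-(c t₁).1 0) ((c t₂).1 0)]
    · have h3 : (c t₂).1 0 ≤ (c t).1 0 := h2 ht
      exact (min_le_right _ _).trans h3
  filter_upwards [hΦ.close (T + T / 4) (min κ κ') (lt_min hκ0 hκ'),
    hΦ.eventually_mem (T + T / 4)] with ρ hclose hmem
  have hw : ∀ t ∈ Icc (-(T / 4)) (T + T / 4), t ∈ Icc (-(T + T / 4)) (T + T / 4) := fun t ht =>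
    ⟨by linarith [ht.1], ht.2⟩
  have hx : ∀ t ∈ Icc (-(T / 4)) (T + T / 4), |(Φ t ρ).1 0 - (c t).1 0| < κ' := fun t ht =>
    (abs_fst_sub_le _ _ 0).trans_lt ((hclose t (hw t ht)).trans_le (min_le_right _ _))
  have hξ : ∀ t ∈ Icc (-(T / 4)) (T + T / 4), |(Φ t ρ).2 0 - (c t).2 0| < κ := fun t ht =>
    (abs_snd_sub_le _ _ 0).trans_lt ((hclose t (hw t ht)).trans_le (min_le_left _ _))
  have hl : ∀ t ∈ Icc (-(T / 4)) (T / 2 - η'), (Φ t ρ).1 0 < 0 := fun t ht => by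
    have h1 := (abs_lt.1 (hx t ⟨ht.1, by linarith [ht.2]⟩)).2
    linarith [hleft t ht]
  have hr : ∀ t ∈ Icc (T / 2 + η') (T + T / 4), 0 < (Φ t ρ).1 0 := fun t ht => by
    have h1 := (abs_lt.1 (hx t ⟨by linarith [ht.1], ht.2⟩)).1
    linarith [hright t ht]
  have hxcont : Continuous fun t => (Φ t ρ).1 0 := by
    have := hΦ.continuous_time ρ
    fun_prop
  have hmid : ∀ t ∈ Icc (T / 2 - η') (T / 2 + η'), t ∈ Icc (-(T / 4)) (T + T / 4) := fun t ht =>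
    ⟨by linarith [ht.1], by linarith [ht.2]⟩
  have hmono : StrictMonoOn (fun t => (Φ t ρ).1 0) (Icc (T / 2 - η') (T / 2 + η')) := by
    refine strictMonoOn_of_deriv_pos (convex_Icc _ _) hxcont.continuousOn fun t ht => ?_
    rw [interior_Icc] at ht
    have ht' := hmid t (Ioo_subset_Icc_self ht)
    have hdt : HasDerivAt (fun t => (Φ t ρ).1 0) (2 * (Φ t ρ).2 0) t :=
      (((PiLp.proj 2 (fun _ : Fin 2 => ℝ) 0 : Plane →L[ℝ] ℝ).comp
        (ContinuousLinearMap.fst ℝ Plane Plane)).hasFDerivAt.comp_hasDerivAt t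
          (hΦ.bichar ρ t (hmem t (hw t ht'))))
    rw [hdt.deriv]
    have h1 := (abs_lt.1 (hξ t ht')).1
    have h2 := hdκ t (by rw [abs_lt]; constructor <;> linarith [ht.1, ht.2])
    linarith
  obtain ⟨t, ht, hzero⟩ := intermediate_value_Icc (show T / 2 - η' ≤ T / 2 + η' by linarith)
    hxcont.continuousOn ⟨(hl (T / 2 - η') ⟨by linarith, le_rfl⟩).le,
      (hr (T / 2 + η') ⟨le_rfl, by linarith⟩).le⟩
  have hzero' : (Φ t ρ).1 0 = 0 := hzero
  refine ⟨t, by rw [abs_lt]; constructor <;> linarith [ht.1, ht.2], hzero', fun s hs hst => ?_,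
    fun s hs hst => ?_⟩
  · rcases le_total s (T / 2 - η') with h | h
    · exact hl s ⟨hs.1, h⟩
    · have := hmono ⟨h, hst.le.trans ht.2⟩ ht hst
      simpa only [hzero'] using this
  · rcases le_total s (T / 2 + η') with h | h
    · have := hmono ht ⟨ht.1.trans hst.le, h⟩ hst
      simpa only [hzero'] using this
    · exact hr s ⟨h, hs.2⟩

/-- Two curves that cross the axis once and agree up to a translation in time cross at
corresponding times. -/
theorem CrossesAt.sub_eq_sub {f g : ℝ → Phase} {tf tg t s η δ : ℝ} (hf : CrossesAt T f tf)
    (hg : CrossesAt T g tg) (htf : |tf - T / 2| < η) (htg : |tg - T / 2| < η)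
    (ht : t ∈ Ioo (-δ) (T + δ)) (hs : s ∈ Ioo (-δ) (T + δ)) (hδ : δ + 2 * η ≤ T / 4)
    (h : ∀ u, f (t + u) = g (s + u)) : t - tf = s - tg := by
  obtain ⟨h1, h2⟩ := abs_lt.1 htf
  obtain ⟨h3, h4⟩ := abs_lt.1 htg
  have hst : f t = g s := by simpa using h 0
  have hz : (g (s + (tf - t))).1 0 = 0 := by
    rw [← h, add_sub_cancel, hf.eq_zero]
  have hη : 0 < η := (abs_nonneg _).trans_lt htf
  have hwin : ∀ u ∈ Icc (-(T / 4)) (T + T / 4), (g u).1 0 = 0 → u = tg := by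
    intro u hu hu0
    rcases lt_trichotomy u tg with h | h | h
    · exact absurd hu0 (hg.neg u hu h).ne
    · exact h
    · exact absurd hu0 (hg.pos u hu h).ne'
  -- The sign of x₁ at the common point puts `s` on the same side of `tg` as `t` is of `tf`. This
  -- keeps the time `s + (tf - t)` in the window, where `tg` is the only zero of x₁ along `g`.
  rcases lt_trichotomy t tf with hlt | heq | hgt
  · have hneg := hf.neg t ⟨by linarith [ht.1], by linarith [ht.2]⟩ hlt
    rw [hst] at hneg
    have hsg : s < tg := by
      by_contra hcon
      rcases (not_lt.1 hcon).eq_or_lt with h5 | h5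
      · rw [← h5, hg.eq_zero] at hneg; exact lt_irrefl _ hneg
      · exact absurd hneg (not_lt.2 (hg.pos s ⟨by linarith [hs.1], by linarith [hs.2]⟩ h5).le)
    have := hwin (s + (tf - t)) ⟨by linarith [hs.1], by linarith [ht.1]⟩ hz
    linarith
  · subst heq
    rw [sub_self, add_zero] at hz
    have := hwin s ⟨by linarith [hs.1], by linarith [hs.2]⟩ hz
    linarith
  · have hpos := hf.pos t ⟨by linarith [ht.1], by linarith [ht.2]⟩ hgt
    rw [hst] at hpos
    have hsg : tg < s := by
      by_contra hcon
      rcases (not_lt.1 hcon).eq_or_lt with h5 | h5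
      · rw [h5, hg.eq_zero] at hpos; exact lt_irrefl _ hpos
      · exact absurd hpos (not_lt.2 (hg.neg s ⟨by linarith [hs.1], by linarith [hs.2]⟩ h5).le)
    have := hwin (s + (tf - t)) ⟨by linarith [ht.2], by linarith [hs.2]⟩ hz
    linarith

end Crossing

/-! ### The orbit of a transversal family that crosses the axis orthogonally -/

section Orbits

open Set Filter Topology Metric

/-- The implicit function theorem, in the form used here. -/
theorem exists_implicit_zero {P Q : Type*} [NormedAddCommGroup P] [NormedSpace ℝ P]
    [FiniteDimensional ℝ P] [NormedAddCommGroup Q] [NormedSpace ℝ Q] [FiniteDimensional ℝ Q]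
    {G : P × Q → Q} {G' : P × Q →L[ℝ] Q} {p₀ : P} {q₀ : Q} (hG : HasStrictFDerivAt G G' (p₀, q₀))
    (hinj : ∀ q, G' (0, q) = 0 → q = 0) :
    (∃ ε > 0, ∀ p ∈ ball p₀ ε, ∀ q ∈ ball q₀ ε, ∀ q' ∈ ball q₀ ε, G (p, q) = G (p, q') → q = q') ∧
      ∃ g : P → Q, Tendsto g (𝓝 p₀) (𝓝 q₀) ∧ ∀ᶠ p in 𝓝 p₀, G (p, g p) = G (p₀, q₀) := by
  have : CompleteSpace P := FiniteDimensional.complete ℝ P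
  have : CompleteSpace Q := FiniteDimensional.complete ℝ Q
  set M' : P × Q →L[ℝ] P × Q := (ContinuousLinearMap.fst ℝ P Q).prod G' with hM'
  have hM'inj : Function.Injective M' := by
    refine (injective_iff_map_eq_zero M').2 ?_
    rintro ⟨p, q⟩ h
    have h1 : p = 0 := congrArg Prod.fst h
    subst h1
    rw [hinj q (congrArg Prod.snd h)]
    rfl
  let L : (P × Q) ≃L[ℝ] P × Q :=
    (LinearEquiv.ofInjectiveEndo (M' : P × Q →ₗ[ℝ] P × Q) hM'inj).toContinuousLinearEquiv
  have hL : (L : P × Q →L[ℝ] P × Q) = M' := by ext <;> rfl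
  have hM : HasStrictFDerivAt (fun x : P × Q => (x.1, G x)) (L : P × Q →L[ℝ] P × Q) (p₀, q₀) := by
    rw [hL]
    exact hasStrictFDerivAt_fst.prodMk hG
  constructor
  · have h1 := hM.eventually_left_inverse
    obtain ⟨ε, hε, h⟩ := eventually_nhds_iff_ball.1 h1
    refine ⟨ε, hε, fun p hp q hq q' hq' heq => ?_⟩
    rw [← ball_prod_same] at h
    have h2 := h (p, q) ⟨hp, hq⟩
    have h3 := h (p, q') ⟨hp, hq'⟩
    simp only at h2 h3
    rw [heq, h3] at h2
    exact (congrArg Prod.snd h2).symm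
  · refine ⟨fun p => (hM.localInverse _ _ _ (p, G (p₀, q₀))).2, ?_, ?_⟩
    · have h1 : Tendsto (fun p : P => (p, G (p₀, q₀))) (𝓝 p₀) (𝓝 (p₀, G (p₀, q₀))) :=
        (Continuous.prodMk continuous_id continuous_const).tendsto p₀
      exact (continuous_snd.tendsto _).comp (hM.localInverse_tendsto.comp h1)
    · have h1 : Tendsto (fun p : P => (p, G (p₀, q₀))) (𝓝 p₀) (𝓝 (p₀, G (p₀, q₀))) :=
        (Continuous.prodMk continuous_id continuous_const).tendsto p₀
      filter_upwards [h1.eventually hM.eventually_right_inverse] with p hp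
      have h2 := congrArg Prod.fst hp
      have h3 := congrArg Prod.snd hp
      simp only at h2 h3
      set x := hM.localInverse _ _ _ (p, G (p₀, q₀))
      have h4 : (p, x.2) = x := Prod.ext h2.symm rfl
      rw [h4]
      exact h3

variable {V : Plane → ℝ} {E T : ℝ} {c : ℝ → Phase} {Φ : ℝ → Phase → Phase} {Ω : Set Phase}

/-- A family, depending on a parameter `y`, of surfaces that are invariant under the flow and whose
tangent plane at `c 0` contains an admissible transversal direction. -/
structure IsTransversalFamily (V : Plane → ℝ) (c : ℝ → Phase) (Φ : ℝ → Phase → Phase)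
    (κ : Plane → ℝ × ℝ → Phase) : Prop where
  shift : ∃ ε > 0, ∀ y ∈ ball (c 0).1 ε, ∀ α β h : ℝ, |α| < ε → |β| < ε → |h| < ε →
    Φ h (κ y (α, β)) = κ y (α + h, β)
  base : κ (c 0).1 0 = c 0
  strict : ∃ (κ' : Plane × (ℝ × ℝ) →L[ℝ] Phase) (w : Phase) (s : ℝ),
    HasStrictFDerivAt (fun p : Plane × (ℝ × ℝ) => κ p.1 p.2) κ' ((c 0).1, 0) ∧
    (∀ α β : ℝ, κ' (0, (α, β)) = α • hamField V (c 0) + β • w) ∧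
    s * s = 1 ∧ timeRev w = s • w ∧ fderiv ℝ (symbolQ V) (c 0) w = 0 ∧
    ∀ l : ℝ, w ≠ l • hamField V (c 0)
  energy : ∀ᶠ p : Plane × (ℝ × ℝ) in 𝓝 ((c 0).1, 0), symbolQ V (κ p.1 p.2) = -V p.1

/-- The linear map `(ρ ↦ (x₁, x₂))` or, for `i = true`, `(ρ ↦ (x₁, ξ₂))`. -/
noncomputable def axisCoord (i : Bool) : Phase →L[ℝ] ℝ × ℝ :=
  ((PiLp.proj 2 (fun _ : Fin 2 => ℝ) 0 : Plane →L[ℝ] ℝ).comp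
    (ContinuousLinearMap.fst ℝ Plane Plane)).prod
  ((PiLp.proj 2 (fun _ : Fin 2 => ℝ) 1 : Plane →L[ℝ] ℝ).comp
    (if i then ContinuousLinearMap.snd ℝ Plane Plane else ContinuousLinearMap.fst ℝ Plane Plane))

@[simp] theorem axisCoord_true (ρ : Phase) : axisCoord true ρ = (ρ.1 0, ρ.2 1) := rfl

@[simp] theorem axisCoord_false (ρ : Phase) : axisCoord false ρ = (ρ.1 0, ρ.1 1) := rfl

theorem axisRev_eq_self_iff (ρ : Phase) : axisRev ρ = ρ ↔ axisCoord true ρ = 0 := by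
  rw [axisCoord_true, axisRev_apply]
  constructor
  · intro h
    have h1 := congrArg (fun ρ : Phase => ρ.1 0) h
    have h2 := congrArg (fun ρ : Phase => ρ.2 1) h
    simp at h1 h2
    refine Prod.ext ?_ ?_ <;> simp <;> linarith
  · intro h
    have h1 : ρ.1 0 = 0 := congrArg Prod.fst h
    have h2 : ρ.2 1 = 0 := congrArg Prod.snd h
    refine Prod.ext ?_ ?_ <;> ext i <;> fin_cases i <;> simp [h1, h2]

/-- The derivative in the surface parameters is invertible: the flow direction moves x₁ at the speed
2ξ₁ ≠ 0, and the two non-vanishing quantities of `IsSymmetricCycle.transversal` are, up to a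
non-zero factor, the determinants for (x₁, x₂) and (x₁, ξ₂). -/
theorem IsTransversalFamily.axisCoord_fibre (hV : ContDiff ℝ ∞ V) (hs : ∀ x, V (refl x) = V x)
    (hc : IsSymmetricCycle V E c T) (hΦ : IsLocalFlow V c Φ Ω) {κ : Plane → ℝ × ℝ → Phase}
    (hκ : IsTransversalFamily V c Φ κ) (i : Bool) :
    (∃ ε > 0, ∀ y ∈ ball (c 0).1 ε, ∀ q ∈ ball (0 : ℝ × ℝ) ε, ∀ q' ∈ ball (0 : ℝ × ℝ) ε,
        axisCoord i (Φ (T / 2) (κ y q)) = axisCoord i (Φ (T / 2) (κ y q')) → q = q') ∧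
      ∃ g : Plane → ℝ × ℝ, Tendsto g (𝓝 (c 0).1) (𝓝 0) ∧
        ∀ᶠ y in 𝓝 (c 0).1, axisCoord i (Φ (T / 2) (κ y (g y))) = axisCoord i (c (T / 2)) := by
  obtain ⟨κ', w, s, hκ', hκw, hs1, hw, hq, hne⟩ := hκ.strict
  obtain ⟨L, hL, hLW⟩ := hΦ.strict (T / 2) (by linarith [hc.pos])
  obtain ⟨hLH, htr⟩ := hc.transversal hV hs hΦ hL hLW
  obtain ⟨hne1, hne2⟩ := htr w s hs1 hw hq hne
  obtain ⟨-, hξ, hpos, hg⟩ := hc.crossing hV hs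
  have hL' : HasStrictFDerivAt (Φ (T / 2)) L (κ (c 0).1 0) := by rwa [hκ.base]
  have hG : HasStrictFDerivAt (fun p : Plane × (ℝ × ℝ) => axisCoord i (Φ (T / 2) (κ p.1 p.2)))
      ((axisCoord i).comp (L.comp κ')) ((c 0).1, 0) :=
    (axisCoord i).hasStrictFDerivAt.comp _ (hL'.comp ((c 0).1, (0 : ℝ × ℝ)) hκ')
  have hfin := exists_implicit_zero hG ?_
  · simpa only [hκ.base, hΦ.orbit] using hfin
  rintro ⟨α, β⟩ h
  simp only [ContinuousLinearMap.comp_apply, hκw, map_add, map_smul, hLH] at h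
  have h1 : α * (2 * (c (T / 2)).2 0) + β * (L w).1 0 = 0 := by
    have := congrArg Prod.fst h
    cases i <;> simpa [hamField] using this
  cases i
  · have h2 : β * (L w).1 1 = 0 := by
      have := congrArg Prod.snd h
      simpa [hamField, hξ] using this
    have hβ := (mul_eq_zero.1 h2).resolve_right hne1
    rw [hβ, zero_mul, add_zero] at h1
    have hα := (mul_eq_zero.1 h1).resolve_right (by positivity)
    rw [hα, hβ]; rfl
  · have h2 : α * gradient V (c (T / 2)).1 1 + β * (L w).2 1 = 0 := by
      have := congrArg Prod.snd h
      simpa [hamField] using this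
    have hβ : β = 0 := by
      have : β * (2 * (c (T / 2)).2 0 * (L w).2 1 - gradient V (c (T / 2)).1 1 * (L w).1 0) = 0 := by
        linear_combination 2 * (c (T / 2)).2 0 * h2 - gradient V (c (T / 2)).1 1 * h1
      exact (mul_eq_zero.1 this).resolve_right hne2
    rw [hβ, zero_mul, add_zero] at h1
    have hα := (mul_eq_zero.1 h1).resolve_right (by positivity)
    rw [hα, hβ]; rfl

/-- In a transversal family, the surface with parameter `y` contains exactly one orbit that crosses
the axis orthogonally; two points on this surface, one orbit of which meets the mirror image of
the other one, lie on that orbit. -/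
theorem IsTransversalFamily.exists_orbit (hV : ContDiff ℝ ∞ V) (hs : ∀ x, V (refl x) = V x)
    (hc : IsSymmetricCycle V E c T) (hΦ : IsLocalFlow V c Φ Ω) {κ : Plane → ℝ × ℝ → Phase}
    (hκ : IsTransversalFamily V c Φ κ) :
    ∃ (η : ℝ) (ε : ℝ) (g : Plane → ℝ × ℝ), 0 < η ∧ η ≤ T / 16 ∧ 0 < ε ∧
      Tendsto g (𝓝 (c 0).1) (𝓝 0) ∧
      (∀ y ∈ ball (c 0).1 ε, ∀ q ∈ ball (0 : ℝ × ℝ) ε, ∀ q' ∈ ball (0 : ℝ × ℝ) ε,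
        κ y q = κ y q' → q = q') ∧
      ∀ᶠ y in 𝓝 (c 0).1, axisRev (Φ (T / 2) (κ y (g y))) = Φ (T / 2) (κ y (g y)) ∧
        CrossesAt T (fun t => Φ t (κ y (g y))) (T / 2) ∧
        0 < (Φ (T / 2) (κ y (g y))).2 0 ∧
        (∀ t ∈ Icc (-(4 * T)) (4 * T), Φ t (κ y (g y)) ∈ Ω) ∧
        symbolQ V (κ y (g y)) = -V y ∧
        ∀ q ∈ ball (0 : ℝ × ℝ) ε, ∀ q' ∈ ball (0 : ℝ × ℝ) ε,
          (∀ t ∈ Icc (-(4 * T)) (4 * T), Φ t (κ y q) ∈ Ω) ∧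
          ∀ δ ≤ T / 8, ∀ t ∈ Ioo (-δ) (T + δ), ∀ s ∈ Ioo (-δ) (T + δ),
            Φ t (κ y q) = axisRev (Φ s (κ y q')) →
            ∃ d d', |d| < η ∧ |d'| < η ∧ κ y q = Φ (-d) (κ y (g y)) ∧
              κ y q' = Φ (-d') (κ y (g y)) ∧ t - T / 2 - d = -(s - T / 2 - d') := by
  obtain ⟨⟨ε₁, hε₁, hinj₁⟩, g, hg, hgA⟩ := hκ.axisCoord_fibre hV hs hc hΦ true
  obtain ⟨⟨ε₂, hε₂, hinj₂⟩, -⟩ := hκ.axisCoord_fibre hV hs hc hΦ false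
  obtain ⟨ε₃, hε₃, hshift⟩ := hκ.shift
  obtain ⟨hx, hξ, hpos, -⟩ := hc.crossing hV hs
  have hT := hc.pos
  set ε₄ := min (min ε₁ ε₂) (min ε₃ (T / 8)) with hε₄
  have hε₄0 : 0 < ε₄ := by positivity
  have h41 : ε₄ ≤ ε₁ := (min_le_left _ _).trans (min_le_left _ _)
  have h42 : ε₄ ≤ ε₂ := (min_le_left _ _).trans (min_le_right _ _)
  have h43 : ε₄ ≤ ε₃ := (min_le_right _ _).trans (min_le_left _ _)
  have h44 : ε₄ ≤ T / 8 := (min_le_right _ _).trans (min_le_right _ _)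
  -- Half of `ε₄`, so that parameters of size `ε ≤ η`, moved in time by less than `η`, stay where
  -- both injectivity statements hold.
  set η := ε₄ / 2 with hη
  have hη0 : 0 < η := by positivity
  have hκc : ContinuousAt (fun p : Plane × (ℝ × ℝ) => κ p.1 p.2) ((c 0).1, 0) := by
    obtain ⟨κ', w, s, hκ', -⟩ := hκ.strict
    exact hκ'.continuousAt
  have hκt : Tendsto (fun p : Plane × (ℝ × ℝ) => κ p.1 p.2) (𝓝 ((c 0).1, 0)) (𝓝 (c 0)) := by
    have := hκc.tendsto
    rwa [hκ.base] at this
  have hξΦ : ∀ᶠ ρ in 𝓝 (c 0), 0 < (Φ (T / 2) ρ).2 0 := by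
    have h1 : ContinuousAt (fun ρ => (Φ (T / 2) ρ).2 0) (c 0) := by
      have := hΦ.continuous_space (T / 2)
      fun_prop
    refine h1.tendsto.eventually_const_lt ?_
    rwa [hΦ.orbit]
  have hgood := (hc.eventually_crossesAt hV hs hΦ hη0).and
    ((hΦ.eventually_mem (4 * T)).and hξΦ)
  obtain ⟨ε₅, hε₅, hball⟩ := eventually_nhds_iff_ball.1 (hκt.eventually hgood)
  rw [← ball_prod_same] at hball
  set ε := min η ε₅ with hε
  have hεη : ε ≤ η := min_le_left _ _
  have hε5 : ε ≤ ε₅ := min_le_right _ _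
  have hε0 : 0 < ε := by positivity
  have hgp : Tendsto (fun y => (y, g y)) (𝓝 (c 0).1) (𝓝 ((c 0).1, 0)) := by
    rw [nhds_prod_eq]
    exact tendsto_id.prodMk hg
  refine ⟨η, ε, g, hη0, by linarith, hε0, hg, fun y hy q hq q' hq' h => ?_, ?_⟩
  · have h4 : ε ≤ ε₂ := by linarith
    exact hinj₂ y (ball_subset_ball h4 hy) q (ball_subset_ball h4 hq) q' (ball_subset_ball h4 hq')
      (by rw [h])
  filter_upwards [hgA, hgp.eventually (hκt.eventually hgood), hgp.eventually hκ.energy,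
    ball_mem_nhds _ hε0, hg.eventually (ball_mem_nhds _ hε0)] with y hA hgy hen hy hgyε
  obtain ⟨⟨tg, htg, hcr⟩, hΩ, hξ1⟩ := hgy
  have hA0 : axisCoord true (Φ (T / 2) (κ y (g y))) = 0 := by
    rw [hA, axisCoord_true, hx, hξ]; rfl
  -- The orbit selected by `g` is on the axis at time `T / 2` by construction, and its crossing is
  -- unique.
  have htg' : tg = T / 2 := by
    have hx0 : (Φ (T / 2) (κ y (g y))).1 0 = 0 := congrArg Prod.fst hA0
    rcases lt_trichotomy (T / 2) tg with h | h | h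
    · exact absurd hx0 (hcr.neg (T / 2) ⟨by linarith, by linarith⟩ h).ne
    · exact h.symm
    · exact absurd hx0 (hcr.pos (T / 2) ⟨by linarith, by linarith⟩ h).ne'
  rw [htg'] at hcr
  refine ⟨(axisRev_eq_self_iff _).2 hA0, hcr, hξ1, hΩ, hen, ?_⟩
  -- Invariance of the surface under the flow moves the crossing to the fixed time `T / 2`, at the
  -- cost of changing the time parameter of `q`.
  have hcomb : ∀ q ∈ ball (0 : ℝ × ℝ) ε, ∃ t, |t - T / 2| < η ∧ CrossesAt T (fun t => Φ t (κ y q)) t ∧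
      Φ t (κ y q) = Φ (T / 2) (κ y (q.1 + (t - T / 2), q.2)) ∧
      (q.1 + (t - T / 2), q.2) ∈ ball (0 : ℝ × ℝ) ε₄ := by
    rintro ⟨α, β⟩ hq
    obtain ⟨⟨t, ht, hcrt⟩, -⟩ := hball (y, (α, β)) ⟨ball_subset_ball hε5 hy, ball_subset_ball hε5 hq⟩
    rw [mem_ball_zero_iff, Prod.norm_def, max_lt_iff, Real.norm_eq_abs, Real.norm_eq_abs] at hq
    refine ⟨t, ht, hcrt, ?_, ?_⟩
    · rw [← hshift y (ball_subset_ball (by linarith) hy) α β (t - T / 2) (by linarith [hq.1])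
        (by linarith [hq.2]) (by linarith), ← hΦ.add, add_sub_cancel]
    · rw [mem_ball_zero_iff, Prod.norm_def, max_lt_iff, Real.norm_eq_abs, Real.norm_eq_abs]
      refine ⟨(abs_add_le _ _).trans_lt ?_, ?_⟩
      · have := hq.1
        simp only at this ⊢
        linarith
      · have := hq.2
        simp only at this ⊢
        linarith
  intro q hq q' hq'
  refine ⟨(hball (y, q) ⟨ball_subset_ball hε5 hy, ball_subset_ball hε5 hq⟩).2.1, ?_⟩
  intro δ hδ t ht s hs' heq
  obtain ⟨tf, htf, hcf, hXf, hqf⟩ := hcomb q hq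
  obtain ⟨tf', htf', hcf', hXf', hqf'⟩ := hcomb q' hq'
  -- The mirrored orbit, run backwards, also crosses once from left to right. It agrees with the
  -- first orbit up to a translation in time, so the two crossing points coincide.
  have hg' : CrossesAt T (fun v => axisRev (Φ (T - v) (κ y q'))) (T - tf') := by
    refine ⟨?_, fun v hv hvt => ?_, fun v hv hvt => ?_⟩
    · simp [hcf'.eq_zero]
    · have := hcf'.pos (T - v) ⟨by linarith [hv.2], by linarith [hv.1]⟩ (by linarith)
      simpa using this
    · have := hcf'.neg (T - v) ⟨by linarith [hv.2], by linarith [hv.1]⟩ (by linarith)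
      simpa using this
  have hsub := hcf.sub_eq_sub hg' (s := T - s) (δ := δ) htf
    (by rw [show T - tf' - T / 2 = -(tf' - T / 2) by ring, abs_neg]; exact htf') ht
    ⟨by linarith [hs'.2], by linarith [hs'.1]⟩ (by linarith) (fun u => by
      rw [add_comm t u, hΦ.add, heq, hΦ.axisRev_eq, ← hΦ.add]
      congr 2
      ring)
  have hX : Φ tf (κ y q) = axisRev (Φ tf' (κ y q')) := by
    rw [show tf = (tf - t) + t by ring, hΦ.add, heq, hΦ.axisRev_eq, ← hΦ.add]
    congr 2
    linarith
  have hz' := hcf'.eq_zero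
  rw [hXf, hXf'] at hX
  simp only [hXf'] at hz'
  -- On the axis `axisRev` does not change the position, and (x₁, x₂) separates the points of the
  -- surface.
  have hqq : (q.1 + (tf - T / 2), q.2) = (q'.1 + (tf' - T / 2), q'.2) := by
    refine hinj₂ y (ball_subset_ball (by linarith) hy) _ (ball_subset_ball h42 hqf) _
      (ball_subset_ball h42 hqf') ?_
    rw [hX]
    simp [hz']
  -- The crossing point now equals its own image under `axisRev`, and the coordinates (x₁, ξ₂)
  -- single out `g y`.
  have hqg : (q.1 + (tf - T / 2), q.2) = g y := by
    refine hinj₁ y (ball_subset_ball (by linarith) hy) _ (ball_subset_ball h41 hqf) _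
      (ball_subset_ball (by linarith) hgyε) ?_
    rw [hA0, ← axisRev_eq_self_iff]
    conv_rhs => rw [hX, ← hqq]
  have hback : ∀ t ρ, ρ = Φ (-t) (Φ t ρ) := fun t ρ => by
    rw [← hΦ.add, neg_add_cancel, hΦ.zero]
  have hqε : ∀ q ∈ ball (0 : ℝ × ℝ) ε, |q.1| < ε₃ ∧ |q.2| < ε₃ := by
    intro q hq
    rw [mem_ball_zero_iff, Prod.norm_def, max_lt_iff, Real.norm_eq_abs, Real.norm_eq_abs] at hq
    exact ⟨by linarith [hq.1], by linarith [hq.2]⟩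
  refine ⟨tf - T / 2, tf' - T / 2, htf, htf', ?_, ?_, by linarith⟩
  · rw [← hqg, ← hshift y (ball_subset_ball (by linarith) hy) q.1 q.2 _ (hqε q hq).1 (hqε q hq).2
      (by linarith), ← hback]
  · rw [← hqg, hqq, ← hshift y (ball_subset_ball (by linarith) hy) q'.1 q'.2 _ (hqε q' hq').1
      (hqε q' hq').2 (by linarith), ← hback]

end Orbits

/-! ### The intersection of a flow-out with its mirror image -/

section Intersection

open Set Filter Topology Metric

variable {V : Plane → ℝ} {E T : ℝ} {c : ℝ → Phase} {Φ : ℝ → Phase → Phase} {Ω : Set Phase}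

theorem IsLocalFlow.eq_of_bichar (hV : ContDiff ℝ ∞ V) (hΦ : IsLocalFlow V c Φ Ω)
    {f : ℝ → Phase} {a b t₀ : ℝ} (ht₀ : t₀ ∈ Icc a b) (hf : IsBicharOn V f (Icc a b)) {ρ : Phase}
    (hρ : ∀ t ∈ Icc a b, Φ t ρ ∈ Ω) (h : f t₀ = Φ t₀ ρ) : ∀ t ∈ Icc a b, f t = Φ t ρ :=
  eqOn_Icc_of_contDiff ((contDiff_hamField hV).of_le (by simp)) ht₀ hf
    (fun t ht => hΦ.bichar ρ t (hρ t ht)) h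

/-- The definition of `flowOut` allows any integral curve; as long as the orbits stay in `Ω`,
uniqueness identifies it with the complete flow. -/
theorem IsLocalFlow.mem_flowOut (hV : ContDiff ℝ ∞ V) (hΦ : IsLocalFlow V c Φ Ω) {A : Set Phase}
    {I : Set ℝ} {M : ℝ} (hA : ∀ ρ ∈ A, ∀ t ∈ Icc (-M) M, Φ t ρ ∈ Ω) (hM : 0 ≤ M)
    (hI : I ⊆ Icc (-M) M) {p : Phase} : p ∈ flowOut V A I ↔ ∃ ρ ∈ A, ∃ t ∈ I, Φ t ρ = p := by
  have hsub : ∀ t ∈ I, uIcc 0 t ⊆ Icc (-M) M := fun t ht =>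
    uIcc_subset_Icc ⟨by linarith, hM⟩ (hI ht)
  constructor
  · rintro ⟨f, t, ht, hf0, hf, rfl⟩
    refine ⟨f 0, hf0, t, ht, ?_⟩
    have h0 : (0 : ℝ) ∈ Icc (min 0 t) (max 0 t) := left_mem_uIcc
    exact (hΦ.eq_of_bichar hV h0 hf (fun s hs => hA _ hf0 s (hsub t ht hs)) (hΦ.zero _).symm t
      right_mem_uIcc).symm
  · rintro ⟨ρ, hρ, t, ht, rfl⟩
    exact ⟨fun t => Φ t ρ, t, ht, by simpa only [hΦ.zero] using hρ,
      fun s hs => hΦ.bichar ρ s (hA ρ hρ s (hsub t ht hs)), rfl⟩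

/-- The orbit of `ρ` reaches the axis orthogonally at time `T / 2`. -/
structure IsAxisOrbit (V : Plane → ℝ) (T : ℝ) (Φ : ℝ → Phase → Phase) (Ω : Set Phase) (E : ℝ)
    (ρ : Phase) : Prop where
  symm : axisRev (Φ (T / 2) ρ) = Φ (T / 2) ρ
  crosses : CrossesAt T (fun t => Φ t ρ) (T / 2)
  pos : 0 < (Φ (T / 2) ρ).2 0
  mem : ∀ t ∈ Icc (-(4 * T)) (4 * T), Φ t ρ ∈ Ω
  energy : symbolQ V ρ = -E

theorem IsAxisOrbit.axisRev_eq (hΦ : IsLocalFlow V c Φ Ω) {ρ : Phase}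
    (hρ : IsAxisOrbit V T Φ Ω E ρ) (u : ℝ) : axisRev (Φ (T / 2 + u) ρ) = Φ (T / 2 - u) ρ := by
  have h1 := hΦ.axisRev_eq (-u) (Φ (T / 2) ρ)
  rw [hρ.symm, neg_neg, ← hΦ.add, ← hΦ.add] at h1
  rw [add_comm, ← h1, sub_eq_add_neg, add_comm]

/-- The times, counted from the crossing of the axis, at which the orbit of `ρ` lies in the flow-out
of `A`. -/
def flowTimes (T : ℝ) (Φ : ℝ → Phase → Phase) (η δ : ℝ) (A : Set Phase) (ρ : Phase) : Set ℝ :=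
  {u | ∃ d, |d| < η ∧ Φ (-d) ρ ∈ A ∧ T / 2 + u + d ∈ Ioo (-δ) (T + δ)}

/-- The times at which the orbit of `ρ` lies in the flow-outs of `A` and of its mirror image. -/
def arcTimes (T : ℝ) (Φ : ℝ → Phase → Phase) (η δ : ℝ) (A : Set Phase) (ρ : Phase) : Set ℝ :=
  {u | u ∈ flowTimes T Φ η δ A ρ ∧ -u ∈ flowTimes T Φ η δ A ρ}

theorem isOpen_flowTimes {η δ : ℝ} {A : Set Phase} {ρ : Phase} :
    IsOpen (flowTimes T Φ η δ A ρ) := by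
  have : flowTimes T Φ η δ A ρ =
      ⋃ d ∈ {d : ℝ | |d| < η ∧ Φ (-d) ρ ∈ A}, (fun u => T / 2 + u + d) ⁻¹' Ioo (-δ) (T + δ) := by
    ext u
    simp only [flowTimes, mem_ofPred_eq, mem_iUnion, mem_preimage, exists_prop, and_assoc]
  rw [this]
  exact isOpen_biUnion fun d _ => isOpen_Ioo.preimage (by fun_prop)

/-- Each admissible `d` contributes a translate of one interval of length `T + 2 * δ`; two
translates are less than `2 * η ≤ T` apart and therefore overlap. -/
theorem ordConnected_flowTimes {η δ : ℝ} (hη : 2 * η ≤ T) (hδ : 0 < δ) {A : Set Phase} {ρ : Phase} :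
    (flowTimes T Φ η δ A ρ).OrdConnected := by
  refine ⟨?_⟩
  rintro u ⟨d, hd, hdA, hu⟩ w ⟨d', hd', hdA', hw⟩ v ⟨huv, hvw⟩
  have h1 := abs_lt.1 hd
  have h2 := abs_lt.1 hd'
  by_cases h : T / 2 + v + d < T + δ
  · exact ⟨d, hd, hdA, by linarith [hu.1], h⟩
  · exact ⟨d', hd', hdA', by linarith, by linarith [hw.2]⟩

theorem isOpen_arcTimes {η δ : ℝ} {A : Set Phase} {ρ : Phase} : IsOpen (arcTimes T Φ η δ A ρ) :=
  isOpen_flowTimes.inter (isOpen_flowTimes.preimage continuous_neg)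

theorem ordConnected_arcTimes {η δ : ℝ} (hη : 2 * η ≤ T) (hδ : 0 < δ) {A : Set Phase} {ρ : Phase} :
    (arcTimes T Φ η δ A ρ).OrdConnected := by
  have h := ordConnected_flowTimes (Φ := Φ) (A := A) (ρ := ρ) hη hδ
  refine ⟨fun u hu w hw v hv => ⟨h.out hu.1 hw.1 hv, h.out hw.2 hu.2 ?_⟩⟩
  exact ⟨neg_le_neg hv.2, neg_le_neg hv.1⟩

/-- Two coincident points on opposite sides of the crossing have x₁ of different signs. On the same
side, translating one of the two times to the crossing would give a second zero of x₁ in the window.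
-/
theorem IsAxisOrbit.injOn (hΦ : IsLocalFlow V c Φ Ω) {ρ : Phase} (hρ : IsAxisOrbit V T Φ Ω E ρ) :
    InjOn (fun u => Φ (T / 2 + u) ρ) (Icc (-(3 * T / 4)) (3 * T / 4)) := by
  have key : ∀ u ∈ Icc (-(3 * T / 4)) (3 * T / 4), ∀ w ∈ Icc (-(3 * T / 4)) (3 * T / 4), u < w →
      Φ (T / 2 + u) ρ ≠ Φ (T / 2 + w) ρ := by
    intro u hu w hw huw h
    have hneg : ∀ v ∈ Icc (-(3 * T / 4)) (3 * T / 4), v < 0 → (Φ (T / 2 + v) ρ).1 0 < 0 :=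
      fun v hv h0 => hρ.crosses.neg _ ⟨by linarith [hv.1], by linarith [hv.2]⟩ (by linarith)
    have hpos : ∀ v ∈ Icc (-(3 * T / 4)) (3 * T / 4), 0 < v → 0 < (Φ (T / 2 + v) ρ).1 0 :=
      fun v hv h0 => hρ.crosses.pos _ ⟨by linarith [hv.1], by linarith [hv.2]⟩ (by linarith)
    have hz := hρ.crosses.eq_zero
    have hshift : ∀ v, Φ (T / 2 + (u + v)) ρ = Φ (T / 2 + (w + v)) ρ := fun v => by
      rw [show T / 2 + (u + v) = v + (T / 2 + u) by ring, hΦ.add, h, ← hΦ.add]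
      congr 1
      ring
    rcases le_or_gt w 0 with hw0 | hw0
    · have h1 := hneg (u + -w) ⟨by linarith [hu.1], by linarith [hu.2, hw.1, hu.1]⟩ (by linarith)
      rw [hshift, add_neg_cancel, add_zero, hz] at h1
      exact lt_irrefl _ h1
    · rcases lt_or_ge u 0 with hu0 | hu0
      · have h1 := hneg u hu hu0
        have h2 := hpos w hw hw0
        rw [h] at h1
        exact lt_asymm h1 h2
      · have h1 := hpos (w + -u) ⟨by linarith [hw.1, hu.2], by linarith [hw.2]⟩ (by linarith)
        rw [← hshift, add_neg_cancel, add_zero, hz] at h1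
        exact lt_irrefl _ h1
  intro u hu w hw h
  rcases lt_trichotomy u w with hlt | heq | hgt
  · exact absurd h (key u hu w hw hlt)
  · exact heq
  · exact absurd h.symm (key w hw u hu hgt)

/-- The data under which the intersection of the flow-outs of `A` and of its mirror image is an arc
of the orbit of `ρ`. -/
structure IsArcGerm (T : ℝ) (Φ : ℝ → Phase → Phase) (Ω : Set Phase) (η δ : ℝ) (A : Set Phase)
    (ρ : Phase) : Prop where
  delta_pos : 0 < δ
  delta_le : δ ≤ T / 8
  eta_le : η ≤ T / 16
  mem : ∀ p ∈ A, ∀ t ∈ Icc (-(4 * T)) (4 * T), Φ t p ∈ Ω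
  match_orbit : ∀ p ∈ A, ∀ p' ∈ A, ∀ t ∈ Ioo (-δ) (T + δ), ∀ s ∈ Ioo (-δ) (T + δ),
    Φ t p = axisRev (Φ s p') → ∃ d d', |d| < η ∧ |d'| < η ∧ p = Φ (-d) ρ ∧ p' = Φ (-d') ρ ∧
      t - T / 2 - d = -(s - T / 2 - d')
  nonempty : ∃ d, |d| < η ∧ Φ (-d) ρ ∈ A

/-- Since `axisRev` reverses the flow, the backward flow-out of the mirrored germ is the mirror
image of the forward flow-out. -/
theorem IsArcGerm.mem_right (hV : ContDiff ℝ ∞ V) (hΦ : IsLocalFlow V c Φ Ω) {η δ : ℝ}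
    {A : Set Phase} {ρ : Phase} (hA : IsArcGerm T Φ Ω η δ A ρ) {p : Phase} :
    p ∈ flowOut V (axisRev '' A) (Ioo (-(T + δ)) δ) ↔
      ∃ ρ ∈ A, ∃ s ∈ Ioo (-δ) (T + δ), axisRev (Φ s ρ) = p := by
  have h1 := hA.delta_le
  have h2 := hA.delta_pos
  rw [hΦ.mem_flowOut hV (M := 4 * T) _ (by linarith)
    fun t ht => ⟨by linarith [ht.1], by linarith [ht.2]⟩]
  · constructor
    · rintro ⟨_, ⟨q, hq, rfl⟩, t, ht, rfl⟩
      exact ⟨q, hq, -t, ⟨by linarith [ht.2], by linarith [ht.1]⟩, (hΦ.axisRev_eq t q).symm⟩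
    · rintro ⟨q, hq, s, hs, rfl⟩
      exact ⟨_, ⟨q, hq, rfl⟩, -s, ⟨by linarith [hs.2], by linarith [hs.1]⟩, by
        rw [hΦ.axisRev_eq, neg_neg]⟩
  · rintro _ ⟨q, hq, rfl⟩ t ht
    rw [hΦ.axisRev_eq]
    exact hΦ.axisRev_mem _ (hA.mem q hq _ ⟨by linarith [ht.2], by linarith [ht.1]⟩)

theorem IsArcGerm.mem_left (hV : ContDiff ℝ ∞ V) (hΦ : IsLocalFlow V c Φ Ω) {η δ : ℝ}
    {A : Set Phase} {ρ : Phase} (hA : IsArcGerm T Φ Ω η δ A ρ) {p : Phase} :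
    p ∈ flowOut V A (Ioo (-δ) (T + δ)) ↔ ∃ ρ ∈ A, ∃ t ∈ Ioo (-δ) (T + δ), Φ t ρ = p := by
  have h1 := hA.delta_le
  have h2 := hA.delta_pos
  exact hΦ.mem_flowOut hV (M := 4 * T) hA.mem (by linarith)
    fun t ht => ⟨by linarith [ht.1], by linarith [ht.2]⟩

/-- With time counted from the crossing, `axisRev` acts on the symmetric orbit as `u ↦ -u`; this is
why `arcTimes` asks for both `u` and `-u`. That no other orbit contributes is `match_orbit`. -/
theorem IsArcGerm.inter_eq (hV : ContDiff ℝ ∞ V) (hΦ : IsLocalFlow V c Φ Ω) {η δ : ℝ}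
    {A : Set Phase} {ρ : Phase} (hA : IsArcGerm T Φ Ω η δ A ρ) (hρ : IsAxisOrbit V T Φ Ω E ρ) :
    flowOut V A (Ioo (-δ) (T + δ)) ∩ flowOut V (axisRev '' A) (Ioo (-(T + δ)) δ) =
      (fun u => Φ (T / 2 + u) ρ) '' arcTimes T Φ η δ A ρ := by
  ext p
  rw [mem_inter_iff, hA.mem_left hV hΦ, hA.mem_right hV hΦ]
  constructor
  · rintro ⟨⟨q, hq, t, ht, rfl⟩, q', hq', s, hs, h⟩
    obtain ⟨d, d', hd, hd', rfl, rfl, hts⟩ := hA.match_orbit q hq q' hq' t ht s hs h.symm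
    refine ⟨t - T / 2 - d, ⟨⟨d, hd, hq, ?_⟩, d', hd', hq', ?_⟩, ?_⟩
    · rwa [show T / 2 + (t - T / 2 - d) + d = t by ring]
    · rwa [show T / 2 + -(t - T / 2 - d) + d' = s by rw [hts]; ring]
    · change Φ (T / 2 + (t - T / 2 - d)) ρ = _
      rw [← hΦ.add]
      congr 1
      ring
  · rintro ⟨u, ⟨⟨d, hd, hdA, hu⟩, d', hd', hdA', hu'⟩, rfl⟩
    refine ⟨⟨_, hdA, _, hu, ?_⟩, _, hdA', _, hu', ?_⟩
    · rw [← hΦ.add]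
      congr 1
      ring
    · rw [← hΦ.add, show T / 2 + -u + d' + -d' = T / 2 + -u by ring, hρ.axisRev_eq hΦ]
      congr 1
      ring

/-- The constant is 11/16 = 1/2 + 1/8 + 1/16, from the bounds on `δ` and `η`. It lies below the 3/4
of the injectivity window. -/
theorem IsArcGerm.arcTimes_subset {η δ : ℝ} {A : Set Phase} {ρ : Phase}
    (hA : IsArcGerm T Φ Ω η δ A ρ) :
    arcTimes T Φ η δ A ρ ⊆ Ioo (-(11 * T / 16)) (11 * T / 16) := by
  rintro u ⟨⟨d, hd, -, hu⟩, -⟩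
  have h1 := abs_lt.1 hd
  have h2 := hA.delta_le
  have h3 := hA.eta_le
  have h4 := hA.delta_pos
  exact ⟨by linarith [hu.1], by linarith [hu.2]⟩

theorem IsArcGerm.zero_mem {η δ : ℝ} {A : Set Phase} {ρ : Phase}
    (hA : IsArcGerm T Φ Ω η δ A ρ) : (0 : ℝ) ∈ arcTimes T Φ η δ A ρ := by
  obtain ⟨d, hd, hdA⟩ := hA.nonempty
  have h1 := abs_lt.1 hd
  have h2 := hA.delta_le
  have h3 := hA.eta_le
  have h4 := hA.delta_pos
  have h5 : (0 : ℝ) ∈ flowTimes T Φ η δ A ρ := ⟨d, hd, hdA, by linarith, by linarith⟩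
  exact ⟨h5, by rwa [neg_zero]⟩

theorem IsArcGerm.isBicharArc (hV : ContDiff ℝ ∞ V) (hΦ : IsLocalFlow V c Φ Ω) {η δ : ℝ}
    {A : Set Phase} {ρ : Phase} (hA : IsArcGerm T Φ Ω η δ A ρ) (hρ : IsAxisOrbit V T Φ Ω E ρ) :
    IsBicharArc V E
      (flowOut V A (Ioo (-δ) (T + δ)) ∩ flowOut V (axisRev '' A) (Ioo (-(T + δ)) δ)) := by
  have h1 := hA.delta_le
  have h3 := hA.eta_le
  have h4 := hA.delta_pos
  refine ⟨fun u => Φ (T / 2 + u) ρ, arcTimes T Φ η δ A ρ, isOpen_arcTimes,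
    ordConnected_arcTimes (by linarith) h4, ⟨0, hA.zero_mem⟩, fun u hu => ?_,
    (hρ.injOn hΦ).mono (fun u hu => ?_), fun u _ => ?_,
    hA.inter_eq hV hΦ hρ⟩
  · have h5 := hA.arcTimes_subset hu
    exact (hΦ.bichar ρ _ (hρ.mem _ ⟨by linarith [h5.1], by linarith [h5.2]⟩)).comp_const_add (T / 2) u
  · have h5 := hA.arcTimes_subset hu
    exact ⟨by linarith [h5.1], by linarith [h5.2]⟩
  · rw [hΦ.energy, hρ.energy]

theorem IsArcGerm.crossesAxisOrthogonally (hV : ContDiff ℝ ∞ V) (hΦ : IsLocalFlow V c Φ Ω)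
    {η δ : ℝ} {A : Set Phase} {ρ : Phase} (hA : IsArcGerm T Φ Ω η δ A ρ)
    (hρ : IsAxisOrbit V T Φ Ω E ρ) :
    CrossesAxisOrthogonally V
      (flowOut V A (Ioo (-δ) (T + δ)) ∩ flowOut V (axisRev '' A) (Ioo (-(T + δ)) δ)) := by
  refine ⟨Φ (T / 2) ρ, ?_, ?_, ?_⟩
  · rw [hA.inter_eq hV hΦ hρ]
    ext p
    constructor
    · rintro ⟨⟨u, hu, rfl⟩, hp⟩
      have hp' : (Φ (T / 2 + u) ρ).1 0 = 0 := hp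
      have h5 := hA.arcTimes_subset hu
      rcases lt_trichotomy u 0 with h | h | h
      · exact absurd hp' (hρ.crosses.neg _ ⟨by linarith [h5.1, h5.2], by linarith [h5.1, h5.2]⟩
          (by linarith)).ne
      · subst h
        simp
      · exact absurd hp' (hρ.crosses.pos _ ⟨by linarith [h5.1, h5.2], by linarith [h5.1, h5.2]⟩
          (by linarith)).ne'
    · rintro rfl
      exact ⟨⟨0, hA.zero_mem, by simp⟩, hρ.crosses.eq_zero⟩
  · have := hρ.pos
    simp only [hamField, PiLp.smul_apply, smul_eq_mul]
    positivity
  · have h1 := (axisRev_eq_self_iff _).1 hρ.symm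
    have h2 : (Φ (T / 2) ρ).2 1 = 0 := congrArg Prod.snd h1
    simp [hamField, h2]

end Intersection

/-! ### The harmonic well: explicit orbits -/

section Model

open Set Filter Topology Metric

variable {lam : Fin 2 → ℝ} {e : OrthonormalBasis (Fin 2) ℝ Plane} {a : Plane}

/-- The Cartesian coordinates `z`. -/
noncomputable def coord (e : OrthonormalBasis (Fin 2) ℝ Plane) (a x : Plane) (j : Fin 2) : ℝ :=
  inner ℝ (e j) (x - a)

/-- The point at time `t` (a different time for each degree of freedom) of the orbit of the harmonic
oscillator that is at rest, at time zero, at the point with coordinates `p`. -/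
noncomputable def modelPoint (lam : Fin 2 → ℝ) (e : OrthonormalBasis (Fin 2) ℝ Plane) (a : Plane)
    (p t : Fin 2 → ℝ) : Phase :=
  (a + ∑ j, (p j * Real.cosh (2 * lam j * t j)) • e j,
    ∑ j, (lam j * p j * Real.sinh (2 * lam j * t j)) • e j)

theorem inner_sum_smul (f : Fin 2 → ℝ) (i : Fin 2) : inner ℝ (e i) (∑ j, f j • e j) = f i := by
  exact e.orthonormal.inner_right_fintype f i

@[simp] theorem coord_modelPoint (p t : Fin 2 → ℝ) (j : Fin 2) :
    coord e a (modelPoint lam e a p t).1 j = p j * Real.cosh (2 * lam j * t j) := by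
  rw [coord, modelPoint, add_sub_cancel_left, inner_sum_smul]

@[simp] theorem inner_modelPoint_snd (p t : Fin 2 → ℝ) (j : Fin 2) :
    inner ℝ (e j) (modelPoint lam e a p t).2 = lam j * p j * Real.sinh (2 * lam j * t j) := by
  rw [modelPoint, inner_sum_smul]

theorem eq_of_inner_eq {x y : Plane} (h : ∀ j, inner ℝ (e j) x = inner ℝ (e j) y) : x = y := by
  refine e.repr.injective ?_
  ext j
  simpa [e.repr_apply_apply] using h j

theorem eq_of_coord_eq {x y : Plane} (h : ∀ j, coord e a x j = coord e a y j) : x = y :=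
  sub_left_injective (eq_of_inner_eq (e := e) h)

theorem phase_eq_of_coord_eq {ρ ρ' : Phase} (h1 : ∀ j, coord e a ρ.1 j = coord e a ρ'.1 j)
    (h2 : ∀ j, inner ℝ (e j) ρ.2 = inner ℝ (e j) ρ'.2) : ρ = ρ' :=
  Prod.ext (eq_of_coord_eq h1) (eq_of_inner_eq h2)

theorem modelPoint_coord_zero (x : Plane) : modelPoint lam e a (coord e a x) 0 = (x, 0) :=
  phase_eq_of_coord_eq (e := e) (a := a) (by simp) (by simp)

theorem quad_eq_sum (x : Plane) : quad lam e a x = ∑ j, (lam j) ^ 2 * (coord e a x j) ^ 2 := rfl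

theorem continuous_coord : Continuous (coord e a) := by
  unfold coord
  fun_prop

theorem contDiff_modelPoint :
    ContDiff ℝ ∞ fun x : (Fin 2 → ℝ) × (Fin 2 → ℝ) => modelPoint lam e a x.1 x.2 := by
  unfold modelPoint
  have hp : ∀ j, ContDiff ℝ ∞ fun x : (Fin 2 → ℝ) × (Fin 2 → ℝ) => x.1 j := fun j => by fun_prop
  have ht : ∀ j, ContDiff ℝ ∞ fun x : (Fin 2 → ℝ) × (Fin 2 → ℝ) => 2 * lam j * x.2 j :=
    fun j => by fun_prop
  refine ContDiff.prodMk (contDiff_const.add (ContDiff.sum fun j _ => ?_))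
    (ContDiff.sum fun j _ => ?_)
  · exact ((hp j).mul (Real.contDiff_cosh.comp (ht j))).smul contDiff_const
  · exact ((contDiff_const.mul (hp j)).mul (Real.contDiff_sinh.comp (ht j))).smul contDiff_const

/-- Derivative of `modelPoint` with respect to the times. -/
theorem hasDerivAt_modelPoint_time (p t τ : Fin 2 → ℝ) (s : ℝ) :
    HasDerivAt (fun s : ℝ => modelPoint lam e a p (t + s • τ))
      (∑ j, (2 * lam j * p j * τ j * Real.sinh (2 * lam j * (t j + s * τ j))) • e j,
        ∑ j, (2 * lam j ^ 2 * p j * τ j * Real.cosh (2 * lam j * (t j + s * τ j))) • e j) s := by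
  have h : ∀ j, HasDerivAt (fun s : ℝ => 2 * lam j * (t j + s * τ j)) (2 * lam j * τ j) s := by
    intro j
    simpa using (((hasDerivAt_id s).mul_const (τ j)).const_add (t j)).const_mul (2 * lam j)
  refine HasDerivAt.prodMk (HasDerivAt.const_add a (HasDerivAt.fun_sum fun j _ => ?_))
    (HasDerivAt.fun_sum fun j _ => ?_)
  · have h1 := (((h j).cosh).const_mul (p j)).smul_const (e j)
    refine h1.congr_deriv ?_
    congr 1
    ring
  · have h1 := (((h j).sinh).const_mul (lam j * p j)).smul_const (e j)
    refine h1.congr_deriv ?_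
    congr 1
    ring

theorem gradient_quad (x : Plane) :
    gradient (quad lam e a) x = ∑ j, (2 * lam j ^ 2 * coord e a x j) • e j := by
  refine ext_inner_right ℝ fun u => ?_
  have h : HasFDerivAt (quad lam e a)
      (∑ j, ((lam j) ^ 2 * (2 * coord e a x j)) • (innerSL ℝ (e j))) x := by
    unfold quad
    refine HasFDerivAt.fun_sum fun j _ => ?_
    have h1 : HasFDerivAt (fun x => inner ℝ (e j) (x - a)) (innerSL ℝ (e j)) x :=
      (innerSL ℝ (e j)).hasFDerivAt.comp x ((hasFDerivAt_id x).sub_const a)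
    have h2 := (h1.pow 2).const_mul ((lam j) ^ 2)
    refine h2.congr_fderiv ?_
    ext u
    simp [coord]
    ring
  rw [inner_gradient, h.fderiv]
  simp only [Fin.sum_univ_two, inner_add_left, real_inner_smul_left, add_apply,
    smul_apply, innerSL_apply_apply, smul_eq_mul]
  ring

variable {V : Plane → ℝ}

theorem hamField_modelPoint {p t : Fin 2 → ℝ}
    (h : V =ᶠ[𝓝 (modelPoint lam e a p t).1] quad lam e a) :
    hamField V (modelPoint lam e a p t) =
      (∑ j, (2 * lam j * p j * Real.sinh (2 * lam j * t j)) • e j,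
        ∑ j, (2 * lam j ^ 2 * p j * Real.cosh (2 * lam j * t j)) • e j) := by
  have hg : gradient V (modelPoint lam e a p t).1 =
      gradient (quad lam e a) (modelPoint lam e a p t).1 := by
    rw [gradient, gradient, h.fderiv_eq]
  rw [hamField, hg, gradient_quad]
  refine Prod.ext ?_ ?_
  · simp only [modelPoint, Finset.smul_sum, smul_smul]
    refine Finset.sum_congr rfl fun j _ => ?_
    congr 1
    ring
  · simp only [coord_modelPoint, ← mul_assoc]

theorem norm_sq_eq_sum (u : Plane) : ‖u‖ ^ 2 = ∑ j, (inner ℝ (e j) u) ^ 2 := by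
  rw [← e.sum_sq_norm_inner_right u]
  simp

theorem symbolQ_modelPoint {p t : Fin 2 → ℝ}
    (h : V (modelPoint lam e a p t).1 = quad lam e a (modelPoint lam e a p t).1) :
    symbolQ V (modelPoint lam e a p t) = -∑ j, (lam j) ^ 2 * (p j) ^ 2 := by
  rw [symbolQ, h, quad_eq_sum, norm_sq_eq_sum (e := e), ← Finset.sum_sub_distrib,
    ← Finset.sum_neg_distrib]
  refine Finset.sum_congr rfl fun j _ => ?_
  rw [inner_modelPoint_snd, coord_modelPoint]
  linear_combination -(lam j) ^ 2 * (p j) ^ 2 * Real.cosh_sq (2 * lam j * t j)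

variable {E T ε₀ : ℝ} {c : ℝ → Phase} {Φ : ℝ → Phase → Phase} {Ω : Set Phase}

theorem tendsto_modelPoint (hrest : (c 0).2 = 0) :
    Tendsto (fun x : (Fin 2 → ℝ) × (Fin 2 → ℝ) => modelPoint lam e a x.1 x.2)
      (𝓝 (coord e a (c 0).1, 0)) (𝓝 (c 0)) := by
  have h := (contDiff_modelPoint (lam := lam) (e := e) (a := a)).continuous.tendsto
    (coord e a (c 0).1, 0)
  simp only [modelPoint_coord_zero] at h
  rwa [← hrest, Prod.mk.eta] at h

/-- Near the left end of the tunnel cycle, the flow is that of the harmonic oscillator. -/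
theorem IsLocalFlow.exists_model_flow (hV : ContDiff ℝ ∞ V) (hΦ : IsLocalFlow V c Φ Ω)
    (hrest : (c 0).2 = 0) (h0 : quad lam e a (c 0).1 = E) (hε₀ : 0 < ε₀)
    (hquad : ∀ x, quad lam e a x < E + ε₀ → V =ᶠ[𝓝 x] quad lam e a) :
    ∃ ε > 0, ∀ p ∈ ball (coord e a (c 0).1) ε, ∀ t ∈ ball (0 : Fin 2 → ℝ) ε,
      V =ᶠ[𝓝 (modelPoint lam e a p t).1] quad lam e a ∧
      ∀ h : ℝ, |h| < ε → Φ h (modelPoint lam e a p t) = modelPoint lam e a p (t + h • 1) := by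
  have hq : ∀ᶠ ρ : Phase in 𝓝 (c 0), quad lam e a ρ.1 < E + ε₀ := by
    have : Continuous fun ρ : Phase => quad lam e a ρ.1 := continuous_quad.comp continuous_fst
    refine this.tendsto _ |>.eventually_lt_const ?_
    rw [h0]
    linarith
  obtain ⟨d, hd, hball⟩ := eventually_nhds_iff_ball.1
    ((tendsto_modelPoint (lam := lam) (e := e) (a := a) hrest).eventually
      (hq.and (hΦ.eventually_mem 1)))
  rw [← ball_prod_same] at hball
  -- The half leaves room for adding the time `h` to `t`; the bound `1` is the time for which nearby
  -- orbits are known to stay in `Ω`.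
  have hm : min (d / 2) 1 ≤ d / 2 := min_le_left _ _
  refine ⟨min (d / 2) 1, by positivity, fun p hp t ht => ?_⟩
  have hp' : p ∈ ball (coord e a (c 0).1) d := ball_subset_ball (by linarith) hp
  have ht' : t ∈ ball (0 : Fin 2 → ℝ) d := ball_subset_ball (by linarith) ht
  refine ⟨hquad _ (hball (p, t) ⟨hp', ht'⟩).1, fun h hh => ?_⟩
  have hts : ∀ s ∈ Icc (-|h|) |h|, t + s • (1 : Fin 2 → ℝ) ∈ ball (0 : Fin 2 → ℝ) d := by
    intro s hs
    rw [mem_ball_zero_iff] at ht ⊢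
    have h1 : ‖s • (1 : Fin 2 → ℝ)‖ ≤ |h| := by
      rw [norm_smul, norm_one, mul_one, Real.norm_eq_abs]
      exact abs_le.2 hs
    linarith [norm_add_le t (s • (1 : Fin 2 → ℝ))]
  have h01 := hΦ.eq_of_bichar hV (f := fun s => modelPoint lam e a p (t + s • 1)) (a := -|h|)
    (b := |h|) (t₀ := 0) ⟨by simp, by simp⟩ (fun s hs => ?_) (ρ := modelPoint lam e a p t)
    (fun s hs => (hball (p, t) ⟨hp', ht'⟩).2 s ?_) (by simp [hΦ.zero]) h
    ⟨neg_abs_le h, le_abs_self h⟩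
  · exact h01.symm
  · rw [hamField_modelPoint (hquad _ (hball (p, t + s • 1) ⟨hp', hts s hs⟩).1)]
    refine (hasDerivAt_modelPoint_time p t 1 s).congr_deriv ?_
    simp
  · have h1 : |h| < 1 := hh.trans_le (min_le_right _ _)
    exact ⟨by linarith [hs.1], by linarith [hs.2]⟩

end Model

/-! ### Transversal families built from explicit orbits -/

section Families

open Set Filter Topology Metric

variable {lam : Fin 2 → ℝ} {e : OrthonormalBasis (Fin 2) ℝ Plane} {a : Plane}
  {V : Plane → ℝ} {E : ℝ} {c : ℝ → Phase} {Φ : ℝ → Phase → Phase}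

theorem sum_smul_basis_injective {f g : Fin 2 → ℝ} (h : ∑ j, f j • e j = ∑ j, g j • e j) : f = g := by
  funext i
  rw [← inner_sum_smul (e := e) f i, h, inner_sum_smul]

theorem hasDerivAt_modelPoint_zero {p : ℝ → Fin 2 → ℝ} {p' τ : Fin 2 → ℝ}
    (hp : ∀ j, HasDerivAt (fun s => p s j) (p' j) 0) :
    HasDerivAt (fun s : ℝ => modelPoint lam e a (p s) (s • τ))
      (∑ j, p' j • e j, ∑ j, (2 * lam j ^ 2 * p 0 j * τ j) • e j) 0 := by
  have h : ∀ j, HasDerivAt (fun s : ℝ => 2 * lam j * (s • τ) j) (2 * lam j * τ j) 0 := by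
    intro j
    simpa using ((hasDerivAt_id (0 : ℝ)).mul_const (τ j)).const_mul (2 * lam j)
  refine HasDerivAt.prodMk (HasDerivAt.const_add a (HasDerivAt.fun_sum fun j _ => ?_))
    (HasDerivAt.fun_sum fun j _ => ?_)
  · refine (((hp j).mul (h j).cosh).smul_const (e j)).congr_deriv ?_
    simp
  · refine ((((hp j).const_mul (lam j)).mul (h j).sinh).smul_const (e j)).congr_deriv ?_
    simp
    congr 1
    ring

/-- The surfaces swept by the orbits of the harmonic oscillator issued from the points at rest with
coordinates `P y β`, the degrees of freedom being shifted in time by `β ν`. -/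
noncomputable def modelFamily (lam : Fin 2 → ℝ) (e : OrthonormalBasis (Fin 2) ℝ Plane) (a : Plane)
    (P : Plane → ℝ → Fin 2 → ℝ) (ν : Fin 2 → ℝ) (y : Plane) (q : ℝ × ℝ) : Phase :=
  modelPoint lam e a (P y q.2) (q.1 • 1 + q.2 • ν)

/-- A common time shift is the flow. The second tangent vector has position part `p'` and momentum
part given by `ν`: `s = 1` forces `ν = 0`, a displacement of the rest point, while `s = -1` forces
`p' = 0`, a vertical vector. The hypothesis `horth` is tangency to the energy surface, and `hne` is
independence from `H_q`, which is vertical at a point at rest. -/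
theorem isTransversalFamily_modelFamily (hV : ContDiff ℝ ∞ V) (hrest : (c 0).2 = 0)
    (hlam : ∀ j, lam j ≠ 0) (hoff : ∀ j, coord e a (c 0).1 j ≠ 0) {ε : ℝ} (hε : 0 < ε)
    (hmod : ∀ p ∈ ball (coord e a (c 0).1) ε, ∀ t ∈ ball (0 : Fin 2 → ℝ) ε,
      V =ᶠ[𝓝 (modelPoint lam e a p t).1] quad lam e a ∧
      ∀ h : ℝ, |h| < ε → Φ h (modelPoint lam e a p t) = modelPoint lam e a p (t + h • 1))
    {P : Plane → ℝ → Fin 2 → ℝ} {ν p' : Fin 2 → ℝ} {s : ℝ}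
    (hP : ContDiffAt ℝ ∞ (fun x : Plane × ℝ => P x.1 x.2) ((c 0).1, 0))
    (hP0 : P (c 0).1 0 = coord e a (c 0).1)
    (hPV : ∀ᶠ x : Plane × ℝ in 𝓝 ((c 0).1, 0), ∑ j, (lam j) ^ 2 * (P x.1 x.2 j) ^ 2 = V x.1)
    (hP' : ∀ j, HasDerivAt (fun β => P (c 0).1 β j) (p' j) 0)
    (hs : s * s = 1) (hsp : s • p' = p') (hsν : s • ν = -ν)
    (horth : ∑ j, (lam j) ^ 2 * coord e a (c 0).1 j * p' j = 0)
    (hne : ∀ l : ℝ, p' = 0 → ν ≠ l • 1) :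
    IsTransversalFamily V c Φ (modelFamily lam e a P ν) := by
  have hpr : Continuous fun x : Plane × (ℝ × ℝ) => (x.1, x.2.2) := by fun_prop
  have hpr' : Tendsto (fun x : Plane × (ℝ × ℝ) => (x.1, x.2.2)) (𝓝 ((c 0).1, 0))
      (𝓝 ((c 0).1, 0)) := hpr.tendsto _
  have htc : Continuous fun x : Plane × (ℝ × ℝ) => x.2.1 • (1 : Fin 2 → ℝ) + x.2.2 • ν := by
    fun_prop
  have htc' : Tendsto (fun x : Plane × (ℝ × ℝ) => x.2.1 • (1 : Fin 2 → ℝ) + x.2.2 • ν)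
      (𝓝 ((c 0).1, 0)) (𝓝 0) := by
    have := htc.tendsto ((c 0).1, 0)
    simpa using this
  have hPc : Tendsto (fun x : Plane × (ℝ × ℝ) => P x.1 x.2.2) (𝓝 ((c 0).1, 0))
      (𝓝 (coord e a (c 0).1)) := by
    have := hP.continuousAt.tendsto.comp hpr'
    rwa [hP0] at this
  have hnear : ∀ᶠ x : Plane × (ℝ × ℝ) in 𝓝 ((c 0).1, 0),
      P x.1 x.2.2 ∈ ball (coord e a (c 0).1) ε ∧
        x.2.1 • (1 : Fin 2 → ℝ) + x.2.2 • ν ∈ ball (0 : Fin 2 → ℝ) ε :=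
    (hPc.eventually (ball_mem_nhds _ hε)).and (htc'.eventually (ball_mem_nhds _ hε))
  have hp0 : modelPoint lam e a (coord e a (c 0).1) 0 = c 0 := by
    rw [modelPoint_coord_zero, ← hrest]
  have hH : hamField V (c 0) = (0, ∑ j, (2 * lam j ^ 2 * coord e a (c 0).1 j) • e j) := by
    have h1 := (hmod _ (mem_ball_self hε) 0 (mem_ball_self hε)).1
    have h2 := hamField_modelPoint h1
    rw [hp0] at h2
    simpa using h2
  refine ⟨?_, ?_, ?_, ?_⟩
  · obtain ⟨d, hd, h⟩ := eventually_nhds_iff_ball.1 hnear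
    refine ⟨min d ε, by positivity, fun y hy α β h1 hα hβ hh => ?_⟩
    obtain ⟨h2, h3⟩ := h (y, (α, β)) (by
      rw [← ball_prod_same, mem_prod, ← Prod.mk_zero_zero, ← ball_prod_same]
      refine ⟨ball_subset_ball (min_le_left _ _) hy, ?_, ?_⟩
      · exact mem_ball_zero_iff.2 (hα.trans_le (min_le_left _ _))
      · exact mem_ball_zero_iff.2 (hβ.trans_le (min_le_left _ _)))
    rw [modelFamily, modelFamily, (hmod _ h2 _ h3).2 h1 (hh.trans_le (min_le_right _ _))]
    congr 1
    module
  · rw [modelFamily]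
    simp [hP0, hp0]
  · have hF : ContDiffAt ℝ ∞ (fun x : Plane × (ℝ × ℝ) => modelFamily lam e a P ν x.1 x.2)
        ((c 0).1, 0) := by
      have h1 : ContDiffAt ℝ ∞ (fun x : Plane × (ℝ × ℝ) => P x.1 x.2.2) ((c 0).1, 0) :=
        ContDiffAt.comp (g := fun x : Plane × ℝ => P x.1 x.2)
          (f := fun x : Plane × (ℝ × ℝ) => (x.1, x.2.2)) _ hP (by fun_prop)
      exact (contDiff_modelPoint (lam := lam) (e := e) (a := a)).contDiffAt.comp
        (f := fun x : Plane × (ℝ × ℝ) => (P x.1 x.2.2, x.2.1 • (1 : Fin 2 → ℝ) + x.2.2 • ν)) _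
        (h1.prodMk (by fun_prop))
    have hstrict := hF.hasStrictFDerivAt (by simp)
    refine ⟨_, (∑ j, p' j • e j, ∑ j, (2 * lam j ^ 2 * coord e a (c 0).1 j * ν j) • e j), s, hstrict,
      fun α β => ?_, hs, ?_, ?_, fun l hl => ?_⟩
    · have hl : HasDerivAt (fun s : ℝ => ((c 0).1, s • (α, β))) ((0 : Plane), (α, β)) 0 := by
        refine (hasDerivAt_const _ _).prodMk ?_
        simpa using (hasDerivAt_id (0 : ℝ)).smul_const (α, β)
      have h1 := (hstrict.hasFDerivAt.comp_hasDerivAt_of_eq (0 : ℝ) hl (by simp))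
      have h2 : HasDerivAt (fun s : ℝ => modelPoint lam e a (P (c 0).1 (s * β))
          (s • (α • (1 : Fin 2 → ℝ) + β • ν)))
          (∑ j, (p' j * β) • e j, ∑ j, (2 * lam j ^ 2 * P (c 0).1 (0 * β) j *
            (α • (1 : Fin 2 → ℝ) + β • ν) j) • e j) 0 :=
        hasDerivAt_modelPoint_zero (p := fun s => P (c 0).1 (s * β)) fun j => by
          have h3 : HasDerivAt (fun s : ℝ => s * β) β 0 := by
            simpa using (hasDerivAt_id (0 : ℝ)).mul_const β
          exact (hP' j).comp_of_eq (0 : ℝ) h3 (by simp)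
      have h3 : ((fun x : Plane × (ℝ × ℝ) => modelFamily lam e a P ν x.1 x.2) ∘
          fun s : ℝ => ((c 0).1, s • (α, β))) = fun s : ℝ => modelPoint lam e a (P (c 0).1 (s * β))
          (s • (α • (1 : Fin 2 → ℝ) + β • ν)) := by
        funext s
        simp only [Function.comp, modelFamily, Prod.smul_mk, smul_eq_mul, smul_add, smul_smul]
      rw [h3] at h1
      rw [h1.unique h2, hH, zero_mul, hP0]
      refine Prod.ext ?_ ?_
      · simp [smul_smul, mul_comm]
      · simp only [Prod.snd_add, Prod.smul_snd, Finset.smul_sum, smul_smul, ← Finset.sum_add_distrib,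
          ← add_smul]
        refine Finset.sum_congr rfl fun j _ => ?_
        congr 1
        simp
        ring
    · rw [timeRev_apply]
      refine Prod.ext ?_ ?_
      · simp only [Prod.smul_fst, Finset.smul_sum, smul_smul]
        refine Finset.sum_congr rfl fun j _ => ?_
        conv_lhs => rw [← hsp]
        rfl
      · simp only [Prod.smul_snd, Finset.smul_sum, smul_smul, ← Finset.sum_neg_distrib, ← neg_smul]
        refine Finset.sum_congr rfl fun j _ => ?_
        have h1 : s * ν j = -ν j := congrFun hsν j
        congr 1
        linear_combination -(2 * lam j ^ 2 * coord e a (c 0).1 j) * h1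
    · have hg : gradient V (c 0).1 = ∑ j, (2 * lam j ^ 2 * coord e a (c 0).1 j) • e j :=
        congrArg Prod.snd hH
      rw [fderiv_symbolQ_apply hV, hrest, hg]
      rw [inner_zero_left, mul_zero, zero_sub, neg_eq_zero, inner_sum]
      calc _ = 2 * ∑ j, (lam j) ^ 2 * coord e a (c 0).1 j * p' j := by
            rw [Finset.mul_sum]
            refine Finset.sum_congr rfl fun j _ => ?_
            rw [inner_smul_right, real_inner_comm, inner_sum_smul]
            ring
        _ = 0 := by rw [horth, mul_zero]
    · rw [hH] at hl
      have h1 : ∑ j, p' j • e j = 0 := by simpa using congrArg Prod.fst hl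
      have h2 : p' = 0 := sum_smul_basis_injective (e := e) (by simpa using h1)
      refine hne l h2 ?_
      have h3 : ∑ j, (2 * lam j ^ 2 * coord e a (c 0).1 j * ν j) • e j =
          ∑ j, (2 * lam j ^ 2 * coord e a (c 0).1 j * l) • e j := by
        have := congrArg Prod.snd hl
        simp only [Prod.smul_snd, Finset.smul_sum, smul_smul] at this
        rw [this]
        simp only [mul_comm]
      funext j
      have h4 := congrFun (sum_smul_basis_injective h3) j
      have h5 : 2 * lam j ^ 2 * coord e a (c 0).1 j ≠ 0 :=
        mul_ne_zero (mul_ne_zero two_ne_zero (pow_ne_zero _ (hlam j))) (hoff j)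
      simpa using mul_left_cancel₀ h5 h4
  · filter_upwards [hnear, hpr'.eventually hPV] with x hx hx'
    rw [modelFamily, symbolQ_modelPoint (hmod _ hx.1 _ hx.2).1.eq_of_nhds, hx']

end Families

/-! ### The tori and the boundary flow-outs as transversal families -/

section TorusAndBoundary

open Set Filter Topology Metric

variable {lam : Fin 2 → ℝ} {e : OrthonormalBasis (Fin 2) ℝ Plane} {a : Plane}
  {V : Plane → ℝ} {E : ℝ} {c : ℝ → Phase} {Φ : ℝ → Phase → Phase}

/-- The complexified tori, parametrised by their umbilics. -/
noncomputable def torusFamily (lam : Fin 2 → ℝ) (e : OrthonormalBasis (Fin 2) ℝ Plane)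
    (a : Plane) : Plane → ℝ × ℝ → Phase :=
  modelFamily lam e a (fun y _ => coord e a y) ![1, -1]

theorem mem_extTorus_iff (y : Plane) (ρ : Phase) :
    ρ ∈ extTorus lam e a (actions lam e a y) ↔ ∀ j, (inner ℝ (e j) ρ.2) ^ 2 =
      (lam j) ^ 2 * ((coord e a ρ.1 j) ^ 2 - (coord e a y j) ^ 2) := by
  refine forall_congr' fun j => ?_
  have h : 2 * lam j * actions lam e a y j = (lam j) ^ 2 * (coord e a y j) ^ 2 := by
    rw [actions, coord]
    ring
  rw [h]
  change _ - (lam j) ^ 2 * (coord e a ρ.1 j) ^ 2 = _ ↔ _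
  constructor <;> intro h <;> linear_combination h

theorem modelPoint_mem_extTorus (y : Plane) (t : Fin 2 → ℝ) :
    modelPoint lam e a (coord e a y) t ∈ extTorus lam e a (actions lam e a y) := by
  rw [mem_extTorus_iff]
  intro j
  rw [inner_modelPoint_snd, coord_modelPoint]
  linear_combination -(lam j) ^ 2 * (coord e a y j) ^ 2 * Real.cosh_sq (2 * lam j * t j)

/-- The points of the torus near the umbilic are given by times. -/
theorem exists_eq_modelPoint (hlam : ∀ j, lam j ≠ 0) {y : Plane} {ρ : Phase}
    (hρ : ρ ∈ extTorus lam e a (actions lam e a y)) (hy : ∀ j, 0 < coord e a ρ.1 j * coord e a y j) :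
    ρ = modelPoint lam e a (coord e a y) fun j =>
      Real.arsinh (inner ℝ (e j) ρ.2 / (lam j * coord e a y j)) / (2 * lam j) := by
  rw [mem_extTorus_iff] at hρ
  have hy0 : ∀ j, coord e a y j ≠ 0 := fun j => right_ne_zero_of_mul (hy j).ne'
  have hval : ∀ j, 2 * lam j * (Real.arsinh (inner ℝ (e j) ρ.2 / (lam j * coord e a y j)) /
      (2 * lam j)) = Real.arsinh (inner ℝ (e j) ρ.2 / (lam j * coord e a y j)) := fun j =>
    mul_div_cancel₀ _ (mul_ne_zero two_ne_zero (hlam j))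
  refine phase_eq_of_coord_eq (e := e) (a := a) (fun j => ?_) fun j => ?_
  · rw [coord_modelPoint, hval]
    have hc := Real.cosh_pos (Real.arsinh (inner ℝ (e j) ρ.2 / (lam j * coord e a y j)))
    have h2 := Real.cosh_sq (Real.arsinh (inner ℝ (e j) ρ.2 / (lam j * coord e a y j)))
    rw [Real.sinh_arsinh, div_pow, hρ j] at h2
    set k := Real.cosh (Real.arsinh (inner ℝ (e j) ρ.2 / (lam j * coord e a y j)))
    have hl := hlam j
    have hy1 := hy0 j
    have h3 : (coord e a ρ.1 j) ^ 2 = (coord e a y j * k) ^ 2 := by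
      rw [mul_pow, h2]
      field_simp
      ring
    -- The equations of the torus determine the coordinate up to sign; having the sign of the
    -- coordinate of `y` selects the branch.
    rcases sq_eq_sq_iff_eq_or_eq_neg.1 h3 with h | h
    · exact h
    · have h4 := hy j
      rw [h] at h4
      have h5 : 0 ≤ coord e a y j ^ 2 * k := by positivity
      nlinarith
  · rw [inner_modelPoint_snd, hval, Real.sinh_arsinh]
    exact (mul_div_cancel₀ _ (mul_ne_zero (hlam j) (hy0 j))).symm

theorem torusFamily_eq (y : Plane) (t : Fin 2 → ℝ) :
    torusFamily lam e a y ((t 0 + t 1) / 2, (t 0 - t 1) / 2) =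
      modelPoint lam e a (coord e a y) t := by
  rw [torusFamily, modelFamily]
  congr 1
  funext j
  fin_cases j <;> simp <;> ring

/-- The times of a point of the torus are continuous jointly in the umbilic and the point, and
vanish at the end of the cycle. This gives one radius for all nearby umbilics; non-zero coordinates
keep the denominators and signs under control. -/
theorem eventually_extTorus (hlam : ∀ j, lam j ≠ 0) (hoff : ∀ j, coord e a (c 0).1 j ≠ 0)
    (hrest : (c 0).2 = 0) {ε : ℝ} (hε : 0 < ε) :
    ∀ᶠ x : Plane × Phase in 𝓝 ((c 0).1, c 0), x.2 ∈ extTorus lam e a (actions lam e a x.1) →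
      ∃ q ∈ ball (0 : ℝ × ℝ) ε, x.2 = torusFamily lam e a x.1 q := by
  have hco : ∀ j, Continuous fun x : Plane => coord e a x j := fun j =>
    (continuous_apply j).comp continuous_coord
  have h1 : ∀ j, ∀ᶠ x : Plane × Phase in 𝓝 ((c 0).1, c 0),
      0 < coord e a x.2.1 j * coord e a x.1 j := fun j => by
    have : Continuous fun x : Plane × Phase => coord e a x.2.1 j * coord e a x.1 j :=
      ((hco j).comp (by fun_prop)).mul ((hco j).comp continuous_fst)
    exact this.tendsto _ |>.eventually_const_lt (mul_self_pos.2 (hoff j))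
  have h2 : ∀ j, Tendsto (fun x : Plane × Phase =>
      Real.arsinh (inner ℝ (e j) x.2.2 / (lam j * coord e a x.1 j)) / (2 * lam j))
      (𝓝 ((c 0).1, c 0)) (𝓝 0) := fun j => by
    have hc : ContinuousAt (fun x : Plane × Phase =>
        Real.arsinh (inner ℝ (e j) x.2.2 / (lam j * coord e a x.1 j)) / (2 * lam j))
        ((c 0).1, c 0) := by
      refine (Real.continuous_arsinh.continuousAt.comp (ContinuousAt.div ?_ ?_ ?_)).div_const _
      · fun_prop
      · exact (continuous_const.mul ((hco j).comp continuous_fst)).continuousAt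
      · exact mul_ne_zero (hlam j) (hoff j)
    have := hc.tendsto
    simpa [hrest] using this
  have h3 : ∀ᶠ x : Plane × Phase in 𝓝 ((c 0).1, c 0), ∀ j,
      |Real.arsinh (inner ℝ (e j) x.2.2 / (lam j * coord e a x.1 j)) / (2 * lam j)| < ε := by
    refine eventually_all.2 fun j => ?_
    have := (h2 j).abs
    rw [abs_zero] at this
    exact this.eventually_lt_const hε
  filter_upwards [eventually_all.2 h1, h3] with x hx hx3 hx'
  refine ⟨_, ?_, (exists_eq_modelPoint hlam hx' hx).trans (torusFamily_eq _ _).symm⟩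
  have h4 := abs_lt.1 (hx3 0)
  have h5 := abs_lt.1 (hx3 1)
  rw [mem_ball_zero_iff, Prod.norm_def, max_lt_iff, Real.norm_eq_abs, Real.norm_eq_abs, abs_lt,
    abs_lt]
  exact ⟨⟨by linarith, by linarith⟩, by linarith, by linarith⟩

/-- Shifting the two oscillators by opposite times gives a vertical tangent vector at the rest
point, and (1, −1) is not proportional to (1, 1). -/
theorem isTransversalFamily_torusFamily (hV : ContDiff ℝ ∞ V) (hrest : (c 0).2 = 0)
    (hlam : ∀ j, lam j ≠ 0) (hoff : ∀ j, coord e a (c 0).1 j ≠ 0) {ε : ℝ} (hε : 0 < ε)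
    (hmod : ∀ p ∈ ball (coord e a (c 0).1) ε, ∀ t ∈ ball (0 : Fin 2 → ℝ) ε,
      V =ᶠ[𝓝 (modelPoint lam e a p t).1] quad lam e a ∧
      ∀ h : ℝ, |h| < ε → Φ h (modelPoint lam e a p t) = modelPoint lam e a p (t + h • 1))
    (hVq : V =ᶠ[𝓝 (c 0).1] quad lam e a) :
    IsTransversalFamily V c Φ (torusFamily lam e a) := by
  have hco : ContDiff ℝ ∞ (coord e a) := by
    unfold coord
    exact contDiff_pi.2 fun j => contDiff_const.inner ℝ (contDiff_id.sub contDiff_const)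
  refine isTransversalFamily_modelFamily hV hrest hlam hoff hε hmod (p' := 0) (s := -1)
    (hco.comp contDiff_fst).contDiffAt rfl ?_ (fun j => hasDerivAt_const _ _) (by norm_num)
    (by simp) (by simp) (by simp) fun l _ h => ?_
  · filter_upwards [(continuous_fst.tendsto ((c 0).1, (0 : ℝ))).eventually hVq] with x hx
    rw [hx]
    rfl
  · have h0 := congrFun h 0
    have h1 := congrFun h 1
    simp at h0 h1
    linarith

/-- Points on the boundary of the well at energy `V y`. -/
noncomputable def boundaryCoord (V : Plane → ℝ) (lam p₀ : Fin 2 → ℝ) (E : ℝ) (y : Plane) (β : ℝ) :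
    Fin 2 → ℝ :=
  ![(Real.sqrt (V y / E - β ^ 2) * (lam 0 * p₀ 0) - β * (lam 1 * p₀ 1)) / lam 0,
    (Real.sqrt (V y / E - β ^ 2) * (lam 1 * p₀ 1) + β * (lam 0 * p₀ 0)) / lam 1]

/-- The flow-outs of the boundaries of the wells, parametrised by points `y` on these boundaries. -/
noncomputable def boundaryFamily (V : Plane → ℝ) (lam : Fin 2 → ℝ)
    (e : OrthonormalBasis (Fin 2) ℝ Plane) (a : Plane) (p₀ : Fin 2 → ℝ) (E : ℝ) :
    Plane → ℝ × ℝ → Phase :=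
  modelFamily lam e a (boundaryCoord V lam p₀ E) 0

/-- In the coordinates λ_j z_j, `boundaryCoord` is √(V y / E − β²) times the base vector plus β
times its rotation by a right angle, so Pythagoras applies. -/
theorem sum_boundaryCoord (hlam : ∀ j, lam j ≠ 0) {p₀ : Fin 2 → ℝ} (hE : 0 < E)
    (hp₀ : ∑ j, (lam j) ^ 2 * (p₀ j) ^ 2 = E) {y : Plane} {β : ℝ} (h : 0 ≤ V y / E - β ^ 2) :
    ∑ j, (lam j) ^ 2 * (boundaryCoord V lam p₀ E y β j) ^ 2 = V y := by
  have hl0 := hlam 0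
  have hl1 := hlam 1
  have hs := Real.sq_sqrt h
  rw [Fin.sum_univ_two] at hp₀ ⊢
  simp only [boundaryCoord, Matrix.cons_val_zero, Matrix.cons_val_one]
  set s := Real.sqrt (V y / E - β ^ 2)
  have h1 : V y = (s ^ 2 + β ^ 2) * E := by
    rw [hs]
    field_simp
    ring
  rw [h1, ← hp₀]
  field_simp
  ring

theorem eventually_sqrt_pos (hVc : Continuous V) (hE : 0 < E) {y₀ : Plane} (h0 : V y₀ = E) :
    ∀ᶠ x : Plane × ℝ in 𝓝 (y₀, 0), 0 < V x.1 / E - x.2 ^ 2 := by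
  have : Continuous fun x : Plane × ℝ => V x.1 / E - x.2 ^ 2 := by fun_prop
  refine this.tendsto _ |>.eventually_const_lt ?_
  simp [h0, hE.ne']

/-- Here the second tangent vector is a non-zero horizontal vector along the boundary of the well,
fixed by time reversal and independent of the vertical `H_q`. -/
theorem isTransversalFamily_boundaryFamily (hV : ContDiff ℝ ∞ V) (hrest : (c 0).2 = 0)
    (hlam : ∀ j, lam j ≠ 0) (hoff : ∀ j, coord e a (c 0).1 j ≠ 0) {ε : ℝ} (hε : 0 < ε)
    (hmod : ∀ p ∈ ball (coord e a (c 0).1) ε, ∀ t ∈ ball (0 : Fin 2 → ℝ) ε,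
      V =ᶠ[𝓝 (modelPoint lam e a p t).1] quad lam e a ∧
      ∀ h : ℝ, |h| < ε → Φ h (modelPoint lam e a p t) = modelPoint lam e a p (t + h • 1))
    (hE : 0 < E) (hV0 : V (c 0).1 = E) (hq0 : quad lam e a (c 0).1 = E) :
    IsTransversalFamily V c Φ (boundaryFamily V lam e a (coord e a (c 0).1) E) := by
  set p₀ := coord e a (c 0).1 with hp₀
  have hl0 := hlam 0
  have hl1 := hlam 1
  have hb0 : V (c 0).1 / E - 0 ^ 2 ≠ 0 := by simp [hV0, hE.ne']
  have hsq : ContDiffAt ℝ ∞ (fun x : Plane × ℝ => Real.sqrt (V x.1 / E - x.2 ^ 2)) ((c 0).1, 0) := by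
    refine ContDiffAt.sqrt ?_ hb0
    fun_prop
  have hsd : HasDerivAt (fun β : ℝ => Real.sqrt (V (c 0).1 / E - β ^ 2)) 0 0 := by
    have h1 : HasDerivAt (fun β : ℝ => V (c 0).1 / E - β ^ 2) 0 0 := by
      simpa using ((hasDerivAt_id (0 : ℝ)).pow 2).const_sub (V (c 0).1 / E)
    simpa using h1.sqrt hb0
  refine isTransversalFamily_modelFamily hV hrest hlam hoff hε hmod (s := 1)
    (p' := ![-(lam 1 * p₀ 1) / lam 0, (lam 0 * p₀ 0) / lam 1])
    ?_ ?_ ?_ ?_ (by norm_num) (by simp) (by simp) ?_ fun l h _ => ?_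
  · refine contDiffAt_pi.2 fun j => ?_
    fin_cases j
    · exact ((hsq.mul contDiffAt_const).sub (contDiffAt_snd.mul contDiffAt_const)).div_const _
    · exact ((hsq.mul contDiffAt_const).add (contDiffAt_snd.mul contDiffAt_const)).div_const _
  · have h1 : Real.sqrt (V (c 0).1 / E - 0 ^ 2) = 1 := by simp [hV0, hE.ne']
    funext j
    fin_cases j
    · simp only [boundaryCoord, h1]
      simp [hl0, hp₀]
    · simp only [boundaryCoord, h1]
      simp [hl1, hp₀]
  · filter_upwards [eventually_sqrt_pos hV.continuous hE hV0] with x hx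
    exact sum_boundaryCoord hlam hE hq0 hx.le
  · intro j
    fin_cases j
    · refine (((hsd.mul_const (lam 0 * p₀ 0)).sub
        ((hasDerivAt_id (0 : ℝ)).mul_const (lam 1 * p₀ 1))).div_const (lam 0)).congr_deriv ?_
      simp
    · refine (((hsd.mul_const (lam 1 * p₀ 1)).add
        ((hasDerivAt_id (0 : ℝ)).mul_const (lam 0 * p₀ 0))).div_const (lam 1)).congr_deriv ?_
      simp
  · rw [Fin.sum_univ_two]
    simp only [Matrix.cons_val_zero, Matrix.cons_val_one]
    field_simp
    ring
  · have h1 := congrFun h 1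
    simp only [Matrix.cons_val_one, Pi.zero_apply] at h1
    exact div_ne_zero (mul_ne_zero hl0 (hoff 0)) hl1 h1

theorem boundaryFamily_zero (hlam : ∀ j, lam j ≠ 0) {p₀ : Fin 2 → ℝ} (hE : 0 < E)
    (hp₀ : ∑ j, (lam j) ^ 2 * (p₀ j) ^ 2 = E) {y : Plane} {β : ℝ} (h : 0 ≤ V y / E - β ^ 2) :
    quad lam e a (boundaryFamily V lam e a p₀ E y (0, β)).1 = V y ∧
      (boundaryFamily V lam e a p₀ E y (0, β)).2 = 0 := by
  constructor
  · rw [quad_eq_sum, ← sum_boundaryCoord hlam hE hp₀ h]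
    refine Finset.sum_congr rfl fun j _ => ?_
    rw [boundaryFamily, modelFamily, coord_modelPoint]
    simp
  · simp [boundaryFamily, modelFamily, modelPoint]

/-- The parameter `β` is read off from the component along the rotated base vector; the other
component is positive near the base point, which selects the positive square root. The bound on `β`
is uniform in `y`. -/
theorem eventually_boundary (hlam : ∀ j, lam j ≠ 0) (hE : 0 < E)
    (hq0 : quad lam e a (c 0).1 = E) {ε : ℝ} (hε : 0 < ε) :
    ∀ᶠ ρ : Phase in 𝓝 (c 0), ∀ y, quad lam e a ρ.1 = V y → ρ.2 = 0 →
      ∃ β, |β| < ε ∧ ρ = boundaryFamily V lam e a (coord e a (c 0).1) E y (0, β) := by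
  set p₀ := coord e a (c 0).1 with hp₀
  have hl0 := hlam 0
  have hl1 := hlam 1
  have hq0' : (lam 0) ^ 2 * (p₀ 0) ^ 2 + (lam 1) ^ 2 * (p₀ 1) ^ 2 = E := by
    rw [← hq0, quad_eq_sum, Fin.sum_univ_two]
  have hco : ∀ j, Continuous fun ρ : Phase => coord e a ρ.1 j := fun j =>
    (continuous_apply j).comp (continuous_coord.comp continuous_fst)
  have hco0 := hco 0
  have hco1 := hco 1
  have h1 : ∀ᶠ ρ : Phase in 𝓝 (c 0), 0 < (lam 0) ^ 2 * coord e a ρ.1 0 * p₀ 0 +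
      (lam 1) ^ 2 * coord e a ρ.1 1 * p₀ 1 := by
    have : Continuous fun ρ : Phase => (lam 0) ^ 2 * coord e a ρ.1 0 * p₀ 0 +
      (lam 1) ^ 2 * coord e a ρ.1 1 * p₀ 1 := by fun_prop
    refine this.tendsto _ |>.eventually_const_lt ?_
    rw [← hp₀]
    linarith
  have h2 : ∀ᶠ ρ : Phase in 𝓝 (c 0), |(lam 0 * p₀ 0 * (lam 1 * coord e a ρ.1 1) -
      lam 1 * p₀ 1 * (lam 0 * coord e a ρ.1 0)) / E| < ε := by
    have : Continuous fun ρ : Phase => |(lam 0 * p₀ 0 * (lam 1 * coord e a ρ.1 1) -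
      lam 1 * p₀ 1 * (lam 0 * coord e a ρ.1 0)) / E| := by fun_prop
    refine this.tendsto _ |>.eventually_lt_const ?_
    rw [← hp₀, show lam 0 * p₀ 0 * (lam 1 * p₀ 1) - lam 1 * p₀ 1 * (lam 0 * p₀ 0) = 0 by ring]
    simpa using hε
  filter_upwards [h1, h2] with ρ hρ1 hρ2 y hy hρ0
  refine ⟨_, hρ2, ?_⟩
  rw [quad_eq_sum, Fin.sum_univ_two] at hy
  have hsq : Real.sqrt (V y / E - ((lam 0 * p₀ 0 * (lam 1 * coord e a ρ.1 1) -
      lam 1 * p₀ 1 * (lam 0 * coord e a ρ.1 0)) / E) ^ 2) =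
      ((lam 0) ^ 2 * coord e a ρ.1 0 * p₀ 0 + (lam 1) ^ 2 * coord e a ρ.1 1 * p₀ 1) / E := by
    rw [Real.sqrt_eq_iff_mul_self_eq_of_pos (by positivity), ← hy]
    field_simp
    rw [← hq0']
    ring
  refine phase_eq_of_coord_eq (e := e) (a := a) (fun j => ?_) fun j => ?_
  · rw [boundaryFamily, modelFamily, coord_modelPoint]
    simp only [boundaryCoord, hsq]
    fin_cases j
    · simp
      field_simp
      rw [← hq0']
      ring
    · simp
      field_simp
      rw [← hq0']
      ring
  · rw [boundaryFamily, modelFamily, inner_modelPoint_snd, hρ0]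
    simp

end TorusAndBoundary

/-! ### The orthogonal orbit of the boundary family is a libration -/

section Librations

open Set Filter Topology Metric

variable {lam : Fin 2 → ℝ} {e : OrthonormalBasis (Fin 2) ℝ Plane} {a : Plane}
  {V : Plane → ℝ} {E T r η δ : ℝ} {c : ℝ → Phase} {Φ : ℝ → Phase → Phase} {Ω : Set Phase}

theorem axisRev_image_germ (Λ : Set Phase) (ρ : Phase) (r : ℝ) :
    axisRev '' germ Λ ρ r = germ (axisRev '' Λ) (axisRev ρ) r := by
  ext p
  constructor
  · rintro ⟨q, ⟨hq, hqr⟩, rfl⟩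
    exact ⟨⟨q, hq, rfl⟩, by rwa [mem_ball, dist_axisRev]⟩
  · rintro ⟨⟨q, hq, rfl⟩, hqr⟩
    exact ⟨q, ⟨hq, by rwa [mem_ball, dist_axisRev] at hqr⟩, rfl⟩

theorem boundaryLift_refl (hs : ∀ x, V (refl x) = V x) (E : ℝ) (a : Plane) :
    boundaryLift V E (refl a) = axisRev '' boundaryLift V E a := by
  ext p
  constructor
  · rintro ⟨h1, h2⟩
    rw [frontier_well_refl hs] at h1
    obtain ⟨x, hx, hxp⟩ := h1
    refine ⟨(x, 0), ⟨hx, rfl⟩, Prod.ext hxp ?_⟩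
    rw [h2]
    simp [refl]
  · rintro ⟨q, ⟨h1, h2⟩, rfl⟩
    refine ⟨?_, ?_⟩
    · rw [frontier_well_refl hs]
      exact ⟨_, h1, rfl⟩
    · rw [axisRev_apply, h2]
      simp [refl]

/-- The equations are even in the momenta, so the sign in `axisRev` does no harm: the right torus is
the image of the left one under the reversing map. -/
theorem extTorus_refl (ι : Fin 2 → ℝ) :
    extTorus lam (fun j => refl (e j)) (refl a) ι = axisRev '' extTorus lam e a ι := by
  have key : ∀ ρ, axisRev ρ ∈ extTorus lam (fun j => refl (e j)) (refl a) ι ↔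
      ρ ∈ extTorus lam e a ι := fun ρ => by
    refine forall_congr' fun j => ?_
    rw [axisRev_apply, inner_neg_right, ← refl_sub, inner_refl_refl, inner_refl_refl, neg_sq]
  ext p
  constructor
  · intro hp
    exact ⟨axisRev p, (key _).1 (by rwa [axisRev_axisRev]), axisRev_axisRev p⟩
  · rintro ⟨q, hq, rfl⟩
    exact (key q).2 hq

theorem boundaryR_eq (hs : ∀ x, V (refl x) = V x) (hcT : c T = axisRev (c 0)) (E : ℝ) :
    boundaryR V a c T r δ E =
      flowOut V (axisRev '' germ (boundaryLift V E a) (c 0) r) (Ioo (-(T + δ)) δ) := by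
  rw [boundaryR, boundaryLift_refl hs, hcT, axisRev_image_germ]

theorem torusR_eq (hcT : c T = axisRev (c 0)) (y : Plane) :
    torusR a lam e c T r y = axisRev '' torusL a lam e c r y := by
  rw [torusR, torusL, extTorus_refl, hcT, axisRev_image_germ]

theorem IsLocalFlow.timeRev_of_rest (hΦ : IsLocalFlow V c Φ Ω) {w : Phase} (hw : w.2 = 0) (t : ℝ) :
    Φ (-t) w = timeRev (Φ t w) := by
  have h1 : timeRev w = w := by
    rw [timeRev_apply, hw, neg_zero]
    exact Prod.ext rfl hw.symm
  have h2 := hΦ.timeRev_eq (-t) w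
  rwa [h1, neg_neg] at h2

/-- An orbit comes to rest only once, within a short time. -/
theorem IsLocalFlow.eq_of_rest (hΦ : IsLocalFlow V c Φ Ω) {ρ : Phase} {α d : ℝ}
    (hη : η ≤ T / 16) (hα : |α| < η) (hd : |d| < η) (hw : (Φ (-α) ρ).2 = 0)
    (hmom : ∀ t ∈ Ioc 0 (3 * T / 4), (Φ t (Φ (-α) ρ)).2 ≠ 0) (h : (Φ (-d) ρ).2 = 0) : d = α := by
  obtain ⟨hα1, hα2⟩ := abs_lt.1 hα
  obtain ⟨hd1, hd2⟩ := abs_lt.1 hd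
  have h1 : Φ (α - d) (Φ (-α) ρ) = Φ (-d) ρ := by
    rw [← hΦ.add]
    congr 1
    ring
  rcases lt_trichotomy d α with hlt | heq | hgt
  · exact absurd (by rw [h1, h]) (hmom (α - d) ⟨by linarith, by linarith⟩)
  · exact heq
  -- An earlier time of rest is turned into a later one by the time symmetry about the point at
  -- rest.
  · refine absurd ?_ (hmom (d - α) ⟨by linarith, by linarith⟩)
    have h2 := hΦ.timeRev_of_rest hw (d - α)
    rw [neg_sub, h1] at h2
    have h3 := congrArg Prod.snd h2
    rw [h, timeRev_apply] at h3
    exact neg_eq_zero.1 h3.symm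

/-- The flow-out of the germ of the left boundary and that of its mirror image intersect along the
lift of a libration. -/
theorem isLibrationLift_inter (hV : ContDiff ℝ ∞ V) (hs : ∀ x, V (refl x) = V x)
    (hΦ : IsLocalFlow V c Φ Ω) (hcT : c T = axisRev (c 0)) {ρ : Phase}
    (hA : IsArcGerm T Φ Ω η δ (germ (boundaryLift V E a) (c 0) r) ρ)
    (hρ : IsAxisOrbit V T Φ Ω E ρ) {α : ℝ} (hα : |α| < η) (hαδ : 2 * α < δ)
    (hw : Φ (-α) ρ ∈ germ (boundaryLift V E a) (c 0) r)
    (hmom : ∀ t ∈ Ioc 0 (3 * T / 4), (Φ t (Φ (-α) ρ)).2 ≠ 0)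
    (hfr : ∀ x ∈ frontier (well V E a), V x = E ∧ x 0 < 0) :
    IsLibrationLift V a c T r δ E (Φ (-α) ρ).1
      (boundaryL V a c T r δ E ∩ boundaryR V a c T r δ E) := by
  have hδ := hA.delta_pos
  have hδT := hA.delta_le
  have hηT := hA.eta_le
  obtain ⟨hα1, hα2⟩ := abs_lt.1 hα
  set w := Φ (-α) ρ with hwdef
  -- The orbit is at rest at time `-α` and crosses the axis at `T / 2`; the symmetry doubles the
  -- duration `T / 2 + α`.
  set T' := T + 2 * α with hT'
  have hw2 : w.2 = 0 := hw.1.2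
  have hwV := hfr _ hw.1.1
  have hwρ : ∀ t, Φ (t + α) w = Φ t ρ := fun t => by
    rw [hwdef, ← hΦ.add]
    congr 1
    ring
  have htime : ∀ t, Φ (-t) w = timeRev (Φ t w) := hΦ.timeRev_of_rest hw2
  have haxis : ∀ t, Φ (T' - t) w = axisRev (Φ t w) := fun t => by
    have h1 := hρ.axisRev_eq hΦ (t - T' / 2)
    rw [← hwρ, ← hwρ] at h1
    rw [show T' - t = T / 2 - (t - T' / 2) + α by rw [hT']; ring, ← h1]
    congr 2
    rw [hT']
    ring
  have hneg : ∀ t, Φ (2 * T' - t) w = timeRev (Φ t w) := fun t => by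
    rw [show 2 * T' - t = T' - (t - T') by ring, haxis, show t - T' = -(T' - t) by ring, htime,
      haxis, axisRev_timeRev, axisRev_axisRev]
  have hper : Function.Periodic (fun t => Φ t w) (2 * T') := fun t => by
    change Φ (t + 2 * T') w = Φ t w
    rw [show t + 2 * T' = 2 * T' - -t by ring, hneg, htime, timeRev_timeRev]
  have hwA := hA.mem w hw
  -- Periodicity extends membership in `Ω` to all times, so the orbit of the modified flow is a true
  -- bicharacteristic.
  have hΩ : ∀ t, Φ t w ∈ Ω := fun t => by
    obtain ⟨s, hs, hst⟩ := hper.exists_mem_Ico₀ (by linarith) t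
    change Φ t w = Φ s w at hst
    rw [hst]
    exact hwA s ⟨by linarith [hs.1], by linarith [hs.2]⟩
  have hbichar : IsBicharOn V (fun t => Φ t w) univ := fun t _ => hΦ.bichar w t (hΩ t)
  have hen : ∀ t, V (Φ t w).1 = ‖(Φ t w).2‖ ^ 2 + E := fun t => by
    have h1 := hΦ.energy t w
    rw [symbolQ, symbolQ, hw2, hwV.1, norm_zero] at h1
    linarith
  have hforb : ∀ t ∈ Ioo 0 T', E < V (Φ t w).1 := by
    have h1 : ∀ t ∈ Ioc 0 (T' / 2), E < V (Φ t w).1 := fun t ht => by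
      have h2 := hmom t ⟨ht.1, by linarith [ht.2]⟩
      rw [hen t]
      have : 0 < ‖(Φ t w).2‖ := norm_pos_iff.2 h2
      have : 0 < ‖(Φ t w).2‖ ^ 2 := by positivity
      linarith
    intro t ht
    rcases le_total t (T' / 2) with h | h
    · exact h1 t ⟨ht.1, h⟩
    · have h2 := h1 (T' - t) ⟨by linarith [ht.2], by linarith⟩
      rw [haxis, axisRev_apply, hs] at h2
      exact h2
  have hT'w : Φ T' w = axisRev w := by
    have := haxis 0
    rwa [sub_zero, hΦ.zero] at this
  have hT'pos : 0 < T' := by linarith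
  have hlib : IsLibration V a (refl a) E (fun t => Φ t w) T' := by
    refine ⟨hT'pos, hbichar, hper, ?_, ?_, hforb⟩
    · simpa only [hΦ.zero] using hw.1
    · rw [hT'w, boundaryLift_refl hs]
      exact ⟨_, hw.1, rfl⟩
  have huniq : ∀ d, |d| < η → (Φ (-d) ρ).2 = 0 → d = α := fun d hd =>
    hΦ.eq_of_rest hηT hα hd hw2 hmom
  have hΓ : boundaryL V a c T r δ E ∩ boundaryR V a c T r δ E =
      (fun t => Φ t w) '' {t | t ∈ Ioo (-δ) (T + δ) ∧ T' - t ∈ Ioo (-δ) (T + δ)} := by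
    rw [boundaryR_eq hs hcT, boundaryL, hA.inter_eq hV hΦ hρ]
    -- Only the shift `d = α` brings the orbit to rest, so here the set of times is a single
    -- interval.
    have hmem : ∀ u, u ∈ flowTimes T Φ η δ (germ (boundaryLift V E a) (c 0) r) ρ ↔
        T / 2 + u + α ∈ Ioo (-δ) (T + δ) := fun u => by
      constructor
      · rintro ⟨d, hd, hdA, hu⟩
        rwa [huniq d hd hdA.1.2] at hu
      · exact fun hu => ⟨α, hα, hw, hu⟩
    ext p
    constructor
    · rintro ⟨u, ⟨hu, hu'⟩, rfl⟩
      rw [hmem] at hu hu'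
      refine ⟨T / 2 + u + α, ⟨hu, ?_⟩, hwρ _⟩
      rwa [show T' - (T / 2 + u + α) = T / 2 + -u + α by rw [hT']; ring]
    · rintro ⟨t, ⟨ht, ht'⟩, rfl⟩
      refine ⟨t - α - T / 2, ⟨(hmem _).2 ?_, (hmem _).2 ?_⟩, ?_⟩
      · rwa [show T / 2 + (t - α - T / 2) + α = t by ring]
      · rwa [show T / 2 + -(t - α - T / 2) + α = T' - t by rw [hT']; ring]
      · change Φ (T / 2 + (t - α - T / 2)) ρ = Φ t w
        rw [← hwρ]
        congr 1
        ring
  have hT'δ : T' < T + δ := by linarith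
  have hsub : Icc 0 T' ⊆ {t | t ∈ Ioo (-δ) (T + δ) ∧ T' - t ∈ Ioo (-δ) (T + δ)} := fun t ht =>
    ⟨⟨by linarith [ht.1], by linarith [ht.2]⟩, by linarith [ht.2], by linarith [ht.1]⟩
  have hfst : Prod.fst '' (boundaryL V a c T r δ E ∩ boundaryR V a c T r δ E) =
      (fun t => (Φ t w).1) '' Icc 0 T' := by
    rw [hΓ, image_image]
    refine subset_antisymm ?_ (image_mono hsub)
    rintro _ ⟨t, ⟨ht, ht'⟩, rfl⟩
    -- The arc overshoots the two points at rest, but there the projection turns back and retraces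
    -- itself.
    rcases lt_or_ge t 0 with h | h
    · exact ⟨-t, ⟨by linarith, by linarith [ht.1]⟩, by simp [htime]⟩
    · rcases le_or_gt t T' with h' | h'
      · exact ⟨t, ⟨h, h'⟩, rfl⟩
      · exact ⟨2 * T' - t, ⟨by linarith [ht.2], by linarith⟩, by simp [hneg]⟩
  have hrefl0 : (axisRev w).1 = refl w.1 := rfl
  have hfrL : ∀ t ∈ Icc 0 T', (Φ t w).1 ∈ frontier (well V E a) → t = 0 := by
    intro t ht htf
    by_contra hne
    rcases lt_or_eq_of_le ht.2 with h | h
    · exact (hforb t ⟨lt_of_le_of_ne ht.1 (Ne.symm hne), h⟩).ne' (hfr _ htf).1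
    · have h1 := (hfr _ htf).2
      rw [h, hT'w, hrefl0, refl_apply_zero] at h1
      linarith [hwV.2]
  refine ⟨fun t => Φ t w, T', hlib, ?_, ?_, ?_, ?_, hT'δ, ?_, ?_, ?_, ?_, hfst, ?_, ?_⟩
  · change Φ 0 w = _
    rw [hΦ.zero]
    exact Prod.ext rfl hw2
  · change Φ T' w = _
    rw [hT'w, axisRev_apply, hw2]
    simp [refl]
  · simpa only [hΦ.zero] using hw.2
  · change Φ T' w ∈ _
    rw [hT'w, hcT, mem_ball, dist_axisRev]
    exact hw.2
  · intro c₁ T₁ hc₁ h0 h1 hT₁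
    have hc₁A : c₁ 0 ∈ germ (boundaryLift V E a) (c 0) r := ⟨hc₁.left, h0⟩
    have hc₁R : c₁ T₁ ∈ axisRev '' germ (boundaryLift V E a) (c 0) r := by
      rw [axisRev_image_germ, ← hcT, ← boundaryLift_refl hs]
      exact ⟨hc₁.right, h1⟩
    obtain ⟨p', hp', hp'c⟩ := hc₁R
    have hT₁pos := hc₁.pos
    have hflow := hΦ.eq_of_bichar hV (f := c₁) (a := 0) (b := T₁) (t₀ := 0) ⟨le_rfl, hT₁pos.le⟩
      (fun t _ => hc₁.bichar t trivial) (ρ := c₁ 0)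
      (fun t ht => hA.mem _ hc₁A t ⟨by linarith [ht.1], by linarith [ht.2]⟩) (hΦ.zero _).symm T₁
      ⟨hT₁pos.le, le_rfl⟩
    -- The competing libration joins the germ to its mirror image: it is matched with the times `T₁`
    -- and `0`. Both shifts must equal `α`, and the relation between the times yields `T₁ = T'`.
    obtain ⟨d, d', hd, hd', hd0, hd0', hdd⟩ := hA.match_orbit _ hc₁A _ hp' T₁
      ⟨by linarith, hT₁⟩ 0 ⟨by linarith, by linarith⟩ (by rw [hΦ.zero, hp'c, hflow])
    have e1 : d = α := huniq d hd (by rw [← hd0]; exact hc₁A.1.2)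
    have e2 : d' = α := huniq d' hd' (by rw [← hd0']; exact hp'.1.2)
    subst e1
    refine ⟨?_, by rw [hT']; linarith⟩
    refine eq_of_contDiff ((contDiff_hamField hV).of_le (by simp)) 0
      (fun t => hc₁.bichar t trivial) (fun t => hbichar t trivial) ?_
    rw [hΦ.zero]
    exact hd0
  · rw [boundaryR_eq hs hcT, boundaryL]
    exact hA.isBicharArc hV hΦ hρ
  · rw [hΓ]
    exact image_mono hsub
  · rw [hΓ]
    exact image_subset_range _ _
  · rw [hfst]
    ext x
    constructor
    · rintro ⟨⟨t, ht, rfl⟩, hx⟩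
      have := hfrL t ht hx
      subst this
      simp [hΦ.zero]
    · rintro rfl
      exact ⟨⟨0, ⟨le_rfl, hT'pos.le⟩, by simp only [hΦ.zero]⟩, hw.1.1⟩
  · rw [hfst, frontier_well_refl hs]
    ext x
    constructor
    · rintro ⟨⟨t, ht, rfl⟩, z, hz, hzt⟩
      replace hzt : refl z = (Φ t w).1 := hzt
      have h1 : (Φ (T' - t) w).1 = z := by
        rw [haxis, axisRev_apply]
        change refl (Φ t w).1 = z
        rw [← hzt, refl_refl]
      have h2 := hfrL (T' - t) ⟨by linarith [ht.2], by linarith [ht.1]⟩ (by rwa [h1])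
      rw [h2, hΦ.zero] at h1
      change (Φ t w).1 = refl w.1
      rw [← hzt, h1]
    · rintro rfl
      exact ⟨⟨T', ⟨hT'pos.le, le_rfl⟩, by simp only [hT'w]; rfl⟩, _, hw.1.1, rfl⟩

end Librations

/-! ### Caustics of the tori and tangency of the bicharacteristic -/

section Caustics

open Set Filter Topology Metric

variable {lam : Fin 2 → ℝ} {e : OrthonormalBasis (Fin 2) ℝ Plane} {a : Plane}
  {V : Plane → ℝ} {E T r η δ : ℝ} {c : ℝ → Phase} {Φ : ℝ → Phase → Phase} {Ω : Set Phase}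

theorem mem_tangentConeAt_of_hasDerivAt {F : Type*} [NormedAddCommGroup F] [NormedSpace ℝ F]
    {f : ℝ → F} {v : F} {t : ℝ} {s : Set F} (hf : HasDerivAt f v t) (hs : ∀ᶠ u in 𝓝 t, f u ∈ s) :
    v ∈ tangentConeAt ℝ s (f t) := by
  have h1 := hf.hasFDerivAt.hasFDerivWithinAt (s := f ⁻¹' s) |>.mapsTo_tangent_cone
  have h2 : (1 : ℝ) ∈ tangentConeAt ℝ (f ⁻¹' s) t := by
    rw [tangentConeAt_of_mem_nhds (s := f ⁻¹' s) hs]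
    trivial
  have h3 := h1 h2
  rw [ContinuousLinearMap.toSpanSingleton_apply, one_smul] at h3
  exact tangentConeAt_mono (image_preimage_subset f s) h3

theorem axisRev_mem_tangentConeAt {Λ : Set Phase} {ρ v : Phase} (h : v ∈ tangentConeAt ℝ Λ ρ) :
    axisRev v ∈ tangentConeAt ℝ (axisRev '' Λ) (axisRev ρ) :=
  (axisRev.hasFDerivWithinAt (s := Λ) (x := ρ)).mapsTo_tangent_cone h

theorem refl_mem_tangentConeAt {S : Set Plane} {x v : Plane} (h : v ∈ tangentConeAt ℝ S x) :
    refl v ∈ tangentConeAt ℝ (refl '' S) (refl x) :=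
  ((reflL : Plane →L[ℝ] Plane).hasFDerivWithinAt (s := S) (x := x)).mapsTo_tangent_cone h

theorem refl_image_caustic_subset (Λ : Set Phase) : refl '' caustic Λ ⊆ caustic (axisRev '' Λ) := by
  rintro _ ⟨_, ⟨ρ, ⟨hρ, v, hv0, hv⟩, rfl⟩, rfl⟩
  refine ⟨axisRev ρ, ⟨⟨ρ, hρ, rfl⟩, -refl v, ?_, ?_⟩, rfl⟩
  · rw [Ne, neg_eq_zero]
    intro h
    exact hv0 (by rw [← norm_eq_zero, ← norm_refl, h, norm_zero])
  · have := axisRev_mem_tangentConeAt hv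
    have h1 : axisRev (0, v) = (0, -refl v) := Prod.ext reflL.map_zero rfl
    rwa [h1] at this

/-- `Γ` touches the regular part of the caustic at `ρ`, and the caustic has a tangent line there. -/
structure TouchesAt (V : Plane → ℝ) (Λ : Set Phase) (y : Plane) (ρ : Phase) : Prop where
  mem : ρ ∈ Λ
  caustic : ρ.1 ∈ caustic Λ
  ne : ρ.1 ≠ y
  velocity : (hamField V ρ).1 ≠ 0
  tangent : ∀ k : ℝ, k • (hamField V ρ).1 ∈ tangentConeAt ℝ (Tunnel.caustic Λ) ρ.1

theorem TouchesAt.touches {Λ Γ : Set Phase} {y : Plane} {ρ : Phase} (h : TouchesAt V Λ y ρ)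
    (hΓ : ρ ∈ Γ) : TouchesRegularCaustic V Λ y Γ :=
  ⟨ρ, hΓ, h.mem, h.caustic, h.ne, h.velocity, by simpa using h.tangent 1⟩

theorem TouchesAt.axisRev (hV : ContDiff ℝ ∞ V) (hs : ∀ x, V (refl x) = V x) {Λ : Set Phase}
    {y : Plane} {ρ : Phase} (h : TouchesAt V Λ y ρ) :
    TouchesAt V (axisRev '' Λ) (refl y) (Tunnel.axisRev ρ) := by
  have hv : (hamField V (Tunnel.axisRev ρ)).1 = -refl (hamField V ρ).1 := by
    rw [hamField_axisRev hV hs]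
    rfl
  refine ⟨⟨ρ, h.mem, rfl⟩, refl_image_caustic_subset _ ⟨_, h.caustic, rfl⟩,
    fun h1 => h.ne (refl_injective h1), ?_, fun k => ?_⟩
  · rw [hv, Ne, neg_eq_zero]
    intro h1
    exact h.velocity (by rw [← norm_eq_zero, ← norm_refl, h1, norm_zero])
  · rw [hv, smul_neg, ← neg_smul, ← refl_smul]
    exact tangentConeAt_mono (refl_image_caustic_subset _)
      (refl_mem_tangentConeAt (h.tangent (-k)))

/-- The points of the torus at which the first degree of freedom is at rest lie over the caustic. -/
theorem modelPoint_mem_caustic (hlam : ∀ j, lam j ≠ 0) {y : Plane} (hy : ∀ j, coord e a y j ≠ 0)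
    {ρ₀ : Phase} {τ : ℝ}
    (h : modelPoint lam e a (coord e a y) ![0, τ] ∈
      germ (extTorus lam e a (actions lam e a y)) ρ₀ r) :
    (modelPoint lam e a (coord e a y) ![0, τ]).1 ∈
      caustic (germ (extTorus lam e a (actions lam e a y)) ρ₀ r) := by
  refine ⟨_, ⟨h, (2 * lam 0 ^ 2 * coord e a y 0) • e 0, ?_, ?_⟩, rfl⟩
  · refine smul_ne_zero (mul_ne_zero (mul_ne_zero two_ne_zero (pow_ne_zero _ (hlam 0))) (hy 0)) ?_
    exact e.orthonormal.ne_zero 0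
  · have hd := hasDerivAt_modelPoint_time (lam := lam) (e := e) (a := a) (coord e a y) ![0, τ]
      ![1, 0] 0
    have h1 : (![0, τ] : Fin 2 → ℝ) + (0 : ℝ) • ![1, 0] = ![0, τ] := by simp
    have h2 := mem_tangentConeAt_of_hasDerivAt hd
      (s := germ (extTorus lam e a (actions lam e a y)) ρ₀ r) (by
        have := hd.continuousAt.tendsto.eventually (isOpen_ball.mem_nhds (by
          rw [h1]; exact h.2))
        filter_upwards [this] with s hs
        exact ⟨modelPoint_mem_extTorus y _, hs⟩)
    rw [h1] at h2
    simpa [Fin.sum_univ_two] using h2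

/-- With the oscillator along `e 0` at rest, varying the time of the other one traces a piece of the
caustic in the direction `e 1`, which is also that of the velocity. The condition `τ ≠ 0` makes the
velocity non-zero and separates the point from the umbilic. -/
theorem touchesAt_modelPoint (hlam : ∀ j, lam j ≠ 0) {y : Plane} (hy : ∀ j, coord e a y j ≠ 0)
    {ρ₀ : Phase} {τ : ℝ} (hτ : τ ≠ 0)
    (hVq : V =ᶠ[𝓝 (modelPoint lam e a (coord e a y) ![0, τ]).1] quad lam e a)
    (h : modelPoint lam e a (coord e a y) ![0, τ] ∈
      germ (extTorus lam e a (actions lam e a y)) ρ₀ r) :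
    TouchesAt V (germ (extTorus lam e a (actions lam e a y)) ρ₀ r) y
      (modelPoint lam e a (coord e a y) ![0, τ]) := by
  have hlτ : 2 * lam 1 * τ ≠ 0 := mul_ne_zero (mul_ne_zero two_ne_zero (hlam 1)) hτ
  have hvel : (hamField V (modelPoint lam e a (coord e a y) ![0, τ])).1 =
      (2 * lam 1 * coord e a y 1 * Real.sinh (2 * lam 1 * τ)) • e 1 := by
    rw [hamField_modelPoint hVq]
    simp [Fin.sum_univ_two]
  refine ⟨h, modelPoint_mem_caustic hlam hy h, fun hne => ?_, ?_, fun k => ?_⟩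
  · have h1 := coord_modelPoint (lam := lam) (e := e) (a := a) (coord e a y) ![0, τ] 1
    rw [hne] at h1
    have h2 : Real.cosh (2 * lam 1 * τ) = 1 := by
      refine mul_left_cancel₀ (hy 1) ?_
      rw [mul_one]
      simpa using h1.symm
    exact (Real.one_lt_cosh.2 hlτ).ne' h2
  · rw [hvel]
    refine smul_ne_zero (mul_ne_zero (mul_ne_zero (mul_ne_zero two_ne_zero (hlam 1)) (hy 1)) ?_)
      (e.orthonormal.ne_zero 1)
    exact fun h0 => hlτ (Real.sinh_eq_zero.1 h0)
  · have hd := hasDerivAt_modelPoint_time (lam := lam) (e := e) (a := a) (coord e a y) ![0, τ]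
      ![0, k] 0
    have h1 : (![0, τ] : Fin 2 → ℝ) + (0 : ℝ) • ![0, k] = ![0, τ] := by simp
    have hd1 := (hasFDerivAt_fst (𝕜 := ℝ)).comp_hasDerivAt (0 : ℝ) hd
    have h2 := mem_tangentConeAt_of_hasDerivAt hd1
      (s := caustic (germ (extTorus lam e a (actions lam e a y)) ρ₀ r)) (by
        have := hd.continuousAt.tendsto.eventually (isOpen_ball.mem_nhds (by
          rw [h1]; exact h.2))
        filter_upwards [this] with s hs
        have h3 : (![0, τ] : Fin 2 → ℝ) + s • ![0, k] = ![0, τ + s * k] := by simp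
        rw [Function.comp, h3]
        rw [h3] at hs
        exact modelPoint_mem_caustic hlam hy ⟨modelPoint_mem_extTorus y _, hs⟩)
    rw [Function.comp, h1] at h2
    rw [hvel]
    convert h2 using 1
    simp [Fin.sum_univ_two, smul_smul]
    congr 1
    ring

/-- The points at rest are determined by any point of their orbits. -/
theorem modelPoint_injective_left (hlam : ∀ j, lam j ≠ 0) {p p' t t' : Fin 2 → ℝ}
    (h : modelPoint lam e a p t = modelPoint lam e a p' t') : p = p' := by
  funext j
  have h1 := congrArg (fun ρ : Phase => coord e a ρ.1 j) h
  have h2 := congrArg (fun ρ : Phase => inner ℝ (e j) ρ.2) h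
  simp only [coord_modelPoint, inner_modelPoint_snd, mul_assoc] at h1 h2
  have h3 := mul_left_cancel₀ (hlam j) h2
  have hc := Real.cosh_sq (2 * (lam j * t j))
  have hc' := Real.cosh_sq (2 * (lam j * t' j))
  have hp := Real.cosh_pos (2 * (lam j * t j))
  have hp' := Real.cosh_pos (2 * (lam j * t' j))
  set C := Real.cosh (2 * (lam j * t j))
  set C' := Real.cosh (2 * (lam j * t' j))
  set S := Real.sinh (2 * (lam j * t j))
  set S' := Real.sinh (2 * (lam j * t' j))
  -- The square of the rest coordinate is recovered through cosh² − sinh² = 1, and its sign from the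
  -- positivity of cosh.
  have hsq : p j ^ 2 = p' j ^ 2 := by
    have e1 : (p j * C) ^ 2 = (p' j * C') ^ 2 := by rw [h1]
    have e2 : (p j * S) ^ 2 = (p' j * S') ^ 2 := by rw [h3]
    rw [mul_pow, mul_pow, hc, hc'] at e1
    rw [mul_pow, mul_pow] at e2
    linarith
  rcases sq_eq_sq_iff_eq_or_eq_neg.1 hsq with h4 | h4
  · exact h4
  · have h5 : p' j * (C + C') = 0 := by
      rw [h4] at h1
      linarith
    rcases mul_eq_zero.1 h5 with h6 | h6
    · rw [h4, h6, neg_zero]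
    · linarith

/-- Points of the germ close, along the orbit, to the reference point belong to the intersection of
the flow-outs. -/
theorem IsArcGerm.mem_inter (hV : ContDiff ℝ ∞ V) (hΦ : IsLocalFlow V c Φ Ω) {A : Set Phase}
    {ρ : Phase} (hA : IsArcGerm T Φ Ω η δ A ρ) (hρ : IsAxisOrbit V T Φ Ω E ρ) (hρA : ρ ∈ A)
    {d : ℝ} (hd : |d| < η) (hdδ : |d| < δ) (hdA : Φ (-d) ρ ∈ A) :
    Φ (-d) ρ ∈ flowOut V A (Ioo (-δ) (T + δ)) ∩ flowOut V (axisRev '' A) (Ioo (-(T + δ)) δ) ∧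
    axisRev (Φ (-d) ρ) ∈
      flowOut V A (Ioo (-δ) (T + δ)) ∩ flowOut V (axisRev '' A) (Ioo (-(T + δ)) δ) := by
  obtain ⟨h1, h2⟩ := abs_lt.1 hdδ
  have h3 := hA.delta_le
  have h4 := hA.delta_pos
  have hη : 0 < η := (abs_nonneg d).trans_lt hd
  rw [hA.inter_eq hV hΦ hρ]
  -- The point lies in the germ itself, hence flow time `0` on this side. Its mirror time is reached
  -- from `ρ ∈ A`, with shift `0` and flow time `T + d`.
  have e1 : -(T / 2) - d ∈ flowTimes T Φ η δ A ρ :=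
    ⟨d, hd, hdA, by linarith, by linarith⟩
  have e2 : T / 2 + d ∈ flowTimes T Φ η δ A ρ :=
    ⟨0, by simpa using hη, by simpa [hΦ.zero] using hρA, by linarith, by linarith⟩
  have e3 : -(-(T / 2) - d) = T / 2 + d := by ring
  constructor
  · refine ⟨-(T / 2) - d, ⟨e1, by rwa [e3]⟩, ?_⟩
    change Φ (T / 2 + (-(T / 2) - d)) ρ = _
    congr 1
    ring
  · refine ⟨T / 2 + d, ⟨e2, by rwa [← e3, neg_neg]⟩, ?_⟩
    have := hρ.axisRev_eq hΦ (-(T / 2) - d)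
    rw [show T / 2 + (-(T / 2) - d) = -d by ring] at this
    rw [this]
    change Φ (T / 2 + (T / 2 + d)) ρ = _
    congr 1
    ring

end Caustics

/-! ### Assembly -/

section Main

open Set Filter Topology Metric

variable {lam : Fin 2 → ℝ} {e : OrthonormalBasis (Fin 2) ℝ Plane} {a : Plane}
  {V : Plane → ℝ} {E T r η δ : ℝ} {c : ℝ → Phase} {Φ : ℝ → Phase → Phase} {Ω : Set Phase}

/-- The orbits of points at rest near the left end of the tunnel cycle do not come to rest before
three quarters of the half period. -/
theorem IsSymmetricCycle.eventually_snd_ne_zero (hc : IsSymmetricCycle V E c T)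
    (hΦ : IsLocalFlow V c Φ Ω) (hlam : ∀ j, lam j ≠ 0) (hoff : ∀ j, coord e a (c 0).1 j ≠ 0)
    {ε : ℝ} (hε : 0 < ε)
    (hmod : ∀ p ∈ ball (coord e a (c 0).1) ε, ∀ t ∈ ball (0 : Fin 2 → ℝ) ε,
      V =ᶠ[𝓝 (modelPoint lam e a p t).1] quad lam e a ∧
      ∀ h : ℝ, |h| < ε → Φ h (modelPoint lam e a p t) = modelPoint lam e a p (t + h • 1)) :
    ∀ᶠ w in 𝓝 (c 0), w.2 = 0 → ∀ t ∈ Ioc 0 (3 * T / 4), (Φ t w).2 ≠ 0 := by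
  have hT := hc.pos
  have hcc : Continuous c := continuous_iff_continuousAt.2 fun t => (hc.bichar t).continuousAt
  -- The momentum of the cycle has a positive lower bound away from time `0`, which passes to nearby
  -- orbits. Up to time `ε / 2` the explicit factor sinh is used instead.
  obtain ⟨m, hm, hmc⟩ := (isCompact_Icc (a := ε / 2) (b := 3 * T / 4)).exists_forall_le'
    (f := fun t => ‖(c t).2‖) (a := 0) (by fun_prop) (fun t ht => by
      have h1 := hc.forbidden t ⟨by linarith [ht.1], by linarith [ht.2]⟩
      have h2 := hc.energy t
      rw [symbolQ] at h2
      rw [norm_pos_iff]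
      intro h3
      rw [h3, norm_zero] at h2
      linarith)
  have hco : Tendsto (fun w : Phase => coord e a w.1) (𝓝 (c 0)) (𝓝 (coord e a (c 0).1)) :=
    (continuous_coord.comp continuous_fst).tendsto _
  have hco0 : ∀ᶠ w : Phase in 𝓝 (c 0), coord e a w.1 0 ≠ 0 :=
    ((continuous_apply 0).continuousAt.tendsto.comp hco).eventually_ne (hoff 0)
  filter_upwards [hco.eventually (ball_mem_nhds _ hε), hco0, hΦ.close T m hm] with w hw hw0 hclose
    hrest t ht h0
  rcases lt_or_ge t (ε / 2) with h | h
  · have hw1 : w = modelPoint lam e a (coord e a w.1) 0 := by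
      rw [modelPoint_coord_zero, ← hrest]
    have h1 := (hmod _ hw 0 (mem_ball_self hε)).2 t (by rw [abs_of_pos ht.1]; linarith)
    rw [← hw1] at h1
    have h2 := inner_modelPoint_snd (lam := lam) (e := e) (a := a) (coord e a w.1) (0 + t • 1) 0
    rw [← h1, h0, inner_zero_right] at h2
    have h3 : 2 * lam 0 * t ≠ 0 := mul_ne_zero (mul_ne_zero two_ne_zero (hlam 0)) ht.1.ne'
    refine mul_ne_zero (mul_ne_zero (hlam 0) hw0) (fun h4 => h3 (Real.sinh_eq_zero.1 h4)) ?_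
    simpa using h2.symm
  · have h1 := hclose t ⟨by linarith [ht.1], by linarith [ht.2]⟩
    have h2 := hmc t ⟨h, ht.2⟩
    have h3 : dist (Φ t w).2 (c t).2 ≤ dist (Φ t w) (c t) := le_max_right _ _
    rw [h0, dist_zero_left] at h3
    linarith

theorem tendsto_modelPoint_comp (hrest : (c 0).2 = 0) {t : Plane → Fin 2 → ℝ}
    (ht : Tendsto t (𝓝 (c 0).1) (𝓝 0)) :
    Tendsto (fun y => modelPoint lam e a (coord e a y) (t y)) (𝓝 (c 0).1) (𝓝 (c 0)) := by
  have h1 := (tendsto_modelPoint (lam := lam) (e := e) (a := a) hrest).comp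
    ((continuous_coord.tendsto _).prodMk_nhds ht)
  simpa only [Function.comp_def] using h1

/-- The orbits that reach the axis orthogonally, for a transversal family. -/
theorem IsTransversalFamily.exists_isArcGerm (hV : ContDiff ℝ ∞ V) (hs : ∀ x, V (refl x) = V x)
    (hc : IsSymmetricCycle V E c T) (hΦ : IsLocalFlow V c Φ Ω) {κ : Plane → ℝ × ℝ → Phase}
    (hκ : IsTransversalFamily V c Φ κ) :
    ∃ (η : ℝ) (ε : ℝ) (g : Plane → ℝ × ℝ), 0 < η ∧ 0 < ε ∧ Tendsto g (𝓝 (c 0).1) (𝓝 0) ∧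
      ∀ᶠ y in 𝓝 (c 0).1, IsAxisOrbit V T Φ Ω (V y) (κ y (g y)) ∧
        ∀ (A : Set Phase) (δ : ℝ), (∀ ρ ∈ A, ∃ q ∈ ball (0 : ℝ × ℝ) ε, ρ = κ y q) → 0 < δ →
          δ ≤ T / 8 → (∃ d, |d| < η ∧ Φ (-d) (κ y (g y)) ∈ A) →
          IsArcGerm T Φ Ω η δ A (κ y (g y)) := by
  obtain ⟨η, ε, g, hη, hηT, hε, hg, -, hev⟩ := hκ.exists_orbit hV hs hc hΦ
  refine ⟨η, ε, g, hη, hε, hg, hev.mono ?_⟩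
  rintro y ⟨h1, h2, h3, h4, h5, h6⟩
  refine ⟨⟨h1, h2, h3, h4, h5⟩, fun A δ hA hδ hδT hne => ⟨hδ, hδT, hηT, ?_, ?_, hne⟩⟩
  · intro p hp
    obtain ⟨q, hq, rfl⟩ := hA p hp
    exact (h6 q hq q hq).1
  · intro p hp p' hp'
    obtain ⟨q, hq, rfl⟩ := hA p hp
    obtain ⟨q', hq', rfl⟩ := hA p' hp'
    exact (h6 q hq q' hq').2 δ hδT

/-- Two arcs reaching the axis orthogonally either are disjoint or lie on the same orbit. -/
theorem IsArcGerm.eq_of_not_disjoint (hV : ContDiff ℝ ∞ V) (hΦ : IsLocalFlow V c Φ Ω)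
    {A A' : Set Phase} {ρ ρ' : Phase} {η' E' : ℝ} (hA : IsArcGerm T Φ Ω η δ A ρ)
    (hρ : IsAxisOrbit V T Φ Ω E ρ) (hA' : IsArcGerm T Φ Ω η' δ A' ρ')
    (hρ' : IsAxisOrbit V T Φ Ω E' ρ')
    (h : ¬Disjoint
      (flowOut V A (Ioo (-δ) (T + δ)) ∩ flowOut V (axisRev '' A) (Ioo (-(T + δ)) δ))
      (flowOut V A' (Ioo (-δ) (T + δ)) ∩ flowOut V (axisRev '' A') (Ioo (-(T + δ)) δ))) :
    ρ = ρ' := by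
  rw [hA.inter_eq hV hΦ hρ, hA'.inter_eq hV hΦ hρ', not_disjoint_iff] at h
  obtain ⟨_, ⟨u, hu, rfl⟩, u', hu', h⟩ := h
  have hT : 0 < T := by linarith [hA.delta_pos, hA.delta_le]
  have h1 := hA.arcTimes_subset hu
  have h2 := hA'.arcTimes_subset hu'
  have h3 : ∀ v, Φ (T / 2 + u + v) ρ = Φ (T / 2 + u' + v) ρ' := fun v => by
    rw [add_comm _ v, hΦ.add v, add_comm _ v, hΦ.add v]
    exact congrArg (Φ v) h.symm
  -- Both orbits cross exactly at `T / 2`, so any small `η` serves; 3/16 = 11/16 − 1/2 is the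
  -- overshoot that the arcs allow.
  have h4 := hρ.crosses.sub_eq_sub hρ'.crosses (η := T / 64) (δ := 3 * T / 16) (t := T / 2 + u)
    (s := T / 2 + u') (by simpa using hT) (by simpa using hT)
    ⟨by linarith [h1.1], by linarith [h1.2]⟩ ⟨by linarith [h2.1], by linarith [h2.2]⟩
    (by linarith) h3
  have h5 := h3 (-(T / 2 + u))
  rw [show T / 2 + u' = T / 2 + u by linarith, add_neg_cancel, hΦ.zero, hΦ.zero] at h5
  exact h5

end Main

end Tunnel

open Tunnel Set Filter Topology Metric in
theorem claim1 (V : Tunnel.Plane → ℝ) (E : ℝ) (a : Tunnel.Plane) (lam : Fin 2 → ℝ)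
    (e : OrthonormalBasis (Fin 2) ℝ Tunnel.Plane)
    (hV : Tunnel.IsDoubleWell V E a lam e)
    (c : ℝ → Tunnel.Phase) (T : ℝ)
    (hc : Tunnel.IsMinimalTunnelCycle V a E c T)
    (hoff : ∀ j, inner ℝ (e j) ((c 0).1 - a) ≠ 0) :
    ∃ r₀ > 0, ∀ r ∈ Set.Ioo 0 r₀, ∀ δ ∈ Set.Ioo 0 r₀, ∀ᶠ y in nhds (c 0).1,
      ∃ y' : Tunnel.Plane,
        Tunnel.IsLibrationLift V a c T r δ (V y) y'
          (Tunnel.boundaryL V a c T r δ (V y) ∩ Tunnel.boundaryR V a c T r δ (V y)) ∧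
        Tunnel.IsTunnelBichar V (V y)
          (Tunnel.torusL a lam e c r y) (Tunnel.torusR a lam e c T r y)
          (Tunnel.torusExtL V a lam e c T r δ y ∩ Tunnel.torusExtR V a lam e c T r δ y) ∧
        Tunnel.CrossesAxisOrthogonally V
          (Tunnel.torusExtL V a lam e c T r δ y ∩ Tunnel.torusExtR V a lam e c T r δ y) ∧
        (y = y' → ((y, 0) : Tunnel.Phase) ∈
          Tunnel.torusExtL V a lam e c T r δ y ∩ Tunnel.torusExtR V a lam e c T r δ y) ∧
        (y ≠ y' →
          Tunnel.TouchesRegularCaustic V (Tunnel.torusL a lam e c r y) y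
            (Tunnel.torusExtL V a lam e c T r δ y ∩ Tunnel.torusExtR V a lam e c T r δ y) ∧
          Tunnel.TouchesRegularCaustic V (Tunnel.torusR a lam e c T r y) (Tunnel.refl y)
            (Tunnel.torusExtL V a lam e c T r δ y ∩ Tunnel.torusExtR V a lam e c T r δ y) ∧
          Disjoint
            (Tunnel.boundaryL V a c T r δ (V y) ∩ Tunnel.boundaryR V a c T r δ (V y))
            (Tunnel.torusExtL V a lam e c T r δ y ∩
              Tunnel.torusExtR V a lam e c T r δ y)) := by
  have hs := hc.isSymmetricCycle hV
  have hT := hs.pos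
  have hVs := hV.smooth
  have hrest := hs.rest
  have hcT : c T = axisRev (c 0) := by simpa using hs.axisRev_eq 0
  have hlam : ∀ j, lam j ≠ 0 := Fin.forall_fin_two.2
    ⟨hV.lam_pos.ne', (hV.lam_pos.trans hV.lam_lt).ne'⟩
  have hoff' : ∀ j, coord e a (c 0).1 j ≠ 0 := hoff
  obtain ⟨ε₀, hε₀, hquad, hwell⟩ := hV.exists_wells
    ⟨_, (isClosed_well hVs.continuous E a).frontier_subset hc.libration.left.1⟩
  have hq0 : quad lam e a (c 0).1 = E := by
    have := hc.libration.left.1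
    rwa [(hwell E ⟨hV.pos, by linarith⟩).2] at this
  have hVq0 := (hquad (c 0).1 (by linarith)).1
  have hV0 : V (c 0).1 = E := hVq0.eq_of_nhds.trans hq0
  obtain ⟨Φ, Ω, hΦ⟩ := exists_isLocalFlow hVs hV.symm (fun t _ => hs.bichar t) (by linarith)
    hs.periodic
  obtain ⟨εm, hεm, hmod⟩ := hΦ.exists_model_flow hVs hrest hq0 hε₀ fun x hx => (hquad x hx).1
  have hκT := isTransversalFamily_torusFamily hVs hrest hlam hoff' hεm hmod hVq0
  have hκB := isTransversalFamily_boundaryFamily hVs hrest hlam hoff' hεm hmod hV.pos hV0 hq0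
  set κT := torusFamily lam e a with hκTdef
  set κB := boundaryFamily V lam e a (coord e a (c 0).1) E with hκBdef
  obtain ⟨ηT, εT, gT, hηT, hεT, hgT, hevT⟩ := hκT.exists_isArcGerm hVs hV.symm hs hΦ
  obtain ⟨ηB, εB, gB, hηB, hεB, hgB, hevB⟩ := hκB.exists_isArcGerm hVs hV.symm hs hΦ
  obtain ⟨εs, hεs, hshift⟩ := hκB.shift
  obtain ⟨r₁, hr₁, hr₁T⟩ := eventually_nhds_iff_ball.1 (eventually_extTorus (a := a) hlam hoff'
    hrest hεT)
  obtain ⟨r₂, hr₂, hr₂B⟩ := eventually_nhds_iff_ball.1 (eventually_boundary (a := a) (V := V) hlam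
    hV.pos hq0 hεB)
  -- The radii `r₁` and `r₂` make the torus and boundary germs parametrised; `T / 8` is the bound on
  -- `δ`.
  refine ⟨min r₁ (min r₂ (T / 8)), by positivity, ?_⟩
  rintro r ⟨hr0, hr⟩ δ ⟨hδ0, hδ⟩
  obtain ⟨hrr₁, hr'⟩ := lt_min_iff.1 hr
  have hrr₂ := (lt_min_iff.1 hr').1
  have hδT := ((lt_min_iff.1 (lt_min_iff.1 hδ).2).2).le
  have hgB1 : Tendsto (fun y => (gB y).1) (𝓝 (c 0).1) (𝓝 0) :=
    (continuous_fst.tendsto (0 : ℝ × ℝ)).comp hgB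
  have hgB2 : Tendsto (fun y => (gB y).2) (𝓝 (c 0).1) (𝓝 0) :=
    (continuous_snd.tendsto (0 : ℝ × ℝ)).comp hgB
  have hwt : Tendsto (fun y => κB y (0, (gB y).2)) (𝓝 (c 0).1) (𝓝 (c 0)) := by
    obtain ⟨κ', -, -, hstrict, -⟩ := hκB.strict
    have h1 : Tendsto (fun y => (y, ((0 : ℝ), (gB y).2))) (𝓝 (c 0).1) (𝓝 ((c 0).1, 0)) :=
      tendsto_id.prodMk_nhds (tendsto_const_nhds.prodMk_nhds hgB2)
    have h2 := hstrict.hasFDerivAt.continuousAt.tendsto.comp h1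
    simp only [hκB.base] at h2
    exact h2
  set tT : Plane → Fin 2 → ℝ := fun y => (gT y).1 • 1 + (gT y).2 • ![1, -1] with htT
  have htT0 : Tendsto tT (𝓝 (c 0).1) (𝓝 0) := by
    have h1 : Continuous fun q : ℝ × ℝ => q.1 • (1 : Fin 2 → ℝ) + q.2 • (![1, -1] : Fin 2 → ℝ) := by
      fun_prop
    have h2 := (h1.tendsto 0).comp hgT
    rwa [Prod.fst_zero, Prod.snd_zero, zero_smul, zero_smul, add_zero] at h2
  have htT00 : Tendsto (fun y => tT y 0) (𝓝 (c 0).1) (𝓝 0) :=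
    ((continuous_apply (0 : Fin 2)).tendsto (0 : Fin 2 → ℝ)).comp htT0
  have hco : Tendsto (coord e a) (𝓝 (c 0).1) (𝓝 (coord e a (c 0).1)) := continuous_coord.tendsto _
  -- Flowing by minus the first time brings the first oscillator to rest: this is the candidate for
  -- the contact with the caustic.
  have hsT : Tendsto (fun y => tT y + (-tT y 0) • 1) (𝓝 (c 0).1) (𝓝 0) := by
    have := htT0.add (htT00.neg.smul_const (1 : Fin 2 → ℝ))
    simpa using this
  have hρT : Tendsto (fun y => modelPoint lam e a (coord e a y) (tT y)) (𝓝 (c 0).1) (𝓝 (c 0)) :=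
    tendsto_modelPoint_comp hrest htT0
  have hρc : Tendsto (fun y => modelPoint lam e a (coord e a y) (tT y + (-tT y 0) • 1))
      (𝓝 (c 0).1) (𝓝 (c 0)) := tendsto_modelPoint_comp hrest hsT
  have hy0 : Tendsto (fun y : Plane => ((y, 0) : Phase)) (𝓝 (c 0).1) (𝓝 (c 0)) := by
    have : Tendsto (fun y : Plane => ((y, 0) : Phase)) (𝓝 (c 0).1) (𝓝 ((c 0).1, 0)) :=
      tendsto_id.prodMk_nhds tendsto_const_nhds
    rwa [show ((c 0).1, (0 : Plane)) = c 0 from Prod.ext rfl hrest.symm] at this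
  have hoffy : ∀ᶠ y in 𝓝 (c 0).1, ∀ j, coord e a y j ≠ 0 := eventually_all.2 fun j =>
    ((continuous_apply j).continuousAt.tendsto.comp hco).eventually_ne (hoff' j)
  have habs : ∀ {f : Plane → ℝ} {k : ℝ}, Tendsto f (𝓝 (c 0).1) (𝓝 0) → 0 < k →
      ∀ᶠ y in 𝓝 (c 0).1, |f y| < k := fun hf hk => by
    have := hf.abs
    rw [abs_zero] at this
    exact this.eventually_lt_const hk
  have hVt : Tendsto V (𝓝 (c 0).1) (𝓝 E) := by
    have := hVs.continuous.tendsto (c 0).1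
    rwa [hV0] at this
  have hsqrt : ∀ᶠ y in 𝓝 (c 0).1, 0 < V y / E - (gB y).2 ^ 2 :=
    (tendsto_id.prodMk_nhds hgB2).eventually (eventually_sqrt_pos hVs.continuous hV.pos hV0)
  have hmom := hwt.eventually (hs.eventually_snd_ne_zero hΦ hlam hoff' hεm hmod)
  filter_upwards [ball_mem_nhds _ hr₁, hevT, hevB, hVt.eventually_const_lt hV.pos,
    hVt.eventually_lt_const (show E < E + ε₀ by linarith), hVq0, hoffy,
    hco.eventually (ball_mem_nhds _ hεm), htT0.eventually (ball_mem_nhds _ hεm),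
    hsT.eventually (ball_mem_nhds _ hεm), habs htT00 (lt_min (lt_min hηT hδ0) hεm),
    hρT.eventually (ball_mem_nhds _ hr0), hρc.eventually (ball_mem_nhds _ hr0),
    hy0.eventually (ball_mem_nhds _ hr0), hwt.eventually (ball_mem_nhds _ hr0),
    habs hgB1 (lt_min (lt_min hηB (half_pos hδ0)) hεs), habs hgB2 hεs, ball_mem_nhds _ hεs, hsqrt,
    hmom] with y hyr₁ hyT hyB hVpos hVlt hVqy hoffy hcoy htTy hsTy ht0 hρTr hρcr hy0r hwr hα hβ hys
    hsq hmomy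
  obtain ⟨hwl, hfr⟩ := hwell (V y) ⟨hVpos, hVlt⟩
  obtain ⟨hoT, hgermT⟩ := hyT
  obtain ⟨hoB, hgermB⟩ := hyB
  set α := (gB y).1 with hαdef
  set ρB := κB y (gB y) with hρBdef
  set ρT := κT y (gT y) with hρTdef
  have hρTm : ρT = modelPoint lam e a (coord e a y) (tT y) := rfl
  obtain ⟨hαη', hαs⟩ := lt_min_iff.1 hα
  obtain ⟨hαη, hαδ⟩ := lt_min_iff.1 hαη'
  obtain ⟨ht0', ht0m⟩ := lt_min_iff.1 ht0
  obtain ⟨ht0η, ht0δ⟩ := lt_min_iff.1 ht0'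
  have hw : Φ (-α) ρB = κB y (0, (gB y).2) := by
    have := hshift y hys α (gB y).2 (-α) hαs hβ (by rwa [abs_neg])
    rwa [add_neg_cancel] at this
  have hwq := boundaryFamily_zero (lam := lam) (e := e) (a := a) hlam hV.pos hq0 hsq.le
  have hwA : Φ (-α) ρB ∈ germ (boundaryLift V (V y) a) (c 0) r := by
    rw [hw]
    refine ⟨⟨?_, hwq.2⟩, hwr⟩
    rw [hfr]
    exact hwq.1
  have hAB : IsArcGerm T Φ Ω ηB δ (germ (boundaryLift V (V y) a) (c 0) r) ρB := by
    refine hgermB _ δ ?_ hδ0 hδT ⟨α, hαη, hwA⟩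
    rintro ρ ⟨⟨hρ1, hρ2⟩, hρr⟩
    rw [hfr] at hρ1
    obtain ⟨β, hβ, hρ⟩ := hr₂B ρ (ball_subset_ball hrr₂.le hρr) y hρ1 hρ2
    refine ⟨(0, β), ?_, hρ⟩
    rw [mem_ball_zero_iff, Prod.norm_def, norm_zero]
    exact max_lt hεB hβ
  have hρTA : ρT ∈ torusL a lam e c r y := ⟨modelPoint_mem_extTorus y _, hρTr⟩
  have hAT : IsArcGerm T Φ Ω ηT δ (torusL a lam e c r y) ρT := by
    refine hgermT _ δ ?_ hδ0 hδT ⟨0, by simpa using hηT, by rwa [neg_zero, hΦ.zero]⟩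
    rintro ρ ⟨hρ, hρr⟩
    refine hr₁T (y, ρ) ?_ hρ
    rw [← ball_prod_same]
    exact ⟨hyr₁, ball_subset_ball hrr₁.le hρr⟩
  have hfrV : ∀ x ∈ frontier (well V (V y) a), V x = V y ∧ x 0 < 0 := by
    intro x hx
    rw [hfr] at hx
    have hx' : quad lam e a x = V y := hx
    have h1 := hquad x (by linarith)
    exact ⟨h1.1.eq_of_nhds.trans hx', h1.2⟩
  have hmomw : ∀ t ∈ Ioc 0 (3 * T / 4), (Φ t (Φ (-α) ρB)).2 ≠ 0 := by
    rw [hw]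
    exact hmomy hwq.2
  have hLR : torusExtL V a lam e c T r δ y ∩ torusExtR V a lam e c T r δ y =
      flowOut V (torusL a lam e c r y) (Ioo (-δ) (T + δ)) ∩
        flowOut V (axisRev '' torusL a lam e c r y) (Ioo (-(T + δ)) δ) := by
    rw [torusExtL, torusExtR, torusR_eq hcT]
  have hαδ' : 2 * α < δ := by linarith [(abs_lt.1 hαδ).2]
  have hlift := isLibrationLift_inter hVs hV.symm hΦ hcT hAB hoB hαη hαδ' hwA hmomw hfrV
  set w := Φ (-α) ρB with hwdef
  have hw2 : w.2 = 0 := hwA.1.2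
  have hΦT' : Φ (T + 2 * α) w = axisRev w := by
    have h1 := hoB.axisRev_eq hΦ (-(T / 2) - α)
    rw [show T / 2 + (-(T / 2) - α) = -α by ring, ← hwdef] at h1
    rw [h1, hwdef, ← hΦ.add]
    congr 1
    ring
  refine ⟨w.1, hlift, ?_, ?_, ?_, fun hne => ?_⟩
  · rw [hLR]
    have h1 := hAT.mem_inter hVs hΦ hoT hρTA (d := 0) (by simpa using hηT) (by simpa using hδ0)
      (by rwa [neg_zero, hΦ.zero])
    rw [neg_zero, hΦ.zero] at h1
    refine ⟨hAT.isBicharArc hVs hΦ hoT, ⟨ρT, h1.1, hρTA⟩, axisRev ρT, h1.2, ?_⟩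
    rw [torusR_eq hcT]
    exact ⟨_, hρTA, rfl⟩
  · rw [hLR]
    exact hAT.crossesAxisOrthogonally hVs hΦ hoT
  · intro hyw
    have hyw' : ((y, 0) : Phase) = w := Prod.ext hyw hw2.symm
    have hyA : ((y, 0) : Phase) ∈ torusL a lam e c r y := by
      refine ⟨?_, hy0r⟩
      rw [← modelPoint_coord_zero (lam := lam) (e := e) (a := a)]
      exact modelPoint_mem_extTorus y 0
    rw [hLR]
    obtain ⟨h1, h2⟩ := abs_lt.1 hαδ
    -- The point (y, 0) lies in the left flow-out at time `0`. It is also the mirror image of the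
    -- other end of its own libration, reached at time `T + 2 * α`, and so lies in the right
    -- flow-out.
    refine ⟨(hAT.mem_left hVs hΦ).2 ⟨_, hyA, 0, ⟨by linarith, by linarith⟩, hΦ.zero _⟩,
      (hAT.mem_right hVs hΦ).2 ⟨_, hyA, T + 2 * α, ⟨by linarith, by linarith⟩, ?_⟩⟩
    rw [hyw', hΦT', axisRev_axisRev]
  · have hρc : Φ (-tT y 0) ρT = modelPoint lam e a (coord e a y) ![0, tT y 1 - tT y 0] := by
      rw [hρTm, (hmod _ hcoy _ htTy).2 _ (by rwa [abs_neg])]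
      congr 1
      funext j
      fin_cases j <;> simp [sub_eq_add_neg]
    have hvec : tT y + (-tT y 0) • 1 = ![0, tT y 1 - tT y 0] := by
      funext j
      fin_cases j <;> simp [sub_eq_add_neg]
    rw [hvec] at hρcr hsTy
    -- If both oscillators came to rest together, the orthogonal orbit of the torus would pass
    -- through (y, 0), which is in the boundary germ. Then `match_orbit`, applied at its crossing of
    -- the axis, makes `y` the end point of the libration.
    have hτ : tT y 1 - tT y 0 ≠ 0 := by
      intro h0
      have hy1 : Φ (-tT y 0) ρT = (y, 0) := by
        rw [hρc, h0, ← modelPoint_coord_zero (lam := lam) (e := e) (a := a)]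
        congr 1
        funext j
        fin_cases j <;> rfl
      have hyB : ((y, 0) : Phase) ∈ germ (boundaryLift V (V y) a) (c 0) r := by
        refine ⟨⟨?_, rfl⟩, hy0r⟩
        rw [hfr]
        exact hVqy.symm
      obtain ⟨h1, h2⟩ := abs_lt.1 ht0δ
      have hsx : Φ (T / 2 + tT y 0) (y, 0) = Φ (T / 2) ρT := by
        rw [← hy1, ← hΦ.add]
        congr 1
        ring
      have hI : T / 2 + tT y 0 ∈ Ioo (-δ) (T + δ) := ⟨by linarith, by linarith⟩
      obtain ⟨d, -, hdη, -, hyd, -, -⟩ := hAB.match_orbit _ hyB _ hyB _ hI _ hI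
        (by rw [hsx, hoT.symm])
      have hdα := hΦ.eq_of_rest hAB.eta_le hαη hdη hw2 hmomw (by rw [← hyd])
      rw [hdα] at hyd
      exact hne (congrArg Prod.fst hyd)
    have hm : modelPoint lam e a (coord e a y) ![0, tT y 1 - tT y 0] ∈
        torusL a lam e c r y := ⟨modelPoint_mem_extTorus y _, hρcr⟩
    have htouch := touchesAt_modelPoint hlam hoffy hτ (hmod _ hcoy _ hsTy).1 hm
    rw [← hρc] at hm htouch
    have hmem := hAT.mem_inter hVs hΦ hoT hρTA ht0η ht0δ hm
    rw [hLR]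
    refine ⟨htouch.touches hmem.1, ?_, ?_⟩
    · rw [torusR_eq hcT]
      exact (htouch.axisRev hVs hV.symm).touches hmem.2
    · by_contra hdis
      rw [boundaryR_eq hV.symm hcT, boundaryL] at hdis
      -- The two reference points coincide. Each is a point of an explicit orbit, so the rest
      -- coordinates agree, and those of the torus are the coordinates of `y`.
      have h1 := hAB.eq_of_not_disjoint hVs hΦ hoB hAT hoT hdis
      have h2 : boundaryCoord V lam (coord e a (c 0).1) E y (gB y).2 = coord e a y :=
        modelPoint_injective_left hlam h1
      refine hne ?_
      refine eq_of_coord_eq (e := e) (a := a) fun j => ?_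
      rw [hw, ← h2, hκBdef, boundaryFamily, modelFamily, coord_modelPoint]
      simp
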